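/- Let $g\ge 0$ and $n\ge 1$ be integers and let $\mu,\nu$ be partitions of $n$, with $\ell(\mu),\ell(\nu)$ parts. Put $b=\frac{2g-2+2\ell(\mu)+2\ell(\nu)}{2}=g-1+\ell(\mu)+\ell(\nu)$ (so $b\geq 1$). **Twisted double Hurwitz number.** Let $\tau=(1\ n{+}1)(2\ n{+}2)\cdots(n\ 2n)\in S_{2n}$. For a partition $\lambda$ of $n$, let $2\lambda$ be the partition of $2n$ in which every part of $\lambda$ is repeated once more, and let $B^\sim_\lambda$ be the set of $\sigma\in S_{2n}$ of cycle type $2\lambda$ (fixed points counted as cycles of length one) with $\tau\sigma\tau=\sigma^{-1}$ such that no cycle $c$ of $\sigma$ satisfies $\tau c\tau=c^{-1}$ as a map of its own support (i.e. the cycles are exchanged in pairs by $c\mapsto\tau c^{-1}\tau$). Let $C_g(\mu,\nu)$ be the set of tuples $(\sigma_1,\eta_1,\dots,\eta_b,\sigma_2)$ in $S_{2n}$ such that $\sigma_1\in B^\sim_\mu$, $\sigma_2$ has cycle type $2\nu$, every $\eta_i$ is a transposition with $\eta_i\ne\tau\eta_i\tau$, $$\eta_b\cdots\eta_1\,\sigma_1\,(\tau\eta_1\tau)\cdots(\tau\eta_b\tau)=\sigma_2,$$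 and the subgroup $\langle\sigma_1,\eta_1,\dots,\eta_b,\tau\eta_1\tau,\dots,\tau\eta_b\tau,\sigma_2\rangle$ acts transitively on $\{1,\dots,2n\}$. Put $\tilde h_g(\mu,\nu)=\frac{1}{(2n)!!}\,|C_g(\mu,\nu)|$. **Tropical counterpart.** Fix real points $p_1<\dots<p_b$. A twisted tropical cover of type $(g,\mu,\nu)$ is a finite connected metric graph $\Gamma$, whose internal edges have finite positive length and whose ends are unbounded, with a map $\pi:\Gamma\to\mathbb R$ and an involution $\iota$ of $\Gamma$ with $\pi\circ\iota=\pi$, such that: * $\pi$ is linear on every edge $e$, with integer slope of absolute value $\omega(e)$ (the weight of $e$), and every end is mapped onto an unbounded ray; * $\pi$ is harmonic: at every vertex the sum of the weights of the adjacent edges leaving to the left equals the sum of the weights of those leaving to the right; * every vertex lies over some $p_i$, and over each $p_i$ there are either exactly two vertices, both three-valent, or exactly one vertex, which is four-valent (an edge may pass over a $p_i$ without having a vertex there); * the ends going to $-\infty$ are $\ell(\mu)$ pairs with weights $\mu_1,\dots,\mu_{\ell(\mu)}$, and those going to $+\infty$ are $\ell(\nu)$ pairs with weights $\nu_1,\dots,\nu_{\ell(\nu)}$;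 * the edges adjacent to a four-valent vertex all have the same weight; * the set of points of $\Gamma$ fixed by $\iota$ is exactly the set of four-valent vertices. Isomorphisms of twisted tropical covers are isomorphisms of metric graphs that commute with the maps to $\mathbb R$ and with the involutions; two covers are equivalent if they are isomorphic, and $\mathrm{Aut}(\pi)$ is the group of automorphisms. The multiplicity of a cover is $$2^{b}\cdot\frac{1}{|\mathrm{Aut}(\pi)|}\cdot\prod_{V}(\omega_V-1)\cdot\prod_{e}\omega(e),$$ where $V$ runs over the four-valent vertices of $\Gamma$, $\omega_V$ is the weight of the edges adjacent to $V$, and $e$ runs over the internal edges of the quotient graph $\Gamma/\iota$. Let $\tilde h^{\mathrm{trop}}_g(\mu,\nu)$ be the sum of the multiplicities of all equivalence classes of twisted tropical covers of type $(g,\mu,\nu)$ with branch points $p_1,\dots,p_b$. **Theorem (Correspondence Theorem).** For every $g\ge 0$, all partitions $\mu,\nu$ of the same positive integer $n$ and all branch points $p_1<\dots<p_b$, only finitely many equivalence classes have non-zero multiplicity, and $$\tilde h_g(\mu,\nu)=\tilde h^{\mathrm{trop}}_g(\mu,\nu).$$ -/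

import Mathlib

open scoped ENNReal

noncomputable section

/-! ## Twisted double Hurwitz numbers -/

/-- The fixed-point free involution `(1 n+1)(2 n+2)⋯(n 2n)`. The set `{1, …, 2n}` is
`Fin n ⊕ Fin n`, where `inl i` plays the role of `i` and `inr i` that of `n + i`. -/
def tau (n : ℕ) : Equiv.Perm (Fin n ⊕ Fin n) := Equiv.sumComm (Fin n) (Fin n)

/-- `C^∼(τ)`: the permutations with `τ σ τ = σ⁻¹`. -/
def CTilde (n : ℕ) : Set (Equiv.Perm (Fin n ⊕ Fin n)) :=
  {σ | tau n * σ * tau n = σ⁻¹}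

/-- `B^∼_n`: the elements of `C^∼(τ)` without self-symmetric cycles, that is, without a cycle `c`
such that `τ c τ = c⁻¹`. (A cycle of length one is never self-symmetric as `τ` has no fixed
point, so only the nontrivial cycles have to be looked at.) -/
def BTilde (n : ℕ) : Set (Equiv.Perm (Fin n ⊕ Fin n)) :=
  {σ | σ ∈ CTilde n ∧ ∀ c ∈ σ.cycleFactorsFinset, tau n * c * tau n ≠ c⁻¹}

/-- `C(σ) = 2λ`: the lengths of the cycles of `σ` (fixed points included) are the parts of `λ`,
each repeated once more. -/
def HasDoubledCycleType {n : ℕ} (σ : Equiv.Perm (Fin n ⊕ Fin n)) (lam : n.Partition) : Prop :=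
  σ.partition.parts = 2 • lam.parts

/-- `B^∼_λ`: the elements of `B^∼_n` of cycle type `2λ`; the involution `c ↦ τ c⁻¹ τ` pairs up
the cycles of each length. -/
def BTildeOf {n : ℕ} (lam : n.Partition) : Set (Equiv.Perm (Fin n ⊕ Fin n)) :=
  {σ | σ ∈ BTilde n ∧ HasDoubledCycleType σ lam}

/-- The number of branch points `b = (2g - 2 + 2ℓ(μ) + 2ℓ(ν)) / 2`. As `ℓ(μ), ℓ(ν) ≥ 1` for
partitions of a positive integer, the subtraction does not truncate and `b > 0`. -/
def numBranch {n : ℕ} (g : ℕ) (μ ν : n.Partition) : ℕ :=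
  g + Multiset.card μ.parts + Multiset.card ν.parts - 1

/-- The set `C_g(μ, ν)` of transitive twisted factorisations `(σ₁, (η₁, …, η_b), σ₂)`. -/
def twistedFactorisations {n : ℕ} (g : ℕ) (μ ν : n.Partition) :
    Set (Equiv.Perm (Fin n ⊕ Fin n) × (Fin (numBranch g μ ν) → Equiv.Perm (Fin n ⊕ Fin n)) ×
      Equiv.Perm (Fin n ⊕ Fin n)) :=
  {x | match x with
    | (σ₁, η, σ₂) =>
      HasDoubledCycleType σ₁ μ ∧ HasDoubledCycleType σ₂ ν ∧
      (∀ i, (η i).IsSwap ∧ η i ≠ tau n * η i * tau n) ∧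
      σ₁ ∈ BTildeOf μ ∧
      (List.ofFn η).reverse.prod * σ₁ * (List.ofFn fun i => tau n * η i * tau n).prod = σ₂ ∧
      MulAction.IsPretransitive
        (Subgroup.closure
          ({σ₁, σ₂} ∪ Set.range η ∪ Set.range fun i => tau n * η i * tau n))
        (Fin n ⊕ Fin n)}

/-- The twisted double Hurwitz number `h̃_g(μ, ν) = |C_g(μ, ν)| / (2n)!!`. -/
def twistedHurwitz {n : ℕ} (g : ℕ) (μ ν : n.Partition) : ℚ :=
  (Nat.card (twistedFactorisations g μ ν) : ℚ) / (Nat.doubleFactorial (2 * n) : ℚ)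

/-! ## Tropical curves and covers of the line -/

/-- An abstract tropical curve (explicit: without genus at vertices), as a finite connected metric
graph. It is given by its vertices `V` other than leaves, its half-edges `H`, the vertex `root h`
that a half-edge starts from, and the involution `inv` exchanging the two halves of an edge. The
internal edges are the pairs `{h, inv h}` with `inv h ≠ h`; the ends are the `h` with
`inv h = h` (the leaf at infinity is not recorded). Loops and multiple edges are allowed. -/
structure TropicalCurve : Type 1 where
  V : Type
  H : Type
  [fintypeV : Fintype V]
  [fintypeH : Fintype H]
  root : H → V
  inv : H → H
  inv_inv : ∀ h, inv (inv h) = h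
  /-- the length of the edge that a half-edge belongs to -/
  length : H → ℝ≥0∞
  length_inv : ∀ h, length (inv h) = length h
  length_pos : ∀ h, 0 < length h
  /-- exactly the ends have infinite length -/
  length_eq_top_iff : ∀ h, length h = ⊤ ↔ inv h = h
  /-- leaves are not recorded as vertices -/
  valence_ne_one : ∀ v, Nat.card {h // root h = v} ≠ 1
  nonempty : Nonempty V
  connected : ∀ v w,
    Relation.ReflTransGen (fun a c => ∃ h, root h = a ∧ root (inv h) = c) v w

attribute [instance] TropicalCurve.fintypeV TropicalCurve.fintypeH

/-- The valence of a vertex (a loop counts twice). -/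
def TropicalCurve.valence (Γ : TropicalCurve) (v : Γ.V) : ℕ := Nat.card {h // Γ.root h = v}

open Classical in
/-- A tropical cover `π : Γ → ℝ` of the real line: a harmonic map that is linear with integer slope
on every edge. On the half-edge `h`, read as an interval starting in `0` at `root h`, it is
`t ↦ pos (root h) + slope h * t`. An internal edge may be contracted (slope `0`); the ends cover
unbounded rays. The points of `ℝ` at which the line is subdivided do not subdivide the
edges of `Γ`: no two-valent vertices are inserted where an edge passes over such a point. -/
structure TropicalCover : Type 1 extends TropicalCurve where
  pos : V → ℝ
  slope : H → ℤ
  slope_inv : ∀ h, inv h ≠ h → slope (inv h) = - slope h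
  slope_end : ∀ h, inv h = h → slope h ≠ 0
  pos_inv : ∀ h, inv h ≠ h →
    pos (root (inv h)) = pos (root h) + (slope h : ℝ) * (length h).toReal
  /-- harmonicity: the local degrees to the left and to the right agree -/
  harmonic : ∀ v,
    ∑ h ∈ Finset.univ.filter (fun h => root h = v ∧ slope h < 0), (slope h).natAbs =
    ∑ h ∈ Finset.univ.filter (fun h => root h = v ∧ 0 < slope h), (slope h).natAbs

/-- The weight `ω(e)` of the edge `e` that a half-edge belongs to. -/
def TropicalCover.weight (π : TropicalCover) (h : π.H) : ℕ := (π.slope h).natAbs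

/-! ## Twisted tropical covers -/

open Classical in
/-- A twisted tropical cover of type `(g, μ, ν)` with branch points `p₁ < ⋯ < p_b`: a tropical
cover of `ℝ` with an involution `ι` (given on vertices and on half-edges) respecting it.
(The surjectivity of the cover follows from connectedness and the presence of ends in both
directions; the first Betti number of the source is `g` by an Euler characteristic count.) -/
structure TwistedTropicalCover {n : ℕ} (g : ℕ) (μ ν : n.Partition)
    (p : Fin (numBranch g μ ν) → ℝ) : Type 1 extends TropicalCover where
  iotaV : V → V
  iotaH : H → H
  iotaV_iotaV : ∀ v, iotaV (iotaV v) = v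
  iotaH_iotaH : ∀ h, iotaH (iotaH h) = h
  iota_root : ∀ h, root (iotaH h) = iotaV (root h)
  iota_inv : ∀ h, inv (iotaH h) = iotaH (inv h)
  iota_length : ∀ h, length (iotaH h) = length h
  iota_pos : ∀ v, pos (iotaV v) = pos v
  iota_slope : ∀ h, slope (iotaH h) = slope h
  /-- vertices lie over branch points -/
  pos_mem : ∀ v, ∃ i, pos v = p i
  /-- over each branch point there are two three-valent vertices or one four-valent vertex -/
  fibre : ∀ i,
    (∃ v w, v ≠ w ∧ {u | pos u = p i} = {v, w} ∧
      toTropicalCurve.valence v = 3 ∧ toTropicalCurve.valence w = 3) ∨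
    (∃ v, {u | pos u = p i} = {v} ∧ toTropicalCurve.valence v = 4)
  /-- the edges adjacent to a four-valent vertex have the same weight -/
  weight_fourValent : ∀ h k, root h = root k → toTropicalCurve.valence (root h) = 4 →
    toTropicalCover.weight h = toTropicalCover.weight k
  /-- the fixed vertices of `ι` are exactly the four-valent ones … -/
  fixed_iff : ∀ v, iotaV v = v ↔ toTropicalCurve.valence v = 4
  /-- … and `ι` fixes no point inside an edge: it neither fixes an edge pointwise
  nor reverses an edge. -/
  iotaH_ne : ∀ h, iotaH h ≠ h ∧ iotaH h ≠ inv h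
  /-- the ends over the left ray come in pairs with weights `μ₁, …, μ_ℓ(μ)` -/
  left_ends : ((Finset.univ.filter fun h => inv h = h ∧ slope h < 0).val.map
    fun h => toTropicalCover.weight h) = 2 • μ.parts
  /-- the ends over the right ray come in pairs with weights `ν₁, …, ν_ℓ(ν)` -/
  right_ends : ((Finset.univ.filter fun h => inv h = h ∧ 0 < slope h).val.map
    fun h => toTropicalCover.weight h) = 2 • ν.parts

namespace TwistedTropicalCover

variable {n g : ℕ} {μ ν : n.Partition} {p : Fin (numBranch g μ ν) → ℝ}

/-- An isomorphism of twisted tropical covers: an isomorphism of metric graphs that is compatible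
with the maps to `ℝ` and with the involutions. -/
@[ext]
structure Iso (X Y : TwistedTropicalCover g μ ν p) where
  onV : X.V ≃ Y.V
  onH : X.H ≃ Y.H
  map_root : ∀ h, Y.root (onH h) = onV (X.root h)
  map_inv : ∀ h, Y.inv (onH h) = onH (X.inv h)
  map_length : ∀ h, Y.length (onH h) = X.length h
  map_pos : ∀ v, Y.pos (onV v) = X.pos v
  map_slope : ∀ h, Y.slope (onH h) = X.slope h
  map_iotaV : ∀ v, Y.iotaV (onV v) = onV (X.iotaV v)
  map_iotaH : ∀ h, Y.iotaH (onH h) = onH (X.iotaH h)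

/-- The identity. -/
def Iso.refl (X : TwistedTropicalCover g μ ν p) : Iso X X where
  onV := Equiv.refl _
  onH := Equiv.refl _
  map_root _ := rfl
  map_inv _ := rfl
  map_length _ := rfl
  map_pos _ := rfl
  map_slope _ := rfl
  map_iotaV _ := rfl
  map_iotaH _ := rfl

/-- The inverse of an isomorphism. -/
def Iso.symm {X Y : TwistedTropicalCover g μ ν p} (f : Iso X Y) : Iso Y X where
  onV := f.onV.symm
  onH := f.onH.symm
  map_root h := by
    apply f.onV.injective; rw [← f.map_root]; simp
  map_inv h := by
    apply f.onH.injective; rw [← f.map_inv]; simp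
  map_length h := by rw [← f.map_length]; simp
  map_pos v := by rw [← f.map_pos]; simp
  map_slope h := by rw [← f.map_slope]; simp
  map_iotaV v := by
    apply f.onV.injective; rw [← f.map_iotaV]; simp
  map_iotaH h := by
    apply f.onH.injective; rw [← f.map_iotaH]; simp

/-- The composition of isomorphisms. -/
def Iso.trans {X Y Z : TwistedTropicalCover g μ ν p} (f : Iso X Y) (k : Iso Y Z) : Iso X Z where
  onV := f.onV.trans k.onV
  onH := f.onH.trans k.onH
  map_root h := by simp [k.map_root, f.map_root]
  map_inv h := by simp [k.map_inv, f.map_inv]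
  map_length h := by simp [k.map_length, f.map_length]
  map_pos v := by simp [k.map_pos, f.map_pos]
  map_slope h := by simp [k.map_slope, f.map_slope]
  map_iotaV v := by simp [k.map_iotaV, f.map_iotaV]
  map_iotaH h := by simp [k.map_iotaH, f.map_iotaH]

/-- Equivalence of twisted tropical covers. -/
instance setoid (g : ℕ) (μ ν : n.Partition) (p : Fin (numBranch g μ ν) → ℝ) :
    Setoid (TwistedTropicalCover g μ ν p) where
  r X Y := Nonempty (Iso X Y)
  iseqv :=
    { refl := fun X => ⟨Iso.refl X⟩
      symm := fun ⟨f⟩ => ⟨f.symm⟩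
      trans := fun ⟨f⟩ ⟨k⟩ => ⟨f.trans k⟩ }

/-- The order of the automorphism group. -/
def autCard (X : TwistedTropicalCover g μ ν p) : ℕ := Nat.card (Iso X X)

open Classical in
/-- The weight `ω_V` of the edges adjacent to `V`, as the maximum of these weights (used at
four-valent vertices, where they all agree). -/
def vertexWeight (X : TwistedTropicalCover g μ ν p) (v : X.V) : ℕ :=
  (Finset.univ.filter fun h => X.root h = v).sup X.weight

/-- Two half-edges of internal edges of `Γ` give the same edge of the quotient graph `Γ/ι`. -/
def quotientEdgeSetoid (X : TwistedTropicalCover g μ ν p) : Setoid {h : X.H // X.inv h ≠ h} where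
  r h k := k.1 = h.1 ∨ k.1 = X.inv h.1 ∨ k.1 = X.iotaH h.1 ∨ k.1 = X.iotaH (X.inv h.1)
  iseqv := by
    refine ⟨fun h => Or.inl rfl, ?_, ?_⟩
    · rintro ⟨h, _⟩ ⟨k, _⟩ hk
      simp only at hk ⊢
      rcases hk with rfl | rfl | rfl | rfl <;>
        simp [X.inv_inv, X.iota_inv, X.iotaH_iotaH]
    · rintro ⟨h, _⟩ ⟨k, _⟩ ⟨l, _⟩ hk hl
      simp only at hk hl ⊢
      rcases hk with rfl | rfl | rfl | rfl <;> rcases hl with rfl | rfl | rfl | rfl <;>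
        simp [X.inv_inv, X.iota_inv, X.iotaH_iotaH]

/-- The internal edges of the quotient graph `Γ/ι`. -/
def QuotientEdge (X : TwistedTropicalCover g μ ν p) : Type := Quotient X.quotientEdgeSetoid

/-- The weight of an internal edge of the quotient graph `Γ/ι`. -/
def QuotientEdge.weight {X : TwistedTropicalCover g μ ν p} (e : X.QuotientEdge) : ℕ :=
  Quotient.lift (s := X.quotientEdgeSetoid) (fun h => X.toTropicalCover.weight h.1)
    (by
      rintro ⟨h, hh⟩ ⟨k, hk'⟩ (hk : k = h ∨ k = X.inv h ∨ k = X.iotaH h ∨ k = X.iotaH (X.inv h))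
      rcases hk with rfl | rfl | rfl | rfl <;>
        simp [TropicalCover.weight, X.iota_slope, X.slope_inv _ hh]) e

/-- The multiplicity
`2^b · 1/|Aut(π)| · ∏_V (ω_V - 1) · ∏_e ω(e)` of a twisted tropical cover. -/
def multiplicity (X : TwistedTropicalCover g μ ν p) : ℚ :=
  2 ^ numBranch g μ ν * (1 / (X.autCard : ℚ)) *
    (∏ᶠ v : {v : X.V // X.valence v = 4}, ((X.vertexWeight v.1 : ℚ) - 1)) *
    ∏ᶠ e : X.QuotientEdge, (e.weight : ℚ)

theorem Iso.autCard_eq {X Y : TwistedTropicalCover g μ ν p} (f : Iso X Y) :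
    X.autCard = Y.autCard := by
  refine Nat.card_congr
    ⟨fun a => (f.symm.trans a).trans f, fun a => (f.trans a).trans f.symm, ?_, ?_⟩ <;>
  · intro a
    apply Iso.ext <;> ext x <;> simp [Iso.trans, Iso.symm]

theorem Iso.valence_eq {X Y : TwistedTropicalCover g μ ν p} (f : Iso X Y) (v : X.V) :
    Y.valence (f.onV v) = X.valence v := by
  refine (Nat.card_congr (f.onH.subtypeEquiv fun h => ?_)).symm
  rw [f.map_root, f.onV.apply_eq_iff_eq]

theorem Iso.vertexWeight_eq {X Y : TwistedTropicalCover g μ ν p} (f : Iso X Y) (v : X.V) :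
    Y.vertexWeight (f.onV v) = X.vertexWeight v := by
  classical
  have : (Finset.univ.filter fun h => Y.root h = f.onV v) =
      (Finset.univ.filter fun h => X.root h = v).map f.onH.toEmbedding := by
    ext h
    obtain ⟨h, rfl⟩ := f.onH.surjective h
    simp [f.map_root]
  unfold vertexWeight
  have h2 := this
  convert (congrArg (fun s => s.sup Y.weight) h2) using 1
  rw [Finset.sup_map]
  congr 1
  funext h
  simp [TropicalCover.weight, f.map_slope]

/-- The bijection on internal edges of the quotient graphs induced by an isomorphism. -/
def Iso.onQuotientEdge {X Y : TwistedTropicalCover g μ ν p} (f : Iso X Y) :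
    X.QuotientEdge ≃ Y.QuotientEdge :=
  Quotient.congr (ra := X.quotientEdgeSetoid) (rb := Y.quotientEdgeSetoid)
    (f.onH.subtypeEquiv fun h => by rw [f.map_inv, Ne, Ne, f.onH.apply_eq_iff_eq])
    (by
      rintro ⟨h, hh⟩ ⟨k, hk⟩
      change (k = h ∨ k = X.inv h ∨ k = X.iotaH h ∨ k = X.iotaH (X.inv h)) ↔
        (f.onH k = f.onH h ∨ f.onH k = Y.inv (f.onH h) ∨ f.onH k = Y.iotaH (f.onH h) ∨
          f.onH k = Y.iotaH (Y.inv (f.onH h)))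
      simp only [f.map_inv, f.map_iotaH, f.onH.apply_eq_iff_eq])

theorem Iso.weight_onQuotientEdge {X Y : TwistedTropicalCover g μ ν p} (f : Iso X Y)
    (e : X.QuotientEdge) : (f.onQuotientEdge e).weight = e.weight := by
  induction e using Quotient.ind with
  | _ h => exact congrArg Int.natAbs (f.map_slope h.1)

theorem Iso.multiplicity_eq {X Y : TwistedTropicalCover g μ ν p} (f : Iso X Y) :
    X.multiplicity = Y.multiplicity := by
  unfold multiplicity
  rw [f.autCard_eq]
  congr 1
  · congr 1
    refine finprod_eq_of_bijective
      (f.onV.subtypeEquiv fun v => by rw [f.valence_eq]) (Equiv.bijective _) fun v => ?_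
    simp [f.vertexWeight_eq]
  · refine finprod_eq_of_bijective f.onQuotientEdge (Equiv.bijective _) fun e => ?_
    rw [f.weight_onQuotientEdge]

end TwistedTropicalCover

/-- The equivalence classes of twisted tropical covers of type `(g, μ, ν)`. -/
def TwistedTropicalCoverClass {n : ℕ} (g : ℕ) (μ ν : n.Partition)
    (p : Fin (numBranch g μ ν) → ℝ) : Type 1 :=
  Quotient (TwistedTropicalCover.setoid g μ ν p)

/-- The multiplicity of an equivalence class of twisted tropical covers. -/
def TwistedTropicalCoverClass.multiplicity {n g : ℕ} {μ ν : n.Partition}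
    {p : Fin (numBranch g μ ν) → ℝ} (c : TwistedTropicalCoverClass g μ ν p) : ℚ :=
  Quotient.lift (s := TwistedTropicalCover.setoid g μ ν p)
    TwistedTropicalCover.multiplicity (fun _ _ ⟨f⟩ => f.multiplicity_eq) c

/-- The tropical twisted double Hurwitz number `h̃^trop_g(μ, ν)` for the branch points `p`: the
weighted count of equivalence classes of twisted tropical covers. -/
def tropicalTwistedHurwitz {n : ℕ} (g : ℕ) (μ ν : n.Partition)
    (p : Fin (numBranch g μ ν) → ℝ) : ℚ :=
  ∑ᶠ c : TwistedTropicalCoverClass g μ ν p, c.multiplicity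

end

/-!
The proof is a double count of *labelled covers*.

Cut the real line at the branch points. Over the `k`-th open interval a labelled cover shows a
*state*: a permutation `σ` of the `2n` points with `τ σ τ = σ⁻¹` and no self-symmetric cycle,
together with a bijection from its cycles to the edges of the cover over that interval which takes
lengths to weights and `c ↦ τ c⁻¹ τ` to the involution. Passing a branch point is a *step*: the
permutation `σ` becomes `η σ τ η τ` (`twist`), and the cycles change exactly as the edges at the
vertices over that branch point do. With `η = (x y)`, either `τ`-symmetric pairs of cycles are
joined, or they are cut, or (if `y` lies in the cycle of `τ x`) a pair `c, τ c⁻¹ τ` of cycles is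
exchanged for another pair of the same length. The last case is the four-valent vertex.

*Labellings of a fixed cover* (`card_isLabelling_eq_multiplicity`). The number of states on given
edges follows from the transitive action of the centraliser of `τ`, of order `(2n)!!`
(`IsState.card_mul_prod`). From a fixed state there are `2 w₁ w₂` steps joining cycles of lengths
`w₁, w₂`, there are `2 w (w - 1)` steps at a crossing of weight `w`, and `2 w` steps cutting a
cycle of length `w` in a prescribed way. The first two numbers are direct (`IsState.card_isStep_join`,
`IsState.card_isStep_cross`), the third by reversing the steps (`IsState.card_isStep_cut`).
The product over all branch points gives `(2n)!!` times `2 ^ b ∏ (ω_V - 1) ∏ ω(e)`. As the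
internal edges are those of the quotient graph, with no distinguished choice of representatives,
this is proved for the squares, where the products run over all edges of the cover. A cover
with an edge of slope zero has multiplicity zero and is left out.

*Labellings over a fixed factorisation* (`card_fibre`). The permutations of a labelling form a
twisted factorisation (`IsLabelling.mem_twistedFactorisations`), transitive since the cover is
connected. Conversely, recording when each cycle of the intermediate products is born and dies
turns a factorisation into a labelled cover (`Factorisation.isLabelling_twistedCover`). Two
labelled covers over the same factorisation are related by exactly one isomorphism that matches
the labels (`IsLabelling.exists_iso`, `IsLabelling.iso_ext`), so that every factorisation singles
out one class of covers, and the labellings of a cover in this class over the factorisation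
are a torsor under its automorphism group (`card_isLabelling_over`).

Hence the fibre of the map from factorisations to classes of covers over the class of `X` has
`(2n)!!` times the multiplicity of `X` elements, and summing over the classes gives the theorem.
-/

namespace TwistedHurwitz

open Equiv Equiv.Perm

/-! ### Multiplication by transpositions and twisting -/

section Swap

variable {P : Type*} [Finite P] {σ : Perm P}

/-- A relation that is stable under one application of `σ` is stable along its cycles. -/
theorem SameCycle.induct {r : P → Prop} {x y : P} (h : σ.SameCycle x y)
    (hr : ∀ z, r z → r (σ z)) (hx : r x) : r y := by
  obtain ⟨k, rfl⟩ := h.exists_nat_pow_eq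
  induction k with
  | zero => simpa
  | succ k ih => rw [pow_succ', mul_apply]; exact hr _ (ih ⟨k, rfl⟩)

variable [DecidableEq P]

/-- A transposition of points of different cycles joins these. -/
theorem sameCycle_swap_mul_of_not {a b : P} (h : ¬ σ.SameCycle a b) :
    (swap a b * σ).SameCycle a b := by
  have hex : ∃ k, 0 < k ∧ (σ ^ k) a = a :=
    ⟨orderOf σ, orderOf_pos σ, by simp [pow_orderOf_eq_one]⟩
  classical
  obtain ⟨hk, hka⟩ := Nat.find_spec hex
  have hmin := fun m => Nat.find_min hex (m := m)
  set k := Nat.find hex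
  -- the new cycle runs through the old cycle of `a` before it is led to `b`
  have key : ∀ j < k, ((swap a b * σ) ^ j) a = (σ ^ j) a := by
    intro j
    induction j with
    | zero => simp
    | succ j ih =>
      intro hj
      rw [pow_succ', mul_apply, ih (by lia), mul_apply, ← mul_apply σ, ← pow_succ']
      refine swap_apply_of_ne_of_ne (fun h' => hmin _ hj ⟨by lia, h'⟩) fun h' => h ⟨j + 1, ?_⟩
      exact_mod_cast h'
  obtain ⟨j, hj⟩ : ∃ j, k = j + 1 := ⟨k - 1, by lia⟩
  refine ⟨(k : ℤ), ?_⟩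
  rw [zpow_natCast, hj, pow_succ', mul_apply, key j (by lia), mul_apply, ← mul_apply σ,
    ← pow_succ', ← hj, hka, swap_apply_left]

/-- A transposition of points of one cycle cuts this cycle between them. -/
theorem not_sameCycle_swap_mul {a b : P} (hab : a ≠ b) (h : σ.SameCycle a b) :
    ¬ (swap a b * σ).SameCycle a b := by
  have hex : ∃ k, (σ ^ k) a = b := h.exists_nat_pow_eq
  classical
  have hk := Nat.find_spec hex
  have hmin := fun m => Nat.find_min hex (m := m)
  set k := Nat.find hex
  have hk0 : 0 < k := Nat.pos_of_ne_zero fun h0 => hab (by simpa [h0] using hk)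
  intro h'
  -- the cycle of `a` under the product consists of the points before `b`
  obtain ⟨j, hj, hjb⟩ := SameCycle.induct (r := fun z => ∃ j < k, (σ ^ j) a = z) h'
    (by
      rintro _ ⟨j, hj, rfl⟩
      rw [mul_apply, ← mul_apply σ, ← pow_succ']
      by_cases hjk : j + 1 = k
      · exact ⟨0, hk0, by rw [hjk, hk]; simp⟩
      · refine ⟨j + 1, by lia, (swap_apply_of_ne_of_ne (fun ha => ?_) fun hb => ?_).symm⟩
        · refine hmin (k - (j + 1)) (by lia) ?_
          have := hk
          rwa [show k = (k - (j + 1)) + (j + 1) by lia, pow_add, mul_apply, ha] at this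
        · exact hmin _ (by lia) hb) ⟨0, hk0, by simp⟩
  exact hmin j hj hjb

/-- The cycles of `(a b) σ` are those of `σ`, with the cycles of `a` and `b` united. -/
theorem sameCycle_swap_mul_iff {a b : P} (h : ¬ σ.SameCycle a b) (u v : P) :
    (swap a b * σ).SameCycle u v ↔ σ.SameCycle u v ∨
      ((σ.SameCycle u a ∨ σ.SameCycle u b) ∧ (σ.SameCycle v a ∨ σ.SameCycle v b)) := by
  have hab := sameCycle_swap_mul_of_not h
  have step : ∀ w, (swap a b * σ).SameCycle w (σ w) := by
    intro w
    have h1 : (swap a b * σ).SameCycle w (swap a b (σ w)) :=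
      sameCycle_apply_right.2 (SameCycle.refl _ _)
    by_cases ha : σ w = a
    · rw [ha, swap_apply_left] at h1
      exact ha ▸ h1.trans hab.symm
    by_cases hb : σ w = b
    · rw [hb, swap_apply_right] at h1
      exact hb ▸ h1.trans hab
    · rwa [swap_apply_of_ne_of_ne ha hb] at h1
  have mono : ∀ {u v}, σ.SameCycle u v → (swap a b * σ).SameCycle u v := fun {u v} huv =>
    SameCycle.induct (r := (swap a b * σ).SameCycle u) huv (fun z hz => hz.trans (step z))
      (SameCycle.refl _ _)
  constructor
  · intro huv
    refine SameCycle.induct (r := fun v => σ.SameCycle u v ∨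
      ((σ.SameCycle u a ∨ σ.SameCycle u b) ∧ (σ.SameCycle v a ∨ σ.SameCycle v b))) huv
      (fun z hz => ?_) (.inl (SameCycle.refl _ _))
    rw [mul_apply]
    have h1 : σ.SameCycle z (σ z) := sameCycle_apply_right.2 (SameCycle.refl _ _)
    by_cases ha : σ z = a
    · rw [ha] at h1 ⊢
      rw [swap_apply_left]
      refine .inr ⟨?_, .inr (SameCycle.refl _ _)⟩
      exact hz.elim (fun h => .inl (h.trans h1)) And.left
    by_cases hb : σ z = b
    · rw [hb] at h1 ⊢
      rw [swap_apply_right]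
      refine .inr ⟨?_, .inl (SameCycle.refl _ _)⟩
      exact hz.elim (fun h => .inr (h.trans h1)) And.left
    · rw [swap_apply_of_ne_of_ne ha hb]
      simpa only [sameCycle_apply_right, sameCycle_apply_left] using hz
  · rintro (h | ⟨hu, hv⟩)
    · exact mono h
    · have hu' : (swap a b * σ).SameCycle u a :=
        hu.elim mono fun h => (mono h).trans hab.symm
      have hv' : (swap a b * σ).SameCycle v a :=
        hv.elim mono fun h => (mono h).trans hab.symm
      exact hu'.trans hv'.symm

end Swap

section Twist

variable {P : Type*}

/-- The effect `σ ↦ η σ (τ η τ)` of one step of a twisted factorisation. -/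
def twist (τ η σ : Perm P) : Perm P := η * σ * (τ * η * τ)

/-- A fixed-point free involution. -/
structure IsFreeInvolution (τ : P → P) : Prop where
  invol : ∀ x, τ (τ x) = x
  ne : ∀ x, τ x ≠ x

/-- The permutations `σ` with `τ σ τ = σ⁻¹` for which `σ τ` has no fixed point. For a fixed-point
free involution `τ` the last condition says that no cycle of `σ` is stable under `τ`. -/
structure IsBalanced (τ σ : Perm P) : Prop where
  conj : ∀ x, τ (σ x) = σ⁻¹ (τ x)
  ne : ∀ x, σ x ≠ τ x

variable {τ σ η : Perm P}

theorem IsBalanced.conj_zpow (h : IsBalanced τ σ) (k : ℤ) (x : P) :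
    τ ((σ ^ k) x) = (σ ^ (-k)) (τ x) := by
  have h1 : SemiconjBy τ σ σ⁻¹ := by
    ext x; simpa using h.conj x
  have := h1.zpow_right k
  rw [zpow_neg, ← inv_zpow]
  exact congrArg (fun f : Perm P => f x) this.eq

theorem IsBalanced.sameCycle_tau (h : IsBalanced τ σ) {x y : P} (hxy : σ.SameCycle x y) :
    σ.SameCycle (τ x) (τ y) := by
  obtain ⟨k, rfl⟩ := hxy
  exact ⟨-k, (h.conj_zpow k x).symm⟩

theorem IsBalanced.sameCycle_tau_iff (h : IsBalanced τ σ) (hτ : IsFreeInvolution τ) {x y : P} :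
    σ.SameCycle (τ x) (τ y) ↔ σ.SameCycle x y :=
  ⟨fun h' => by simpa [hτ.invol] using h.sameCycle_tau h', h.sameCycle_tau⟩

theorem IsBalanced.sameCycle_tau_comm (h : IsBalanced τ σ) (hτ : IsFreeInvolution τ) {x y : P} :
    σ.SameCycle (τ x) y ↔ σ.SameCycle x (τ y) := by
  rw [← h.sameCycle_tau_iff hτ, hτ.invol]

/-- If `τ` maps `z` to `σ ^ k z`, then the midpoint `σ ^ (k / 2) z` is fixed by `τ` or mapped to
its image under `σ`, according to the parity of `k`. -/
theorem IsBalanced.not_sameCycle (h : IsBalanced τ σ) (hτ : IsFreeInvolution τ) (z : P) :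
    ¬ σ.SameCycle z (τ z) := by
  rintro ⟨k, hk⟩
  obtain ⟨j, hj | hj⟩ := Int.even_or_odd' k
  · apply hτ.ne ((σ ^ j) z)
    rw [h.conj_zpow, ← hk, ← mul_apply, ← zpow_add, hj]
    congr 2; ring
  · apply h.ne ((σ ^ j) z)
    rw [← mul_apply, ← zpow_one_add, h.conj_zpow, ← hk, ← mul_apply, ← zpow_add, hj]
    congr 2; ring

theorem twist_apply (x : P) : twist τ η σ x = η (σ (τ (η (τ x)))) := rfl

theorem twist_twist (hτ : IsFreeInvolution τ) (hη : ∀ x, η (η x) = x) :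
    twist τ η (twist τ η σ) = σ := by
  ext x
  simp [twist_apply, hη, hτ.invol]

theorem IsBalanced.twist (h : IsBalanced τ σ) (hτ : IsFreeInvolution τ) (hη : ∀ x, η (η x) = x) :
    IsBalanced τ (twist τ η σ) where
  conj x := by
    rw [eq_inv_iff_eq, twist_apply, twist_apply, hτ.invol, hη]
    have := h.conj (τ (η (τ x)))
    rw [eq_inv_iff_eq, hτ.invol] at this
    rw [this, hη]
  ne x hx := by
    rw [twist_apply] at hx
    apply h.ne (τ (η (τ x)))
    rw [hτ.invol, ← hη (σ _), hx]

/-- The points whose `σ`-cycle contains a point moved by `η`. -/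
def Touched (η σ : Perm P) (z : P) : Prop := ∃ u, η u ≠ u ∧ σ.SameCycle z u

theorem Touched.congr {z w : P} (h : σ.SameCycle z w) : Touched η σ z ↔ Touched η σ w :=
  ⟨fun ⟨u, hu, hz⟩ => ⟨u, hu, h.symm.trans hz⟩, fun ⟨u, hu, hz⟩ => ⟨u, hu, h.trans hz⟩⟩

theorem touched_of_ne {z : P} (h : η z ≠ z) : Touched η σ z := ⟨z, h, SameCycle.refl _ _⟩

/-- A cycle away from the transposition is not affected by the twist. -/
theorem twist_apply_of_not_touched (hτ : IsFreeInvolution τ) {z : P}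
    (h1 : ¬ Touched η σ z) (h2 : ¬ Touched η σ (τ z)) :
    twist τ η σ z = σ z := by
  have hz : η (τ z) = τ z := by_contra fun hm => h2 (touched_of_ne hm)
  rw [twist_apply, hz, hτ.invol]
  by_contra hm
  exact h1 ((Touched.congr (sameCycle_apply_right.2 (SameCycle.refl _ _))).2 (touched_of_ne hm))

variable [DecidableEq P]

theorem touched_swap {x y : P} (hxy : x ≠ y) {z : P} :
    Touched (swap x y) σ z ↔ σ.SameCycle z x ∨ σ.SameCycle z y := by
  constructor
  · rintro ⟨u, hu, hz⟩
    by_cases h1 : u = x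
    · exact .inl (h1 ▸ hz)
    by_cases h2 : u = y
    · exact .inr (h2 ▸ hz)
    · exact absurd (swap_apply_of_ne_of_ne h1 h2) hu
  · rintro (h | h)
    · exact ⟨x, by simpa using hxy.symm, h⟩
    · exact ⟨y, by simpa using hxy, h⟩

theorem tau_swap_tau (hτ : IsFreeInvolution τ) (x y : P) :
    τ * swap x y * τ = swap (τ x) (τ y) := by
  have h2 : τ * τ = 1 := by ext x; simp [hτ.invol]
  rw [mul_swap_eq_swap_mul, mul_assoc, h2, mul_one]

theorem twist_swap (hτ : IsFreeInvolution τ) (x y : P) :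
    twist τ (swap x y) σ = swap x y * (swap (σ (τ x)) (σ (τ y)) * σ) := by
  rw [twist, tau_swap_tau hτ, mul_assoc, mul_swap_eq_swap_mul]

theorem isSwap_apply_apply (hη : η.IsSwap) (x : P) : η (η x) = x := by
  obtain ⟨a, b, -, rfl⟩ := hη
  simp

/-- The set of touched points is either stable under `τ` or disjoint from its image. -/
theorem touched_tau_iff (h : IsBalanced τ σ) (hτ : IsFreeInvolution τ) (hη : η.IsSwap)
    {z : P} (h1 : Touched η σ z) (h2 : Touched η σ (τ z)) (w : P) :
    Touched η σ (τ w) ↔ Touched η σ w := by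
  obtain ⟨x, y, hxy, rfl⟩ := hη
  simp only [touched_swap hxy, h.sameCycle_tau_comm hτ] at *
  have e : σ.SameCycle x (τ y) := by
    have hx := h.not_sameCycle hτ x
    have hy := h.not_sameCycle hτ y
    rcases h1 with h1 | h1 <;> rcases h2 with h2 | h2
    · exact absurd (h1.symm.trans h2) hx
    · exact h1.symm.trans h2
    · exact (h.sameCycle_tau_comm hτ).1 (h2.symm.trans h1)
    · exact absurd (h1.symm.trans h2) hy
  have e' : σ.SameCycle y (τ x) := ((h.sameCycle_tau_comm hτ).2 e).symm
  exact ⟨fun h' => h'.elim (fun h' => .inr (h'.trans e'.symm)) fun h' => .inl (h'.trans e.symm),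
    fun h' => h'.elim (fun h' => .inr (h'.trans e)) fun h' => .inl (h'.trans e')⟩

variable [Finite P]

theorem Touched.of_twist (h : IsBalanced τ σ) (hτ : IsFreeInvolution τ) (hη : η.IsSwap)
    {z : P} (hz : Touched η (twist τ η σ) z) : Touched η σ z := by
  obtain ⟨u, hu, hz⟩ := hz
  refine SameCycle.induct hz.symm (fun w hw => ?_) (touched_of_ne hu)
  have hσ : ∀ w, Touched η σ w → Touched η σ (σ w) := fun w hw =>
    (Touched.congr (sameCycle_apply_right.2 (SameCycle.refl _ _))).1 hw
  have hη' : ∀ w, Touched η σ w → Touched η σ (η w) := by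
    intro w hw
    by_cases hm : η w = w
    · rwa [hm]
    · refine touched_of_ne fun h' => hm ?_
      rwa [isSwap_apply_apply hη, eq_comm] at h'
  rw [twist_apply]
  refine hη' _ (hσ _ ?_)
  by_cases hm : η (τ w) = τ w
  · rwa [hm, hτ.invol]
  · rw [touched_tau_iff h hτ hη hw (touched_of_ne hm)]
    exact hη' _ (touched_of_ne hm)

theorem touched_twist (h : IsBalanced τ σ) (hτ : IsFreeInvolution τ) (hη : η.IsSwap) {z : P} :
    Touched η (twist τ η σ) z ↔ Touched η σ z := by
  refine ⟨Touched.of_twist h hτ hη, fun hz => ?_⟩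
  have hη' := isSwap_apply_apply hη
  refine Touched.of_twist (h.twist hτ hη') hτ hη ?_
  rwa [twist_twist hτ hη']

/-- Cycles away from the transposition and its image under `τ` are not affected by the twist. -/
theorem sameCycle_twist_of_not_touched (h : IsBalanced τ σ) (hτ : IsFreeInvolution τ)
    (hη : η.IsSwap) {z w : P} (h1 : ¬ Touched η σ z) (h2 : ¬ Touched η σ (τ z)) :
    (twist τ η σ).SameCycle z w ↔ σ.SameCycle z w := by
  have aux : ∀ {ρ : Perm P}, IsBalanced τ ρ → ¬ Touched η ρ z → ¬ Touched η ρ (τ z) →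
      ρ.SameCycle z w → (twist τ η ρ).SameCycle z w := by
    intro ρ h h1 h2 hw
    refine (SameCycle.induct (r := fun u => ρ.SameCycle z u ∧ (twist τ η ρ).SameCycle z u) hw
      (fun u ⟨hu, hu'⟩ => ⟨sameCycle_apply_right.2 hu, ?_⟩)
      ⟨SameCycle.refl _ _, SameCycle.refl _ _⟩).2
    rw [← twist_apply_of_not_touched hτ (by rwa [← Touched.congr hu])
      (by rwa [← Touched.congr (h.sameCycle_tau hu)])]
    exact sameCycle_apply_right.2 hu'
  have hη' := isSwap_apply_apply hη
  refine ⟨fun hw => ?_, aux h h1 h2⟩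
  have := aux (h.twist hτ hη') (by rwa [touched_twist h hτ hη])
    (by rwa [touched_twist h hτ hη]) hw
  rwa [twist_twist hτ hη'] at this

section
variable (h : IsBalanced τ σ) (hτ : IsFreeInvolution τ) {x y : P}
include h hτ

/-- The join: if neither `y` nor `τ y` lies in the cycle of `x`, then the twist by the
transposition `(x y)` joins the cycles of `x` and `y`, and those of `τ x` and `τ y`. -/
theorem sameCycle_twist_of_join (h1 : ¬ σ.SameCycle x y) (h2 : ¬ σ.SameCycle x (τ y)) (u v : P) :
    (twist τ (swap x y) σ).SameCycle u v ↔ σ.SameCycle u v ∨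
      ((σ.SameCycle u x ∨ σ.SameCycle u y) ∧ (σ.SameCycle v x ∨ σ.SameCycle v y)) ∨
      ((σ.SameCycle u (τ x) ∨ σ.SameCycle u (τ y)) ∧
        (σ.SameCycle v (τ x) ∨ σ.SameCycle v (τ y))) := by
  have hu : ¬ σ.SameCycle (σ (τ x)) (σ (τ y)) := by
    rwa [sameCycle_apply_left, sameCycle_apply_right, h.sameCycle_tau_iff hτ]
  have key := sameCycle_swap_mul_iff hu
  simp only [sameCycle_apply_right] at key
  have hx := h.not_sameCycle hτ x
  have hy := h.not_sameCycle hτ y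
  have h3 : ¬ σ.SameCycle y (τ x) := fun h' => h2 ((h.sameCycle_tau_comm hτ).1 h'.symm)
  have hxy : ¬ (swap (σ (τ x)) (σ (τ y)) * σ).SameCycle x y := by
    rw [key]; tauto
  rw [twist_swap hτ, sameCycle_swap_mul_iff hxy]
  simp only [key]
  tauto

/-- The cut: if `y` lies in the cycle of `x`, then the twist by `(x y)` separates the four points
`x`, `y`, `τ x`, `τ y`. -/
theorem not_sameCycle_twist_of_cut (hxy : x ≠ y) (h1 : σ.SameCycle x y) :
    ¬ (twist τ (swap x y) σ).SameCycle x y ∧ ¬ (twist τ (swap x y) σ).SameCycle x (τ y) := by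
  have hu : σ.SameCycle (σ (τ x)) (σ (τ y)) := by
    rwa [sameCycle_apply_left, sameCycle_apply_right, h.sameCycle_tau_iff hτ]
  have hx := h.not_sameCycle hτ x
  have hy := h.not_sameCycle hτ y
  have h3 : ¬ σ.SameCycle x (τ y) := fun h' => hy (h1.symm.trans h')
  have hne : σ (τ x) ≠ σ (τ y) := fun h' => hxy (τ.injective (σ.injective h'))
  set ρ := swap (σ (τ x)) (σ (τ y)) * σ with hρ
  have hcut := not_sameCycle_swap_mul hne hu
  have key := sameCycle_swap_mul_iff hcut
  rw [← mul_assoc, swap_mul_self, one_mul] at key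
  have hxρ : ¬ ρ.SameCycle x (σ (τ x)) := fun h' =>
    hx (sameCycle_apply_right.1 ((key _ _).2 (.inl h')))
  have hxρ' : ¬ ρ.SameCycle x (σ (τ y)) := fun h' =>
    h3 (sameCycle_apply_right.1 ((key _ _).2 (.inl h')))
  have h1ρ : ρ.SameCycle x y := by
    have := (key x y).1 h1
    tauto
  have hcut' := not_sameCycle_swap_mul hxy h1ρ
  rw [twist_swap hτ]
  refine ⟨hcut', fun h' => h3 ?_⟩
  have key' := sameCycle_swap_mul_iff hcut'
  rw [← mul_assoc, swap_mul_self, one_mul] at key'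
  exact (key _ _).2 (.inl ((key' _ _).2 (.inl h')))

/-- The crossing: if `τ y` lies in the cycle of `x`, then the twist by `(x y)` separates `x` from
`y`, joins `x` to `τ y`, and preserves the union of the cycles of `x` and `y` as well as all other
cycles. -/
theorem sameCycle_twist_of_cross (hxy : x ≠ y) (h1 : σ.SameCycle x (τ y)) :
    ¬ (twist τ (swap x y) σ).SameCycle x y ∧ (twist τ (swap x y) σ).SameCycle x (τ y) := by
  have hbal := h.twist hτ (η := swap x y) (by simp)
  have hx := h.not_sameCycle hτ x
  have hy := h.not_sameCycle hτ y
  have h2 : σ.SameCycle (τ x) y := (h.sameCycle_tau_comm hτ).2 h1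
  have h3 : ¬ σ.SameCycle x y := fun h' => hx (h'.trans h2.symm)
  have hu : ¬ σ.SameCycle (σ (τ x)) (σ (τ y)) := by
    rwa [sameCycle_apply_left, sameCycle_apply_right, h.sameCycle_tau_iff hτ]
  have key := sameCycle_swap_mul_iff hu
  simp only [sameCycle_apply_right] at key
  have h1ρ : (swap (σ (τ x)) (σ (τ y)) * σ).SameCycle x y := by
    rw [key]; exact .inr ⟨.inr h1, .inl h2.symm⟩
  have hcut := not_sameCycle_swap_mul hxy h1ρ
  have key' := sameCycle_swap_mul_iff hcut
  rw [← mul_assoc, swap_mul_self, one_mul] at key'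
  rw [← twist_swap hτ] at hcut key'
  refine ⟨hcut, ?_⟩
  have h5 : (swap (σ (τ x)) (σ (τ y)) * σ).SameCycle x (τ y) := by
    rw [key]; exact .inl h1
  have h6 := hbal.not_sameCycle hτ y
  have := (key' _ _).1 h5
  rcases this with h | ⟨-, h | h⟩
  · exact h
  · exact h.symm
  · exact absurd h.symm h6

end

end Twist

/-! ### States, sites and steps; joins -/

/-- Edges with positive weights and a fixed-point free involution `iota` that respects these. -/
structure PairedEdges (E : Type*) where
  iota : E → E
  free : IsFreeInvolution iota
  weight : E → ℕ
  weight_pos : ∀ e, 0 < weight e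
  weight_iota : ∀ e, weight (iota e) = weight e

section State

variable {P E V : Type*} [Fintype P] [DecidableEq P] [DecidableEq E]

/-- A state over a point of the line between two branch points: a permutation `σ` with a labelling
of `P` by the edges `S` over that point. The cycles of `σ` are the fibres of the labelling, their
lengths are the weights of the edges, and `τ` acts on the labels as `iota`. -/
structure IsState (Λ : PairedEdges E) (τ : Perm P) (S : Finset E) (ω : Perm P × (P → E)) :
    Prop where
  balanced : IsBalanced τ ω.1
  mem : ∀ z, ω.2 z ∈ S
  label_tau : ∀ z, ω.2 (τ z) = Λ.iota (ω.2 z)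
  sameCycle : ∀ z u, ω.1.SameCycle z u ↔ ω.2 z = ω.2 u
  card : ∀ e ∈ S, (Finset.univ.filter fun z => ω.2 z = e).card = Λ.weight e

omit [DecidableEq P] in
theorem IsState.exists_eq {Λ : PairedEdges E} {τ : Perm P} {S : Finset E} {ω : Perm P × (P → E)}
    (h : IsState Λ τ S ω) {e : E} (he : e ∈ S) : ∃ z, ω.2 z = e := by
  have := h.card e he ▸ Λ.weight_pos e
  obtain ⟨z, hz⟩ := Finset.card_pos.1 this
  exact ⟨z, by simpa using hz⟩

/-- The edges near a branch point: those over its left and over its right side, among them the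
ones that end (`dying`) and that start (`born`) at the vertices over the branch point, with these
vertices. All other edges pass over the branch point. -/
structure Site (E V : Type*) [DecidableEq E] where
  before : Finset E
  after : Finset E
  dying : Finset E
  born : Finset E
  tgt : E → V
  src : E → V
  dying_subset : dying ⊆ before
  born_subset : born ⊆ after
  sdiff_eq : before \ dying = after \ born
  disjoint_born : Disjoint before born
  disjoint_dying : Disjoint after dying

/-- The site read from the right to the left. -/
def Site.reverse (s : Site E V) : Site E V where
  before := s.after
  after := s.before
  dying := s.born
  born := s.dying
  tgt := s.src
  src := s.tgt
  dying_subset := s.born_subset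
  born_subset := s.dying_subset
  sdiff_eq := s.sdiff_eq.symm
  disjoint_born := s.disjoint_dying
  disjoint_dying := s.disjoint_born

/-- A step from the state `ω` to the state `ω'` across a branch point: the twist by a
transposition, which moves points at one of the vertices over the branch point. -/
structure IsStep (Λ : PairedEdges E) (τ : Perm P) (s : Site E V) (ω : Perm P × (P → E))
    (η : Perm P) (ω' : Perm P × (P → E)) : Prop where
  isSwap : η.IsSwap
  ne : η ≠ τ * η * τ
  fst : ω'.1 = twist τ η ω.1
  stay : ∀ z, ω.2 z ∉ s.dying → ω'.2 z = ω.2 z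
  pass : ∀ z, ω.2 z ∈ s.dying → ω'.2 z ∈ s.born ∧ s.src (ω'.2 z) = s.tgt (ω.2 z)
  moved : ∀ z, η z ≠ z → ω.2 z ∈ s.dying ∧ s.tgt (ω.2 (η z)) = s.tgt (ω.2 z)
  isState : IsState Λ τ s.after ω'

variable {Λ : PairedEdges E} {τ : Perm P} {s : Site E V} {ω ω' : Perm P × (P → E)} {η : Perm P}

theorem IsStep.born_iff (h : IsStep Λ τ s ω η ω') (hω : IsState Λ τ s.before ω) (z : P) :
    ω'.2 z ∈ s.born ↔ ω.2 z ∈ s.dying := by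
  refine ⟨fun hz => by_contra fun hd => ?_, fun hz => (h.pass z hz).1⟩
  rw [h.stay z hd] at hz
  exact Finset.disjoint_left.1 s.disjoint_born (hω.mem z) hz

/-- Steps can be read from the right to the left, as the twist by a transposition is an
involution. -/
theorem IsStep.reverse (hτ : IsFreeInvolution τ) (h : IsStep Λ τ s ω η ω')
    (hω : IsState Λ τ s.before ω) : IsStep Λ τ s.reverse ω' η ω where
  isSwap := h.isSwap
  ne := h.ne
  fst := by rw [h.fst, twist_twist hτ (isSwap_apply_apply h.isSwap)]
  stay z hz := (h.stay z fun hd => hz (h.pass z hd).1).symm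
  pass z hz := by
    have hd := (h.born_iff hω z).1 hz
    exact ⟨hd, (h.pass z hd).2.symm⟩
  moved z hz := by
    have h1 := h.moved z hz
    have h2 := h.moved (η z) (fun h' => hz (by simpa using h'))
    exact ⟨(h.pass z h1.1).1, ((h.pass _ h2.1).2.trans h1.2).trans (h.pass z h1.1).2.symm⟩
  isState := hω

/-- At a join, the edges `a₁` and `a₂` end at a vertex at which `e` starts. -/
structure Site.IsJoin (Λ : PairedEdges E) (s : Site E V) (a₁ a₂ e : E) : Prop where
  dying_eq : s.dying = {a₁, a₂, Λ.iota a₁, Λ.iota a₂}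
  born_eq : s.born = {e, Λ.iota e}
  ne : a₁ ≠ a₂
  ne_iota : a₁ ≠ Λ.iota a₂
  tgt₁ : s.tgt a₁ = s.src e
  tgt₂ : s.tgt a₂ = s.src e
  tgt_iota₁ : s.tgt (Λ.iota a₁) = s.src (Λ.iota e)
  tgt_iota₂ : s.tgt (Λ.iota a₂) = s.src (Λ.iota e)
  src_ne : s.src e ≠ s.src (Λ.iota e)
  weight_eq : Λ.weight e = Λ.weight a₁ + Λ.weight a₂

/-- At a crossing, `a` and its image end at a vertex at which `e` and its image start. -/
structure Site.IsCross (Λ : PairedEdges E) (s : Site E V) (a e : E) : Prop where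
  dying_eq : s.dying = {a, Λ.iota a}
  born_eq : s.born = {e, Λ.iota e}
  tgt_iota : s.tgt (Λ.iota a) = s.tgt a
  src_eq : s.src e = s.tgt a
  src_iota : s.src (Λ.iota e) = s.tgt a
  weight_eq : Λ.weight e = Λ.weight a

theorem Site.IsJoin.iota {a₁ a₂ e : E} (h : s.IsJoin Λ a₁ a₂ e) :
    s.IsJoin Λ (Λ.iota a₁) (Λ.iota a₂) (Λ.iota e) where
  dying_eq := by
    rw [h.dying_eq, Λ.free.invol, Λ.free.invol]; ext; simp; tauto
  born_eq := by rw [h.born_eq, Λ.free.invol, Finset.pair_comm]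
  ne h' := h.ne (by rw [← Λ.free.invol a₁, h', Λ.free.invol])
  ne_iota h' := h.ne_iota (by rw [← Λ.free.invol a₁, h', Λ.free.invol])
  tgt₁ := h.tgt_iota₁
  tgt₂ := h.tgt_iota₂
  tgt_iota₁ := by simpa only [Λ.free.invol] using h.tgt₁
  tgt_iota₂ := by simpa only [Λ.free.invol] using h.tgt₂
  src_ne := by simpa only [Λ.free.invol] using h.src_ne.symm
  weight_eq := by simpa only [Λ.weight_iota] using h.weight_eq

omit [Fintype P] in
theorem swap_ne_tau (hτ : IsFreeInvolution τ) {x y : P} (hxy : x ≠ y) :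
    swap x y ≠ τ * swap x y * τ ↔ y ≠ τ x := by
  rw [tau_swap_tau hτ, not_iff_not]
  constructor
  · intro h
    have h1 := congrArg (fun f : Perm P => f x) h
    simp only [swap_apply_left] at h1
    rw [swap_apply_def] at h1
    have := hτ.ne x
    split_ifs at h1 with h2 h3
    · exact absurd h2.symm this
    · exact h1
    · exact absurd h1.symm hxy
  · rintro rfl
    rw [hτ.invol, swap_comm]

/-- The labels after a join. -/
def joinLabel (Λ : PairedEdges E) (a₁ a₂ e : E) (f : P → E) (z : P) : E :=
  if f z = a₁ ∨ f z = a₂ then e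
  else if f z = Λ.iota a₁ ∨ f z = Λ.iota a₂ then Λ.iota e else f z

omit [Fintype P] [DecidableEq P] in
theorem joinLabel_iota {a₁ a₂ e : E} (h : s.IsJoin Λ a₁ a₂ e) (f : P → E) :
    joinLabel Λ (Λ.iota a₁) (Λ.iota a₂) (Λ.iota e) f = joinLabel Λ a₁ a₂ e f := by
  have n1 := Λ.free.ne a₁
  have n2 := Λ.free.ne a₂
  have n3 := h.ne_iota
  have n4 : a₂ ≠ Λ.iota a₁ := fun h' => n3 (by rw [h', Λ.free.invol])
  ext z
  simp only [joinLabel, Λ.free.invol]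
  grind

/-- If `x` and `y` lie on the cycles labelled by `a₁` and `a₂`, then the twist by `(x y)` joins these
cycles, and the labels after the step are forced. -/
theorem IsState.isStep_join {a₁ a₂ e : E} (hω : IsState Λ τ s.before ω) (hτ : IsFreeInvolution τ)
    (h : s.IsJoin Λ a₁ a₂ e) {x y : P} (hx : ω.2 x = a₁) (hy : ω.2 y = a₂) :
    IsStep Λ τ s ω (swap x y) (twist τ (swap x y) ω.1, joinLabel Λ a₁ a₂ e ω.2) := by
  have n1 := Λ.free.ne a₁
  have n2 := Λ.free.ne a₂
  have n3 := h.ne_iota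
  have n4 : a₂ ≠ Λ.iota a₁ := fun h' => n3 (by rw [h', Λ.free.invol])
  have n5 := h.ne
  have n6 : Λ.iota a₁ ≠ Λ.iota a₂ := h.iota.ne
  have n7 := Λ.free.ne e
  have hd : ∀ c, c ∈ s.dying ↔ c = a₁ ∨ c = a₂ ∨ c = Λ.iota a₁ ∨ c = Λ.iota a₂ := by
    simp [h.dying_eq]
  have hb : ∀ c, c ∈ s.born ↔ c = e ∨ c = Λ.iota e := by simp [h.born_eq]
  have hnb : ∀ z, ω.2 z ≠ e ∧ ω.2 z ≠ Λ.iota e := fun z => by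
    rw [← not_or, ← hb]
    exact Finset.disjoint_left.1 s.disjoint_born (hω.mem z)
  have hxy : x ≠ y := fun h' => n5 (by rw [← hx, h', hy])
  have hinv : ∀ z, ω.2 z = a₁ → ω.2 (τ z) = Λ.iota a₁ := fun z hz => by rw [hω.label_tau, hz]
  have ii := Λ.free.invol
  have hbal := hω.balanced.twist hτ (η := swap x y) (by simp)
  refine ⟨⟨x, y, hxy, rfl⟩, (swap_ne_tau hτ hxy).2 fun h' => ?_, rfl, fun z hz => ?_,
    fun z hz => ?_, fun z hz => ?_, hbal, fun z => ?_, fun z => ?_, fun z u => ?_, fun c hc => ?_⟩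
  · exact n4 (by rw [← hy, h', hω.label_tau, hx])
  · rw [hd] at hz
    simp only [joinLabel]
    grind
  · rw [hd] at hz
    rw [hb]
    have := h.tgt₁
    have := h.tgt₂
    have := h.tgt_iota₁
    have := h.tgt_iota₂
    simp only [joinLabel]
    grind
  · rw [hd]
    have := h.tgt₁
    have := h.tgt₂
    rw [swap_apply_def] at hz ⊢
    split_ifs at hz ⊢ <;> simp_all
  · have h1 : joinLabel Λ a₁ a₂ e ω.2 z ∈ s.born ∨
        joinLabel Λ a₁ a₂ e ω.2 z ∈ s.before \ s.dying := by
      rw [hb, Finset.mem_sdiff, hd]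
      have := hω.mem z
      simp only [joinLabel]
      grind
    rcases h1 with h1 | h1
    · exact s.born_subset h1
    · rw [s.sdiff_eq] at h1
      exact (Finset.mem_sdiff.1 h1).1
  · simp only [joinLabel, hω.label_tau]
    have := ii (ω.2 z)
    have := ii a₁
    have := ii a₂
    have := ii e
    grind
  · have h1 : ¬ ω.1.SameCycle x y := by rw [hω.sameCycle, hx, hy]; exact n5
    have h2 : ¬ ω.1.SameCycle x (τ y) := by rw [hω.sameCycle, hω.label_tau, hx, hy]; exact n3
    rw [sameCycle_twist_of_join hω.balanced hτ h1 h2]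
    simp only [hω.sameCycle, hω.label_tau, hx, hy, joinLabel]
    have := hnb z
    have := hnb u
    grind
  · have hc' : c ∈ s.born ∨ c ∈ s.before \ s.dying := by
      rw [s.sdiff_eq, Finset.mem_sdiff]
      tauto
    have m1 : a₁ ∈ s.before := s.dying_subset ((hd _).2 (by simp))
    have m2 : a₂ ∈ s.before := s.dying_subset ((hd _).2 (by simp))
    have m3 : Λ.iota a₁ ∈ s.before := s.dying_subset ((hd _).2 (by simp))
    have m4 : Λ.iota a₂ ∈ s.before := s.dying_subset ((hd _).2 (by simp))
    have hunion : ∀ b₁ b₂, b₁ ≠ b₂ → b₁ ∈ s.before → b₂ ∈ s.before →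
        (Finset.univ.filter fun z => ω.2 z = b₁ ∨ ω.2 z = b₂).card =
          Λ.weight b₁ + Λ.weight b₂ := by
      intro b₁ b₂ hne hb₁ hb₂
      rw [Finset.filter_or, Finset.card_union_of_disjoint, hω.card _ hb₁, hω.card _ hb₂]
      rw [Finset.disjoint_filter]
      rintro z - rfl
      exact hne
    rcases hc' with hc' | hc'
    · rw [hb] at hc'
      rcases hc' with rfl | rfl
      · rw [h.weight_eq, ← hunion _ _ n5 m1 m2]
        congr 1
        ext z
        have := hnb z
        simp only [joinLabel, Finset.mem_filter, Finset.mem_univ, true_and]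
        grind
      · rw [Λ.weight_iota, h.weight_eq, ← Λ.weight_iota a₁, ← Λ.weight_iota a₂,
          ← hunion _ _ n6 m3 m4]
        congr 1
        ext z
        have := hnb z
        simp only [joinLabel, Finset.mem_filter, Finset.mem_univ, true_and]
        grind
    · rw [Finset.mem_sdiff, hd] at hc'
      rw [← hω.card c hc'.1]
      congr 1
      ext z
      have hce : c ≠ e ∧ c ≠ Λ.iota e := by
        obtain ⟨u, hu⟩ := hω.exists_eq hc'.1
        rw [← hu]; exact hnb u
      simp only [joinLabel, Finset.mem_filter, Finset.mem_univ, true_and]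
      grind

/-- At a join, the transposition moves a point with one of the labels `a₁`, `a₂` and one with the
other label (up to `iota`): two points with the same label would be separated by the twist, but
the vertex has only one outgoing edge. -/
theorem IsStep.eq_of_join {a₁ a₂ e : E} (hs : IsStep Λ τ s ω η ω')
    (hω : IsState Λ τ s.before ω) (hτ : IsFreeInvolution τ) (h : s.IsJoin Λ a₁ a₂ e) :
    (∃ x y, (ω.2 x = a₁ ∧ ω.2 y = a₂ ∨ ω.2 x = Λ.iota a₁ ∧ ω.2 y = Λ.iota a₂) ∧ η = swap x y) ∧
      ω'.2 = joinLabel Λ a₁ a₂ e ω.2 := by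
  have n1 := Λ.free.ne a₁
  have n2 := Λ.free.ne a₂
  have n7 := Λ.free.ne e
  have n8 := h.src_ne
  have hd : ∀ c, c ∈ s.dying ↔ c = a₁ ∨ c = a₂ ∨ c = Λ.iota a₁ ∨ c = Λ.iota a₂ := by
    simp [h.dying_eq]
  have hb : ∀ c, c ∈ s.born ↔ c = e ∨ c = Λ.iota e := by simp [h.born_eq]
  have t1 := h.tgt₁
  have t2 := h.tgt₂
  have t3 := h.tgt_iota₁
  have t4 := h.tgt_iota₂
  have hlab : ω'.2 = joinLabel Λ a₁ a₂ e ω.2 := by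
    ext z
    have s1 := hs.stay z
    have s2 := hs.pass z
    rw [hd] at s1 s2
    rw [hb] at s2
    simp only [joinLabel]
    grind
  refine ⟨?_, hlab⟩
  obtain ⟨x, y, hxy, hη⟩ := hs.isSwap
  have mx := hs.moved x (by simpa [hη] using hxy.symm)
  have my := hs.moved y (by simpa [hη] using hxy)
  have et : s.tgt (ω.2 y) = s.tgt (ω.2 x) := by simpa [hη] using mx.2
  have hne : ω.2 x ≠ ω.2 y := by
    intro heq
    have hcut := (not_sameCycle_twist_of_cut hω.balanced hτ hxy
      ((hω.sameCycle x y).2 heq)).1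
    rw [← hη, ← hs.fst, hs.isState.sameCycle, hlab] at hcut
    exact hcut (by simp only [joinLabel, heq])
  have dx := (hd _).1 mx.1
  have dy := (hd _).1 my.1
  have c1 : (ω.2 x = a₁ ∧ ω.2 y = a₂ ∨ ω.2 x = Λ.iota a₁ ∧ ω.2 y = Λ.iota a₂) ∨
      (ω.2 y = a₁ ∧ ω.2 x = a₂ ∨ ω.2 y = Λ.iota a₁ ∧ ω.2 x = Λ.iota a₂) := by
    grind
  rcases c1 with c1 | c1
  · exact ⟨x, y, c1, hη⟩
  · exact ⟨y, x, c1, by rw [hη, swap_comm]⟩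

/-- The number of steps from a given state across a join. -/
theorem IsState.card_isStep_join {a₁ a₂ e : E} (hω : IsState Λ τ s.before ω)
    (hτ : IsFreeInvolution τ) (h : s.IsJoin Λ a₁ a₂ e) :
    Nat.card {q : Perm P × (Perm P × (P → E)) // IsStep Λ τ s ω q.1 q.2} =
      2 * (Λ.weight a₁ * Λ.weight a₂) := by
  have n1 := Λ.free.ne a₁
  have n2 := Λ.free.ne a₂
  have n3 := h.ne_iota
  have n4 : a₂ ≠ Λ.iota a₁ := fun h' => n3 (by rw [h', Λ.free.invol])
  have n5 := h.ne
  have n6 : Λ.iota a₁ ≠ Λ.iota a₂ := h.iota.ne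
  have hd : ∀ c, c ∈ s.dying ↔ c = a₁ ∨ c = a₂ ∨ c = Λ.iota a₁ ∨ c = Λ.iota a₂ := by
    simp [h.dying_eq]
  -- a step is the choice of a point of each of the two cycles, on one side of the involution
  let F : E → Finset P := fun c => Finset.univ.filter fun z => ω.2 z = c
  let D : Finset (P × P) := F a₁ ×ˢ F a₂ ∪ F (Λ.iota a₁) ×ˢ F (Λ.iota a₂)
  have hD : ∀ q : P × P, q ∈ D ↔
      (ω.2 q.1 = a₁ ∧ ω.2 q.2 = a₂ ∨ ω.2 q.1 = Λ.iota a₁ ∧ ω.2 q.2 = Λ.iota a₂) := by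
    simp [D, F]
  have hcard : D.card = 2 * (Λ.weight a₁ * Λ.weight a₂) := by
    rw [Finset.card_union_of_disjoint, Finset.card_product, Finset.card_product, hω.card, hω.card,
      hω.card, hω.card, Λ.weight_iota, Λ.weight_iota, two_mul]
    any_goals exact s.dying_subset ((hd _).2 (by simp))
    rw [Finset.disjoint_left]
    rintro ⟨x, y⟩ h1 h2
    simp only [F, Finset.mem_product, Finset.mem_filter, Finset.mem_univ, true_and] at h1 h2
    exact n1 (h2.1.symm.trans h1.1)
  rw [← hcard, ← Nat.card_eq_finsetCard]
  symm
  refine Nat.card_eq_of_bijective (fun q : D => ⟨(swap q.1.1 q.1.2,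
    (twist τ (swap q.1.1 q.1.2) ω.1, joinLabel Λ a₁ a₂ e ω.2)), ?_⟩) ⟨?_, ?_⟩
  · rcases (hD _).1 q.2 with ⟨h1, h2⟩ | ⟨h1, h2⟩
    · exact hω.isStep_join hτ h h1 h2
    · have := hω.isStep_join hτ h.iota h1 h2
      rwa [joinLabel_iota h] at this
  · rintro ⟨⟨x, y⟩, hq⟩ ⟨⟨x', y'⟩, hq'⟩ heq
    have heq' : swap x y = swap x' y' := congrArg (fun z => z.1.1) heq
    rw [hD] at hq hq'
    simp only at hq hq'
    have hxy : x ≠ y := by rintro rfl; grind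
    have h1 : x = x' := by
      have h2 : swap x' y' x ≠ x := by rw [← heq']; simpa using hxy.symm
      by_contra hx
      have hy : x = y' := by
        by_contra hy
        exact h2 (swap_apply_of_ne_of_ne hx hy)
      subst hy
      grind
    subst h1
    have h2 := congrArg (fun f : Perm P => f x) heq'
    simp only [swap_apply_left] at h2
    simp [h2]
  · rintro ⟨⟨η, ω'⟩, hs⟩
    obtain ⟨⟨x, y, hxy, rfl⟩, hlab⟩ := hs.eq_of_join hω hτ h
    refine ⟨⟨(x, y), (hD _).2 hxy⟩, ?_⟩
    ext1
    simp only [Prod.mk.injEq, true_and]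
    exact Prod.ext hs.fst.symm hlab.symm

end State

/-! ### Steps at a crossing -/

section Cross

variable {P E V : Type*} [Fintype P] [DecidableEq P] [DecidableEq E]
variable {Λ : PairedEdges E} {τ : Perm P} {s : Site E V} {ω ω' : Perm P × (P → E)} {η : Perm P}

open Classical in
/-- The labels after a crossing, where `σ` is the new permutation, and its cycle through `x` is
labelled by `c`. -/
noncomputable def crossLabel (Λ : PairedEdges E) (a c : E) (σ : Perm P) (x : P) (f : P → E)
    (z : P) : E :=
  if f z = a ∨ f z = Λ.iota a then if σ.SameCycle z x then c else Λ.iota c else f z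

/-- If `x` and `y` lie on the cycles labelled by `a` and `iota a` and `y ≠ τ x`, then the twist by
`(x y)` is a step across the crossing. Either of the two new edges may be the label of `x`. -/
theorem IsState.isStep_cross {a e c : E} (hω : IsState Λ τ s.before ω) (hτ : IsFreeInvolution τ)
    (h : s.IsCross Λ a e) {x y : P} (hx : ω.2 x = a) (hy : ω.2 y = Λ.iota a) (hxy' : y ≠ τ x)
    (hc : c ∈ s.born) :
    IsStep Λ τ s ω (swap x y) (twist τ (swap x y) ω.1,
      crossLabel Λ a c (twist τ (swap x y) ω.1) x ω.2) := by
  classical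
  have n1 := Λ.free.ne a
  have hd : ∀ c, c ∈ s.dying ↔ c = a ∨ c = Λ.iota a := by simp [h.dying_eq]
  have hb : ∀ d, d ∈ s.born ↔ d = c ∨ d = Λ.iota c := by
    have := Λ.free.invol e
    simp only [h.born_eq, Finset.mem_insert, Finset.mem_singleton] at hc ⊢
    grind
  have n2 := Λ.free.ne c
  have hsrc : s.src c = s.tgt a ∧ s.src (Λ.iota c) = s.tgt a := by
    have h1 := h.src_eq
    have h2 := h.src_iota
    have := Λ.free.invol e
    simp only [h.born_eq, Finset.mem_insert, Finset.mem_singleton] at hc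
    grind
  have hw : Λ.weight c = Λ.weight a := by
    rw [← h.weight_eq]
    simp only [h.born_eq, Finset.mem_insert, Finset.mem_singleton] at hc
    rcases hc with rfl | rfl
    · rfl
    · exact Λ.weight_iota e
  have hnb : ∀ z, ω.2 z ≠ c ∧ ω.2 z ≠ Λ.iota c := fun z => by
    rw [← not_or, ← hb]
    exact Finset.disjoint_left.1 s.disjoint_born (hω.mem z)
  have hxy : x ≠ y := fun h' => n1 (by rw [← hy, ← h', hx])
  have hsw : (swap x y).IsSwap := ⟨x, y, hxy, rfl⟩
  have ii := Λ.free.invol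
  have hbal := hω.balanced.twist hτ (η := swap x y) (by simp)
  -- the points on the two cycles that change are the same before and after the twist
  have htou : ∀ z, Touched (swap x y) ω.1 z ↔ ω.2 z = a ∨ ω.2 z = Λ.iota a := by
    intro z
    rw [touched_swap hxy, hω.sameCycle, hω.sameCycle, hx, hy]
  have hcr := sameCycle_twist_of_cross hω.balanced hτ hxy
    (by rw [hω.sameCycle, hω.label_tau, hx, hy, ii])
  set σ' := twist τ (swap x y) ω.1 with hσ'
  have htou' : ∀ z, (ω.2 z = a ∨ ω.2 z = Λ.iota a) → σ'.SameCycle z x ∨ σ'.SameCycle z y := by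
    intro z hz
    rwa [← htou, ← touched_twist hω.balanced hτ hsw, touched_swap hxy] at hz
  have hstab : ∀ {z u}, σ'.SameCycle z u →
      ((ω.2 z = a ∨ ω.2 z = Λ.iota a) ↔ (ω.2 u = a ∨ ω.2 u = Λ.iota a)) := by
    intro z u hzu
    rw [← htou, ← htou, ← touched_twist hω.balanced hτ hsw, Touched.congr hzu,
      touched_twist hω.balanced hτ hsw]
  have hun : ∀ z, ¬ (ω.2 z = a ∨ ω.2 z = Λ.iota a) → ∀ u, σ'.SameCycle z u ↔ ω.2 z = ω.2 u := by
    intro z hz u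
    rw [hσ', sameCycle_twist_of_not_touched hω.balanced hτ hsw (by rwa [htou])
      (by rw [htou, hω.label_tau]; have := ii (ω.2 z); have := ii a; grind), hω.sameCycle]
  have hyx : σ'.SameCycle (τ x) y := (hbal.sameCycle_tau_comm hτ).2 hcr.2
  -- the new cycles are those of `x` and of `τ x`
  have htx : ∀ z, (ω.2 z = a ∨ ω.2 z = Λ.iota a) →
      (σ'.SameCycle (τ z) x ↔ ¬ σ'.SameCycle z x) := by
    intro z hz
    constructor
    · intro h1 h2
      exact hbal.not_sameCycle hτ z (h2.trans h1.symm)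
    · intro h1
      exact (hbal.sameCycle_tau (((htou' z hz).resolve_left h1))).trans hcr.2.symm
  have hequiv : ∀ z, crossLabel Λ a c σ' x ω.2 (τ z) = Λ.iota (crossLabel Λ a c σ' x ω.2 z) := by
    intro z
    simp only [crossLabel, hω.label_tau]
    have := ii (ω.2 z)
    have := ii a
    have := ii c
    by_cases hz : ω.2 z = a ∨ ω.2 z = Λ.iota a
    · have := htx z hz
      grind
    · grind
  refine ⟨hsw, (swap_ne_tau hτ hxy).2 hxy', rfl, fun z hz => ?_,
    fun z hz => ?_, fun z hz => ?_, hbal, fun z => ?_, fun z => ?_, fun z u => ?_, fun d hd' => ?_⟩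
  · rw [hd] at hz
    simp only [crossLabel, if_neg hz]
  · rw [hd] at hz
    rw [hb]
    have := h.tgt_iota
    simp only [crossLabel, if_pos hz]
    grind
  · rw [hd]
    have := h.tgt_iota
    rw [swap_apply_def] at hz ⊢
    split_ifs at hz ⊢ <;> simp_all
  · have h1 : crossLabel Λ a c σ' x ω.2 z ∈ s.born ∨
        crossLabel Λ a c σ' x ω.2 z ∈ s.before \ s.dying := by
      rw [hb, Finset.mem_sdiff, hd]
      have := hω.mem z
      simp only [crossLabel]
      grind
    rcases h1 with h1 | h1
    · exact s.born_subset h1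
    · rw [s.sdiff_eq] at h1
      exact (Finset.mem_sdiff.1 h1).1
  · exact hequiv z
  · by_cases hz : ω.2 z = a ∨ ω.2 z = Λ.iota a
    · by_cases hu : ω.2 u = a ∨ ω.2 u = Λ.iota a
      · simp only [crossLabel, if_pos hz, if_pos hu]
        by_cases h1 : σ'.SameCycle z x <;> by_cases h2 : σ'.SameCycle u x
        · simp [h1, h2, h1.trans h2.symm]
        · simp only [h1, h2, if_true, if_false, n2.symm, iff_false]
          exact fun h3 => h2 (h3.symm.trans h1)
        · simp only [h1, h2, if_true, if_false, n2, iff_false]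
          exact fun h3 => h1 (h3.trans h2)
        · simp only [h1, h2, if_false, iff_true]
          exact ((htou' z hz).resolve_left h1).trans ((htou' u hu).resolve_left h2).symm
      · have h1 : ¬ σ'.SameCycle z u := fun h' => hu ((hstab h').1 hz)
        have := hnb u
        simp only [h1, crossLabel, if_pos hz, if_neg hu, false_iff]
        split_ifs <;> tauto
    · rw [hun z hz]
      have := hnb z
      simp only [crossLabel]
      grind
  · have hc' : d ∈ s.born ∨ d ∈ s.before \ s.dying := by
      rw [s.sdiff_eq, Finset.mem_sdiff]
      tauto
    have m1 : a ∈ s.before := s.dying_subset ((hd _).2 (by simp))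
    have m2 : Λ.iota a ∈ s.before := s.dying_subset ((hd _).2 (by simp))
    rcases hc' with hc' | hc'
    · -- the involution `τ` exchanges the two new cycles, which therefore have the same length
      have e1 : (Finset.univ.filter fun z => (ω.2 z = a ∨ ω.2 z = Λ.iota a)).card =
          2 * Λ.weight a := by
        rw [Finset.filter_or, Finset.card_union_of_disjoint, hω.card _ m1, hω.card _ m2,
          Λ.weight_iota, two_mul]
        rw [Finset.disjoint_filter]
        rintro z - rfl
        exact n1.symm
      have e2 : (Finset.univ.filter fun z => crossLabel Λ a c σ' x ω.2 z = c).card =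
          (Finset.univ.filter fun z => crossLabel Λ a c σ' x ω.2 z = Λ.iota c).card := by
        refine Finset.card_bij' (fun z _ => τ z) (fun z _ => τ z) ?_ ?_ ?_ ?_
        · intro z hz
          have hz' : crossLabel Λ a c σ' x ω.2 z = c := by simpa using hz
          simpa [hz'] using hequiv z
        · intro z hz
          have hz' : crossLabel Λ a c σ' x ω.2 z = Λ.iota c := by simpa using hz
          simpa [hz', ii] using hequiv z
        · simp [hτ.invol]
        · simp [hτ.invol]
      have e3 : (Finset.univ.filter fun z => crossLabel Λ a c σ' x ω.2 z = c).card +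
          (Finset.univ.filter fun z => crossLabel Λ a c σ' x ω.2 z = Λ.iota c).card =
          2 * Λ.weight a := by
        rw [← e1, ← Finset.card_union_of_disjoint, ← Finset.filter_or]
        · congr 1
          ext z
          have := hnb z
          simp only [crossLabel, Finset.mem_filter, Finset.mem_univ, true_and]
          grind
        · rw [Finset.disjoint_filter]
          intro z _ h1 h2
          exact n2 (h2.symm.trans h1)
      rw [hb] at hc'
      rcases hc' with rfl | rfl
      · lia
      · rw [Λ.weight_iota]; lia
    · rw [Finset.mem_sdiff, hd] at hc'
      rw [← hω.card d hc'.1]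
      congr 1
      ext z
      have hce : d ≠ c ∧ d ≠ Λ.iota c := by
        obtain ⟨u, hu⟩ := hω.exists_eq hc'.1
        rw [← hu]; exact hnb u
      simp only [crossLabel, Finset.mem_filter, Finset.mem_univ, true_and]
      grind

/-- At a crossing, the transposition moves a point labelled by `a` and one labelled by its image:
two points `x`, `y` with the same label would lead to four different cycles through `x`, `y` and
their images under `τ`, but only two edges start at the vertex. -/
theorem IsStep.eq_of_cross {a e : E} (hs : IsStep Λ τ s ω η ω')
    (hω : IsState Λ τ s.before ω) (hτ : IsFreeInvolution τ) (h : s.IsCross Λ a e) :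
    ∃ x y c, ω.2 x = a ∧ ω.2 y = Λ.iota a ∧ y ≠ τ x ∧ c ∈ s.born ∧ η = swap x y ∧
      ω'.2 = crossLabel Λ a c ω'.1 x ω.2 := by
  have n1 := Λ.free.ne a
  have ii := Λ.free.invol
  have hd : ∀ c, c ∈ s.dying ↔ c = a ∨ c = Λ.iota a := by simp [h.dying_eq]
  have hb : ∀ c, c ∈ s.born ↔ c = e ∨ c = Λ.iota e := by simp [h.born_eq]
  obtain ⟨x, y, hxy, hη⟩ := hs.isSwap
  have mx := hs.moved x (by simpa [hη] using hxy.symm)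
  have my := hs.moved y (by simpa [hη] using hxy)
  have bx := (hb _).1 (hs.pass x mx.1).1
  have hy' := (hb _).1 (hs.pass y my.1).1
  have hne : ω.2 x ≠ ω.2 y := by
    intro heq
    have hcut := not_sameCycle_twist_of_cut hω.balanced hτ hxy ((hω.sameCycle x y).2 heq)
    rw [← hη, ← hs.fst, hs.isState.sameCycle, hs.isState.sameCycle, hs.isState.label_tau] at hcut
    have := ii e
    grind
  have key : ∀ x y, η = swap x y → ω.2 x = a → ω.2 y = Λ.iota a →
      ω'.2 = crossLabel Λ a (ω'.2 x) ω'.1 x ω.2 := by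
    intro x y hη hx hy
    have hdx : ω.2 x ∈ s.dying := (hd _).2 (.inl hx)
    have h1 := (hb _).1 (hs.pass x hdx).1
    have := ii e
    ext z
    simp only [crossLabel, hs.isState.sameCycle]
    have s1 := hs.stay z
    have s2 := hs.pass z
    rw [hd] at s1 s2
    rw [hb] at s2
    grind
  have dx := (hd _).1 mx.1
  have dy := (hd _).1 my.1
  have hc : (ω.2 x = a ∧ ω.2 y = Λ.iota a) ∨ (ω.2 y = a ∧ ω.2 x = Λ.iota a) := by grind
  rcases hc with hc | hc
  · refine ⟨x, y, _, hc.1, hc.2, ?_, (hs.pass x mx.1).1, hη, key x y hη hc.1 hc.2⟩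
    rw [← swap_ne_tau hτ hxy, ← hη]; exact hs.ne
  · rw [swap_comm] at hη
    refine ⟨y, x, _, hc.1, hc.2, ?_, (hs.pass y my.1).1, hη, key y x hη hc.1 hc.2⟩
    rw [← swap_ne_tau hτ hxy.symm, ← hη]; exact hs.ne

/-- The number of steps from a given state across a crossing. -/
theorem IsState.card_isStep_cross {a e : E} (hω : IsState Λ τ s.before ω)
    (hτ : IsFreeInvolution τ) (h : s.IsCross Λ a e) :
    Nat.card {q : Perm P × (Perm P × (P → E)) // IsStep Λ τ s ω q.1 q.2} =
      2 * (Λ.weight a * (Λ.weight a - 1)) := by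
  have n1 := Λ.free.ne a
  have n2 := Λ.free.ne e
  have hd : ∀ c, c ∈ s.dying ↔ c = a ∨ c = Λ.iota a := by simp [h.dying_eq]
  -- a step is the choice of `x` on the cycle of `a`, of a point `y ≠ τ x` on its image, and of the
  -- new label of `x`
  let F : E → Finset P := fun c => Finset.univ.filter fun z => ω.2 z = c
  let D₀ : Finset (P × P) := (F a ×ˢ F (Λ.iota a)).filter fun q => ¬ q.2 = τ q.1
  have hD₀ : ∀ q, q ∈ D₀ ↔ (ω.2 q.1 = a ∧ ω.2 q.2 = Λ.iota a) ∧ q.2 ≠ τ q.1 := by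
    simp [D₀, F]
  have hcard₀ : D₀.card = Λ.weight a * (Λ.weight a - 1) := by
    have h1 := Finset.card_filter_add_card_filter_not (s := F a ×ˢ F (Λ.iota a))
      (fun q => q.2 = τ q.1)
    have h2 : ((F a ×ˢ F (Λ.iota a)).filter fun q => q.2 = τ q.1).card = (F a).card := by
      refine Finset.card_bij' (fun q _ => q.1) (fun x _ => (x, τ x)) ?_ ?_ ?_ ?_
      · rintro ⟨x, y⟩ hq
        simp only [Finset.mem_filter, Finset.mem_product] at hq
        exact hq.1.1
      · intro x hx
        have : ω.2 x = a := by simpa [F] using hx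
        simp [F, hω.label_tau, this]
      · rintro ⟨x, y⟩ hq
        simp only [Finset.mem_filter] at hq
        simp [hq.2]
      · simp
    rw [h2, Finset.card_product, hω.card, hω.card, Λ.weight_iota] at h1
    · rw [Nat.mul_sub_one]
      exact Nat.eq_sub_of_add_eq' h1
    all_goals exact s.dying_subset ((hd _).2 (by simp))
  have hcard : (D₀ ×ˢ s.born).card = 2 * (Λ.weight a * (Λ.weight a - 1)) := by
    rw [Finset.card_product, hcard₀, h.born_eq, Finset.card_pair n2.symm, mul_comm]
  rw [← hcard, ← Nat.card_eq_finsetCard]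
  symm
  refine Nat.card_eq_of_bijective (fun q : ↥(D₀ ×ˢ s.born) => ⟨(swap q.1.1.1 q.1.1.2,
    (twist τ (swap q.1.1.1 q.1.1.2) ω.1,
      crossLabel Λ a q.1.2 (twist τ (swap q.1.1.1 q.1.1.2) ω.1) q.1.1.1 ω.2)), ?_⟩) ⟨?_, ?_⟩
  · have hq := Finset.mem_product.1 q.2
    have hq' := (hD₀ _).1 hq.1
    exact hω.isStep_cross hτ h hq'.1.1 hq'.1.2 hq'.2 hq.2
  · rintro ⟨⟨⟨x, y⟩, c⟩, hq⟩ ⟨⟨⟨x', y'⟩, c'⟩, hq'⟩ heq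
    have heq' : swap x y = swap x' y' := congrArg (fun z => z.1.1) heq
    have heq2 := congrFun (congrArg (fun z => z.1.2.2) heq) x
    rw [Finset.mem_product, hD₀] at hq hq'
    simp only at hq hq'
    have hxy : x ≠ y := by rintro rfl; grind
    have h1 : x = x' := by
      have h2 : swap x' y' x ≠ x := by rw [← heq']; simpa using hxy.symm
      by_contra hx
      have hy : x = y' := by
        by_contra hy
        exact h2 (swap_apply_of_ne_of_ne hx hy)
      subst hy
      grind
    subst h1
    have h2 := congrArg (fun f : Perm P => f x) heq'
    simp only [swap_apply_left] at h2
    subst h2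
    have h3 : c = c' := by
      simpa [crossLabel, hq.1.1.1, SameCycle.refl] using heq2
    simp [h3]
  · rintro ⟨⟨η, ω'⟩, hs⟩
    obtain ⟨x, y, c, hx, hy, hxy, hc, rfl, hlab⟩ := hs.eq_of_cross hω hτ h
    refine ⟨⟨((x, y), c), Finset.mem_product.2 ⟨(hD₀ _).2 ⟨⟨hx, hy⟩, hxy⟩, hc⟩⟩, ?_⟩
    ext1
    simp only [Prod.mk.injEq, true_and]
    have h1 := hs.fst
    simp only at h1 hlab
    rw [h1] at hlab
    exact Prod.ext h1.symm hlab.symm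

end Cross

/-! ### Renaming the points -/

/-- Two surjections with the same fibres have the same image up to a bijection. -/
theorem exists_equiv_of_surjective {X A B : Type*} {f : X → A} {g : X → B}
    (hf : Function.Surjective f) (hg : Function.Surjective g)
    (h : ∀ x y, f x = f y ↔ g x = g y) : ∃ φ : A ≃ B, ∀ x, φ (f x) = g x := by
  have hinv : ∀ x, g (Function.surjInv hf (f x)) = g x := fun x =>
    (h _ _).1 (Function.surjInv_eq hf _)
  refine ⟨Equiv.ofBijective (fun a => g (Function.surjInv hf a)) ⟨?_, ?_⟩, hinv⟩
  · intro a b hab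
    have := (h _ _).2 hab
    rwa [Function.surjInv_eq hf, Function.surjInv_eq hf] at this
  · intro b
    obtain ⟨x, rfl⟩ := hg b
    exact ⟨f x, hinv x⟩

/-- The powers of a permutation that fix a point are the multiples of the length of its cycle. -/
theorem zpow_apply_eq_self_iff {P : Type*} [Fintype P] (σ : Perm P) [DecidableRel σ.SameCycle]
    (x : P) (k : ℤ) :
    (σ ^ k) x = x ↔ ((Finset.univ.filter fun z => σ.SameCycle x z).card : ℤ) ∣ k := by
  classical
  have h1 := MulAction.zpow_smul_eq_iff_minimalPeriod_dvd (a := σ) (b := x) (n := k)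
  rw [Perm.smul_def] at h1
  rw [h1, MulAction.minimalPeriod_eq_card, ← Nat.card_eq_fintype_card]
  have h2 : Nat.card (MulAction.orbit (Subgroup.zpowers σ) x) =
      (Finset.univ.filter fun z => σ.SameCycle x z).card := by
    rw [← Fintype.card_subtype, ← Nat.card_eq_fintype_card]
    refine Nat.card_congr (Equiv.subtypeEquivRight fun z => ?_)
    constructor
    · rintro ⟨⟨_, k, rfl⟩, rfl⟩
      exact ⟨k, rfl⟩
    · rintro ⟨k, rfl⟩
      exact ⟨⟨σ ^ k, k, rfl⟩, rfl⟩
  rw [h2]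

section Transport

variable {P E V : Type*} [Fintype P] [DecidableEq P] [DecidableEq E]
variable {Λ : PairedEdges E} {τ : Perm P} {s : Site E V} {ω ω' : Perm P × (P → E)} {η : Perm P}

/-- Renaming the points of a state by `ψ`. -/
def renamePoints (ψ : Perm P) (ω : Perm P × (P → E)) : Perm P × (P → E) :=
  (ψ * ω.1 * ψ⁻¹, fun z => ω.2 (ψ.symm z))

omit [Fintype P] [DecidableEq P] [DecidableEq E] in
theorem renamePoints_mul (ψ φ : Perm P) (ω : Perm P × (P → E)) :
    renamePoints ψ (renamePoints φ ω) = renamePoints (ψ * φ) ω := by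
  refine Prod.ext ?_ rfl
  simp only [renamePoints]; group

omit [Fintype P] [DecidableEq P] [DecidableEq E] in
theorem renamePoints_one (ω : Perm P × (P → E)) : renamePoints 1 ω = ω := by
  refine Prod.ext ?_ rfl
  simp [renamePoints]

variable {ψ : Perm P} (hψ : ∀ z, ψ (τ z) = τ (ψ z))
include hψ

omit [Fintype P] [DecidableEq P] in
theorem symm_tau_comm (z : P) : ψ.symm (τ z) = τ (ψ.symm z) := by
  rw [symm_apply_eq, hψ, apply_symm_apply]

omit [Fintype P] [DecidableEq P] in
theorem twist_conj (η σ : Perm P) :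
    twist τ (ψ * η * ψ⁻¹) (ψ * σ * ψ⁻¹) = ψ * twist τ η σ * ψ⁻¹ := by
  ext z
  simp [twist, mul_apply, symm_tau_comm hψ]

omit [DecidableEq P] in
theorem IsState.transport {S : Finset E} (h : IsState Λ τ S ω) :
    IsState Λ τ S (renamePoints ψ ω) where
  balanced :=
    { conj := fun x => by
        have := h.balanced.conj (ψ.symm x)
        simp only [renamePoints, mul_apply, mul_inv_rev, inv_inv, ← hψ, coe_inv] at this ⊢
        rw [this, symm_tau_comm hψ]
      ne := fun x hx => by
        simp only [renamePoints, mul_apply] at hx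
        apply h.balanced.ne (ψ.symm x)
        rw [← symm_tau_comm hψ, ← hx, symm_apply_apply, coe_inv] }
  mem z := h.mem _
  label_tau z := by simp only [renamePoints, symm_tau_comm hψ, h.label_tau]
  sameCycle z u := by
    simp only [renamePoints, sameCycle_conj, h.sameCycle, coe_inv]
  card e he := by
    rw [← h.card e he]
    refine Finset.card_bij' (fun z _ => ψ.symm z) (fun z _ => ψ z) (fun z hz => ?_)
      (fun z hz => ?_) ?_ ?_
    · exact Finset.mem_filter.2 ⟨Finset.mem_univ _, (Finset.mem_filter.1 hz).2⟩
    · refine Finset.mem_filter.2 ⟨Finset.mem_univ _, ?_⟩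
      simpa [renamePoints] using hz
    · simp
    · simp

theorem IsStep.transport (h : IsStep Λ τ s ω η ω') :
    IsStep Λ τ s (renamePoints ψ ω) (ψ * η * ψ⁻¹) (renamePoints ψ ω') where
  isSwap := by
    obtain ⟨x, y, hxy, rfl⟩ := h.isSwap
    exact ⟨ψ x, ψ y, ψ.injective.ne hxy, by rw [mul_swap_eq_swap_mul, mul_inv_cancel_right]⟩
  ne h' := by
    apply h.ne
    ext z
    have := congrArg (fun f : Perm P => ψ.symm (f (ψ z))) h'
    simpa [mul_apply, ← hψ, symm_tau_comm hψ] using this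
  fst := by
    simp only [renamePoints, twist_conj hψ, h.fst]
  stay z hz := h.stay _ hz
  pass z hz := h.pass _ hz
  moved z hz := by
    have := h.moved (ψ.symm z) (fun h' => hz (by
      rw [mul_apply, mul_apply, coe_inv, h', apply_symm_apply]))
    simpa [renamePoints, mul_apply] using this
  isState := h.isState.transport hψ

/-- The number of steps from a state does not change under renaming. -/
theorem card_isStep_transport :
    Nat.card {q : Perm P × (Perm P × (P → E)) // IsStep Λ τ s (renamePoints ψ ω) q.1 q.2} =
      Nat.card {q : Perm P × (Perm P × (P → E)) // IsStep Λ τ s ω q.1 q.2} := by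
  refine Nat.card_congr
    { toFun := fun q => ⟨(ψ⁻¹ * q.1.1 * ψ, renamePoints ψ⁻¹ q.1.2), ?_⟩
      invFun := fun q => ⟨(ψ * q.1.1 * ψ⁻¹, renamePoints ψ q.1.2), q.2.transport hψ⟩
      left_inv := fun q => ?_
      right_inv := fun q => ?_ }
  · have := q.2.transport (ψ := ψ⁻¹) (symm_tau_comm hψ)
    rwa [renamePoints_mul, inv_mul_cancel, renamePoints_one, inv_inv] at this
  · ext1
    refine Prod.ext ?_ ?_
    · simp only; group
    · simp [renamePoints_mul, renamePoints_one]
  · ext1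
    refine Prod.ext ?_ ?_
    · simp only; group
    · simp [renamePoints_mul, renamePoints_one]

end Transport

section Frames

variable {P E : Type*} [Fintype P] [DecidableEq P] [DecidableEq E]
variable {Λ : PairedEdges E} {τ : Perm P} {S T : Finset E} {ω ω' : Perm P × (P → E)}

/-- The point reached from the base point of the edge `q` by `k` steps along its cycle, and by
`τ` if the mark is `false`. -/
def basedPoint (τ : Perm P) (ω : Perm P × (P → E)) (base : T → P) (q : T × Bool × ℤ) : P :=
  if q.2.1 then (ω.1 ^ q.2.2) (base q.1) else τ ((ω.1 ^ q.2.2) (base q.1))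

/-- A set of representatives of the pairs of edges in `S`. -/
structure IsTransversal (Λ : PairedEdges E) (S T : Finset E) : Prop where
  subset : T ⊆ S
  iota_mem : ∀ e ∈ S, Λ.iota e ∈ S
  mem_iff : ∀ e ∈ S, e ∈ T ↔ Λ.iota e ∉ T

omit [DecidableEq E] in
theorem exists_isTransversal [Finite E] (Λ : PairedEdges E) (hS : ∀ e ∈ S, Λ.iota e ∈ S) :
    ∃ T, IsTransversal Λ S T := by
  obtain ⟨k, ⟨f⟩⟩ := Finite.exists_equiv_fin E
  refine ⟨S.filter fun e => f e < f (Λ.iota e), Finset.filter_subset _ _, hS, fun e he => ?_⟩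
  have : f e ≠ f (Λ.iota e) := fun h => Λ.free.ne e (f.injective h).symm
  simp only [Finset.mem_filter, he, hS e he, true_and, Λ.free.invol]
  lia

theorem IsTransversal.union_eq (hT : IsTransversal Λ S T) :
    S = T ∪ T.image Λ.iota ∧ Disjoint T (T.image Λ.iota) := by
  constructor
  · ext e
    simp only [Finset.mem_union, Finset.mem_image]
    constructor
    · intro he
      by_cases h : e ∈ T
      · exact .inl h
      · refine .inr ⟨Λ.iota e, ?_, Λ.free.invol e⟩
        by_contra h'
        exact h ((hT.mem_iff e he).2 h')
    · rintro (h | ⟨q, hq, rfl⟩)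
      · exact hT.subset h
      · exact hT.iota_mem _ (hT.subset hq)
  · rw [Finset.disjoint_left]
    intro e he he'
    obtain ⟨q, hq, rfl⟩ := Finset.mem_image.1 he'
    exact (hT.mem_iff q (hT.subset hq)).1 hq he

theorem IsTransversal.prod_eq (hT : IsTransversal Λ S T) :
    ∏ e ∈ S, Λ.weight e = (∏ e ∈ T, Λ.weight e) ^ 2 := by
  rw [hT.union_eq.1, Finset.prod_union hT.union_eq.2, Finset.prod_image, sq]
  · simp [Λ.weight_iota]
  · exact fun a _ b _ h => by rw [← Λ.free.invol a, h, Λ.free.invol]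

theorem IsTransversal.sum_eq (hT : IsTransversal Λ S T) :
    ∑ e ∈ S, Λ.weight e = 2 * ∑ e ∈ T, Λ.weight e := by
  rw [hT.union_eq.1, Finset.sum_union hT.union_eq.2, Finset.sum_image, two_mul]
  · simp [Λ.weight_iota]
  · exact fun a _ b _ h => by rw [← Λ.free.invol a, h, Λ.free.invol]

variable {base : T → P}

omit [DecidableEq P] in
theorem IsState.label_basedPoint (h : IsState Λ τ S ω) (hb : ∀ q, ω.2 (base q) = q)
    (q : T × Bool × ℤ) :
    ω.2 (basedPoint τ ω base q) = if q.2.1 then (q.1 : E) else Λ.iota q.1 := by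
  have h1 : ω.2 ((ω.1 ^ q.2.2) (base q.1)) = q.1 := by
    rw [← hb q.1, ← h.sameCycle]
    exact sameCycle_zpow_left.2 (SameCycle.refl _ _)
  rw [basedPoint]
  split_ifs
  · exact h1
  · rw [h.label_tau, h1]

omit [DecidableEq P] in
theorem IsState.basedPoint_eq_iff (h : IsState Λ τ S ω) (hT : IsTransversal Λ S T)
    (hb : ∀ q, ω.2 (base q) = q) (q r : T × Bool × ℤ) :
    basedPoint τ ω base q = basedPoint τ ω base r ↔
      q.1 = r.1 ∧ q.2.1 = r.2.1 ∧ (Λ.weight q.1 : ℤ) ∣ q.2.2 - r.2.2 := by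
  classical
  have key : ∀ (e : T) (k l : ℤ), (ω.1 ^ k) (base e) = (ω.1 ^ l) (base e) ↔
      (Λ.weight e : ℤ) ∣ k - l := by
    intro e k l
    have h1 : (Finset.univ.filter fun z => ω.1.SameCycle (base e) z).card = Λ.weight e := by
      rw [← h.card e (hT.subset e.2)]
      simp only [h.sameCycle, hb, eq_comm]
    rw [← h1, ← zpow_apply_eq_self_iff, sub_eq_neg_add, zpow_add, mul_apply, zpow_neg,
      inv_eq_iff_eq]
  constructor
  · intro heq
    have hl := congrArg ω.2 heq
    rw [h.label_basedPoint hb, h.label_basedPoint hb] at hl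
    obtain ⟨⟨e, he⟩, s, k⟩ := q
    obtain ⟨⟨f, hf⟩, t, l⟩ := r
    have h1 := hT.mem_iff e (hT.subset he)
    have h2 := hT.mem_iff f (hT.subset hf)
    have hst : s = t := by
      cases s <;> cases t <;> simp at hl ⊢
      · rw [← hl] at hf; tauto
      · rw [hl] at he; tauto
    subst hst
    have hef : e = f := by
      cases s <;> simp at hl
      · rw [← Λ.free.invol e, hl, Λ.free.invol]
      · exact hl
    subst hef
    refine ⟨rfl, rfl, ?_⟩
    rw [← key]
    cases s <;> simpa [basedPoint] using heq
  · obtain ⟨e, s, k⟩ := q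
    obtain ⟨f, t, l⟩ := r
    rintro ⟨h1, h2, h3⟩
    simp only at h1 h2 h3
    subst h1 h2
    rw [← key] at h3
    simp only [basedPoint, h3]

omit [DecidableEq P] in
theorem IsState.basedPoint_surjective (h : IsState Λ τ S ω) (hτ : IsFreeInvolution τ)
    (hT : IsTransversal Λ S T) (hb : ∀ q, ω.2 (base q) = q) :
    Function.Surjective (basedPoint τ ω base) := by
  have key : ∀ z, ω.2 z ∈ T → ∃ q, ∃ k : ℤ, z = (ω.1 ^ k) (base q) := by
    intro z hz
    have h1 : ω.1.SameCycle (base ⟨ω.2 z, hz⟩) z := by rw [h.sameCycle, hb]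
    obtain ⟨k, hk⟩ := h1
    exact ⟨⟨_, hz⟩, k, hk.symm⟩
  intro z
  by_cases hz : ω.2 z ∈ T
  · obtain ⟨q, k, hq⟩ := key z hz
    exact ⟨(q, true, k), by simp [basedPoint, ← hq]⟩
  · have hz' : ω.2 (τ z) ∈ T := by
      rw [h.label_tau]
      by_contra h'
      exact hz ((hT.mem_iff _ (h.mem z)).2 h')
    obtain ⟨q, k, hq⟩ := key _ hz'
    exact ⟨(q, false, k), by simp [basedPoint, ← hq, hτ.invol]⟩

omit [Fintype P] [DecidableEq P] [DecidableEq E] in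
theorem tau_basedPoint (hτ : IsFreeInvolution τ) (q : T × Bool × ℤ) :
    τ (basedPoint τ ω base q) = basedPoint τ ω base (q.1, !q.2.1, q.2.2) := by
  obtain ⟨q, s, k⟩ := q
  cases s <;> simp [basedPoint, hτ.invol]

omit [DecidableEq P] in
theorem IsState.apply_basedPoint (h : IsState Λ τ S ω)
    (q : T × Bool × ℤ) :
    ω.1 (basedPoint τ ω base q) =
      basedPoint τ ω base (q.1, q.2.1, if q.2.1 then q.2.2 + 1 else q.2.2 - 1) := by
  obtain ⟨q, s, k⟩ := q
  cases s
  · have h1 := h.balanced.conj ((ω.1 ^ (k - 1)) (base q))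
    rw [eq_inv_iff_eq, ← mul_apply ω.1 (ω.1 ^ (k - 1)), ← zpow_one_add, add_sub_cancel] at h1
    simpa [basedPoint] using h1
  · simp [basedPoint, add_comm k 1, zpow_one_add]

omit [DecidableEq P] in
/-- Any two states over the same edges, with base points on the cycles, differ by a unique
renaming of the points that commutes with `τ`. -/
theorem IsState.existsUnique_transport (h : IsState Λ τ S ω) (h' : IsState Λ τ S ω')
    (hτ : IsFreeInvolution τ) (hT : IsTransversal Λ S T) {base' : T → P}
    (hb : ∀ q, ω.2 (base q) = q) (hb' : ∀ q, ω'.2 (base' q) = q) :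
    ∃! ψ : Perm P, (∀ z, ψ (τ z) = τ (ψ z)) ∧ renamePoints ψ ω = ω' ∧ ∀ q, ψ (base q) = base' q := by
  have hs := h.basedPoint_surjective hτ hT hb
  obtain ⟨ψ, hψ⟩ := exists_equiv_of_surjective hs (h'.basedPoint_surjective hτ hT hb')
    (fun q r => by rw [h.basedPoint_eq_iff hT hb, h'.basedPoint_eq_iff hT hb'])
  have h1 : ∀ z, ψ (τ z) = τ (ψ z) := by
    intro z
    obtain ⟨q, rfl⟩ := hs z
    rw [tau_basedPoint hτ, hψ, hψ, tau_basedPoint hτ]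
  have h2 : ∀ z, ψ (ω.1 z) = ω'.1 (ψ z) := by
    intro z
    obtain ⟨q, rfl⟩ := hs z
    rw [h.apply_basedPoint, hψ, hψ, h'.apply_basedPoint]
  have h3 : ∀ z, ω'.2 (ψ z) = ω.2 z := by
    intro z
    obtain ⟨q, rfl⟩ := hs z
    rw [hψ, h.label_basedPoint hb, h'.label_basedPoint hb']
  refine ⟨ψ, ⟨h1, ?_, fun q => ?_⟩, ?_⟩
  · refine Prod.ext ?_ ?_
    · ext z
      simp [renamePoints, mul_apply, h2]
    · ext z
      simp [renamePoints, ← h3]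
  · simpa [basedPoint] using hψ (q, true, 0)
  · rintro φ ⟨g1, rfl, g3⟩
    ext z
    obtain ⟨q, rfl⟩ := hs z
    rw [hψ]
    have g2 : ∀ (k : ℤ) z, φ ((ω.1 ^ k) z) = (((φ * ω.1 * φ⁻¹) ^ k : Perm P) (φ z)) := by
      intro k z
      rw [conj_zpow]
      simp [mul_apply]
    obtain ⟨q, s, k⟩ := q
    cases s <;> simp only [basedPoint, g1, g2, renamePoints, g3, if_true, Bool.false_eq_true, if_false]

end Frames

/-! ### The number of states -/

section CountStates

variable {P E : Type*} [Fintype P] [DecidableEq E]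
variable {Λ : PairedEdges E} {τ : Perm P} {S T : Finset E} {ω ω' : Perm P × (P → E)}

theorem IsState.iota_mem (h : IsState Λ τ S ω) : ∀ e ∈ S, Λ.iota e ∈ S := by
  intro e he
  obtain ⟨z, rfl⟩ := h.exists_eq he
  rw [← h.label_tau]
  exact h.mem _

theorem IsState.exists_base (h : IsState Λ τ S ω) (hT : IsTransversal Λ S T) :
    ∃ base : T → P, ∀ q, ω.2 (base q) = q := by
  choose b hb using fun q : T => h.exists_eq (hT.subset q.2)
  exact ⟨b, hb⟩

/-- States over the same edges differ by a renaming of the points that commutes with `τ`. -/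
theorem IsState.exists_transport [Finite E] (h : IsState Λ τ S ω) (h' : IsState Λ τ S ω')
    (hτ : IsFreeInvolution τ) :
    ∃ ψ : Perm P, (∀ z, ψ (τ z) = τ (ψ z)) ∧ renamePoints ψ ω = ω' := by
  obtain ⟨T, hT⟩ := exists_isTransversal Λ h.iota_mem
  obtain ⟨b, hb⟩ := h.exists_base hT
  obtain ⟨b', hb'⟩ := h'.exists_base hT
  obtain ⟨ψ, ⟨h1, h2, -⟩, -⟩ := h.existsUnique_transport h' hτ hT hb hb'
  exact ⟨ψ, h1, h2⟩

/-- As the renamings that commute with `τ` permute the states with base points simply transitively,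
the number of states times the number of choices of base points is the order of the centralizer
of `τ`. -/
theorem IsState.card_mul_prod [Finite E] (h : IsState Λ τ S ω)
    (hτ : IsFreeInvolution τ) (hT : IsTransversal Λ S T) :
    Nat.card {ω : Perm P × (P → E) // IsState Λ τ S ω} * ∏ e ∈ T, Λ.weight e =
      Nat.card {ψ : Perm P // ∀ z, ψ (τ z) = τ (ψ z)} := by
  classical
  obtain ⟨b, hb⟩ := h.exists_base hT
  have h1 : Nat.card {ψ : Perm P // ∀ z, ψ (τ z) = τ (ψ z)} =
      Nat.card (Σ ω : {ω : Perm P × (P → E) // IsState Λ τ S ω},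
        ∀ q : T, {z // ω.1.2 z = q}) := by
    refine Nat.card_eq_of_bijective (fun ψ => ⟨⟨renamePoints ψ.1 ω, h.transport ψ.2⟩,
      fun q => ⟨ψ.1 (b q), by simp [renamePoints, hb]⟩⟩) ⟨?_, ?_⟩
    · rintro ⟨ψ, hψ⟩ ⟨φ, hφ⟩ heq
      obtain ⟨heq1, heq2⟩ := Sigma.mk.inj_iff.1 heq
      have heq1 : renamePoints ψ ω = renamePoints φ ω := congrArg Subtype.val heq1
      have heq2 : ∀ q, ψ (b q) = φ (b q) := by
        intro q
        have hfun : ∀ {x y : {ω : Perm P × (P → E) // IsState Λ τ S ω}}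
            (f : ∀ q : T, {z // x.1.2 z = q}) (g : ∀ q : T, {z // y.1.2 z = q}),
            x = y → HEq f g → (f q : P) = g q := by
          rintro x _ f g rfl hfg
          rw [eq_of_heq hfg]
        exact hfun _ _ (Subtype.ext heq1) heq2
      have hu := h.existsUnique_transport (h.transport hψ) hτ hT hb
        (base' := fun q => ψ (b q)) (fun q => by simp [renamePoints, hb])
      exact Subtype.ext (hu.unique ⟨hψ, rfl, fun _ => rfl⟩
        ⟨hφ, heq1.symm, fun q => (heq2 q).symm⟩)
    · rintro ⟨⟨ω', h'⟩, b'⟩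
      obtain ⟨ψ, ⟨hψ, rfl, hb'⟩, -⟩ := h.existsUnique_transport h' hτ hT hb
        (base' := fun q => b' q) (fun q => (b' q).2)
      refine ⟨⟨ψ, hψ⟩, Sigma.ext rfl (heq_of_eq ?_)⟩
      ext q
      exact hb' q
  have h2 : ∀ ω : {ω : Perm P × (P → E) // IsState Λ τ S ω},
      Nat.card (∀ q : T, {z // ω.1.2 z = q}) = ∏ e ∈ T, Λ.weight e := by
    rintro ⟨ω, h⟩
    rw [Nat.card_pi, ← Finset.prod_coe_sort T fun e => Λ.weight e]
    refine Finset.prod_congr rfl fun q _ => ?_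
    rw [← h.card q (hT.subset q.2), Nat.card_eq_fintype_card, Fintype.card_subtype]
  have : Fintype {ω : Perm P × (P → E) // IsState Λ τ S ω} := Fintype.ofFinite _
  rw [h1, Nat.card_sigma, Finset.sum_congr rfl fun ω _ => h2 ω, Finset.sum_const,
    Finset.card_univ, Nat.card_eq_fintype_card, smul_eq_mul]

end CountStates

section Tau

theorem tau_isFreeInvolution (n : ℕ) : IsFreeInvolution (tau n) where
  invol x := by rcases x with x | x <;> rfl
  ne x := by rcases x with x | x <;> simp [tau]

theorem tau_mul_tau (n : ℕ) : tau n * tau n = 1 := by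
  ext x; exact (tau_isFreeInvolution n).invol x

/-- The order of the centralizer of `τ`. -/
theorem card_commute_tau (n : ℕ) :
    Nat.card {ψ : Perm (Fin n ⊕ Fin n) // ∀ z, ψ (tau n z) = tau n (ψ z)} =
      Nat.doubleFactorial (2 * n) := by
  rcases Nat.eq_zero_or_pos n with rfl | hn
  · have : Unique {ψ : Perm (Fin 0 ⊕ Fin 0) // ∀ z, ψ (tau 0 z) = tau 0 (ψ z)} :=
      { default := ⟨1, fun z => rfl⟩
        uniq := fun ψ => Subtype.ext (Subsingleton.elim _ _) }
    simp
  have h1 : Nat.card {ψ : Perm (Fin n ⊕ Fin n) // ∀ z, ψ (tau n z) = tau n (ψ z)} =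
      Nat.card (Subgroup.centralizer {tau n}) := by
    refine Nat.card_congr (Equiv.subtypeEquivRight fun ψ => ?_)
    rw [Subgroup.mem_centralizer_singleton_iff]
    exact ⟨fun h => by ext z; exact h z, fun h z => congrArg (fun f : Perm _ => f z) h⟩
  have hord : orderOf (tau n) = 2 := by
    refine orderOf_eq_prime (by rw [sq, tau_mul_tau]) fun h => ?_
    exact (tau_isFreeInvolution n).ne (Sum.inl ⟨0, hn⟩) (by rw [h]; rfl)
  obtain ⟨k, hk⟩ := cycleType_prime_order (σ := tau n) (by rw [hord]; exact Nat.prime_two)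
  have hsupp : (tau n).support = Finset.univ := by
    ext z; simp [(tau_isFreeInvolution n).ne z]
  have hsum := (tau n).sum_cycleType
  rw [hsupp, hk, hord, Finset.card_univ, Multiset.sum_replicate, smul_eq_mul] at hsum
  have hkn : k + 1 = n := by
    simp at hsum; lia
  rw [hkn, hord] at hk
  rw [h1, nat_card_centralizer, hk]
  have h3 : (Multiset.replicate n 2).toFinset = {2} := by
    rw [Multiset.toFinset_replicate]; simp [hn.ne']
  rw [h3, Nat.doubleFactorial_two_mul]
  simp [mul_comm n 2, two_mul]

variable {E : Type*} [DecidableEq E] {Λ : PairedEdges E} {S T : Finset E} {n : ℕ}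

/-- A state for any edges of total weight `2n`: the cycle on each representative `e` of the pairs
of edges is modelled by `ℤ/w(e)`. -/
theorem IsTransversal.exists_isState (hT : IsTransversal Λ S T)
    (hsum : ∑ e ∈ S, Λ.weight e = 2 * n) :
    ∃ ω : Perm (Fin n ⊕ Fin n) × (Fin n ⊕ Fin n → E), IsState Λ (tau n) S ω := by
  classical
  have hne : ∀ q : T, NeZero (Λ.weight q) := fun q => ⟨(Λ.weight_pos q).ne'⟩
  let M := Σ q : T, ZMod (Λ.weight q)
  have : ∀ q : T, Fintype (ZMod (Λ.weight q)) := fun q => ZMod.fintype _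
  have hcard : Fintype.card M = n := by
    rw [Fintype.card_sigma]
    simp only [ZMod.card]
    rw [Finset.sum_coe_sort T (fun q => Λ.weight q)]
    have := hT.sum_eq
    lia
  let f : M ≃ Fin n := Fintype.equivFinOfCardEq hcard
  let ρ₀ : Perm M := Equiv.sigmaCongrRight fun q => Equiv.addRight 1
  let ρ : Perm (Fin n) := f.permCongr ρ₀
  let l : Fin n → E := fun i => (f.symm i).1
  have hρ : ∀ m, ρ (f m) = f ⟨m.1, m.2 + 1⟩ := by
    intro m; simp [ρ, ρ₀, Equiv.permCongr_apply, Equiv.sigmaCongrRight]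
  have hpow : ∀ (k : ℕ) m, (ρ ^ k) (f m) = f ⟨m.1, m.2 + k⟩ := by
    intro k
    induction k with
    | zero => simp
    | succ k ih =>
      intro m
      rw [pow_succ', mul_apply, ih, hρ]
      simp [add_assoc]
  have hl : ∀ i j, ρ.SameCycle i j ↔ l i = l j := by
    intro i j
    obtain ⟨⟨q, a⟩, rfl⟩ := f.surjective i
    obtain ⟨⟨r, b⟩, rfl⟩ := f.surjective j
    simp only [l, symm_apply_apply]
    constructor
    · intro h
      obtain ⟨k, hk⟩ := h.exists_nat_pow_eq
      rw [hpow] at hk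
      exact congrArg (fun m : M => (m.1 : E)) (f.injective hk)
    · intro h
      have := Subtype.ext h
      subst this
      refine ⟨((b - a).val : ℤ), ?_⟩
      rw [zpow_natCast, hpow]
      simp
  have hfib : ∀ q : T, (Finset.univ.filter fun i => l i = q).card = Λ.weight q := by
    intro q
    rw [← ZMod.card (Λ.weight q), ← Fintype.card_subtype]
    symm
    refine Fintype.card_congr (Equiv.ofBijective
      (fun a : ZMod (Λ.weight q) => (⟨f ⟨q, a⟩, by simp [l]⟩ : {i // l i = q})) ⟨?_, ?_⟩)
    · intro a b hab
      have := f.injective (congrArg Subtype.val hab)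
      exact eq_of_heq (Sigma.mk.inj_iff.1 this).2
    · rintro ⟨i, hi⟩
      obtain ⟨⟨r, b⟩, rfl⟩ := f.surjective i
      simp only [l, symm_apply_apply] at hi
      have := Subtype.ext hi
      subst this
      exact ⟨b, rfl⟩
  have hlT : ∀ i, l i ∈ T := fun i => (f.symm i).1.2
  -- `tau` exchanges the two copies of `Fin n`, so that the inverse acts on the second copy
  let σ : Perm (Fin n ⊕ Fin n) := Equiv.sumCongr ρ ρ⁻¹
  let lab : Fin n ⊕ Fin n → E := Sum.elim l fun i => Λ.iota (l i)
  have hpowl : ∀ (k : ℕ) i, (σ ^ k) (Sum.inl i) = Sum.inl ((ρ ^ k) i) := by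
    intro k i
    induction k with
    | zero => rfl
    | succ k ih => rw [pow_succ', mul_apply, ih, pow_succ', mul_apply]; rfl
  have hpowr : ∀ (k : ℕ) i, (σ ^ k) (Sum.inr i) = Sum.inr ((ρ⁻¹ ^ k) i) := by
    intro k i
    induction k with
    | zero => rfl
    | succ k ih => rw [pow_succ', mul_apply, ih, pow_succ', mul_apply]; rfl
  have hiT : ∀ e ∈ T, ∀ e' ∈ T, e ≠ Λ.iota e' := by
    rintro e he e' he' rfl
    exact (hT.mem_iff e' (hT.subset he')).1 he' he
  have hij : ∀ a b, Λ.iota a = Λ.iota b ↔ a = b := fun a b =>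
    ⟨fun h => by rw [← Λ.free.invol a, h, Λ.free.invol], fun h => by rw [h]⟩
  refine ⟨(σ, lab), ⟨fun x => ?_, fun x => ?_⟩, fun z => ?_, fun z => ?_, fun z u => ?_,
    fun e he => ?_⟩
  · rcases x with x | x
    · rfl
    · rfl
  · rcases x with x | x <;> simp [σ, tau]
  · rcases z with z | z
    · exact hT.subset (hlT z)
    · exact hT.iota_mem _ (hT.subset (hlT z))
  · rcases z with z | z
    · rfl
    · exact (Λ.free.invol _).symm
  · constructor
    · intro h
      obtain ⟨k, rfl⟩ := h.exists_nat_pow_eq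
      rcases z with z | z
      · rw [hpowl]
        exact (hl _ _).1 (sameCycle_pow_right.2 (SameCycle.refl _ _))
      · rw [hpowr]
        refine congrArg Λ.iota ((hl _ _).1 ?_)
        rw [← sameCycle_inv]
        exact sameCycle_pow_right.2 (SameCycle.refl _ _)
    · rcases z with z | z <;> rcases u with u | u
      · intro h
        obtain ⟨k, rfl⟩ := ((hl z u).2 h).exists_nat_pow_eq
        rw [← hpowl]
        exact sameCycle_pow_right.2 (SameCycle.refl _ _)
      · intro h
        exact absurd h (hiT _ (hlT z) _ (hlT u))
      · intro h
        exact absurd h.symm (hiT _ (hlT u) _ (hlT z))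
      · intro h
        obtain ⟨k, rfl⟩ := (sameCycle_inv.2 ((hl z u).2 ((hij _ _).1 h))).exists_nat_pow_eq
        rw [← hpowr]
        exact sameCycle_pow_right.2 (SameCycle.refl _ _)
  · have hc : (Finset.univ.filter fun z => lab z = e).card =
        (Finset.univ.filter fun i => l i = e).card +
          (Finset.univ.filter fun i => Λ.iota (l i) = e).card := by
      rw [← Fintype.card_subtype, ← Fintype.card_subtype, ← Fintype.card_subtype,
        ← Fintype.card_sum]
      exact Fintype.card_congr subtypeSum
    refine hc.trans ?_
    by_cases h : e ∈ T
    · have h0 : (Finset.univ.filter fun i => Λ.iota (l i) = e).card = 0 := by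
        rw [Finset.card_eq_zero, Finset.filter_eq_empty_iff]
        exact fun i _ h' => hiT e h _ (hlT i) h'.symm
      rw [h0, add_zero]
      exact hfib ⟨e, h⟩
    · have h' : Λ.iota e ∈ T := by
        by_contra h'
        exact h ((hT.mem_iff e he).2 h')
      have h0 : (Finset.univ.filter fun i => l i = e).card = 0 := by
        rw [Finset.card_eq_zero, Finset.filter_eq_empty_iff]
        rintro i - rfl
        exact h (hlT i)
      rw [h0, zero_add, ← Λ.weight_iota e]
      rw [← hfib ⟨_, h'⟩]
      congr 1
      ext i
      simp only [Finset.mem_filter, Finset.mem_univ, true_and]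
      rw [← hij (l i), Λ.free.invol]

/-- The number of states over edges of total weight `2n`. -/
theorem card_isState_sq [Finite E] (hS : ∀ e ∈ S, Λ.iota e ∈ S)
    (hsum : ∑ e ∈ S, Λ.weight e = 2 * n) :
    Nat.card {ω : Perm (Fin n ⊕ Fin n) × (Fin n ⊕ Fin n → E) // IsState Λ (tau n) S ω} ^ 2 *
      ∏ e ∈ S, Λ.weight e = Nat.doubleFactorial (2 * n) ^ 2 := by
  obtain ⟨T, hT⟩ := exists_isTransversal Λ hS
  obtain ⟨ω, hω⟩ := hT.exists_isState hsum
  rw [hT.prod_eq, ← mul_pow, hω.card_mul_prod (tau_isFreeInvolution n) hT, card_commute_tau]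

theorem IsState.sum_weight {P : Type*} [Fintype P] {τ : Perm P} {ω : Perm P × (P → E)}
    (h : IsState Λ τ S ω) : ∑ e ∈ S, Λ.weight e = Fintype.card P := by
  rw [← Finset.card_univ, Finset.card_eq_sum_card_fiberwise (fun z _ => h.mem z)]
  exact Finset.sum_congr rfl fun e he => (h.card e he).symm

end Tau

/-! ### The number of steps and of paths -/

section CountSteps

variable {E V : Type*} [DecidableEq E] {n : ℕ}
variable {Λ : PairedEdges E} {s : Site E V}
variable {ω ω' : Perm (Fin n ⊕ Fin n) × (Fin n ⊕ Fin n → E)} {η : Perm (Fin n ⊕ Fin n)}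

theorem Site.IsJoin.prod_dying {a₁ a₂ e : E} (h : s.IsJoin Λ a₁ a₂ e) :
    ∏ d ∈ s.dying, Λ.weight d = (Λ.weight a₁ * Λ.weight a₂) ^ 2 := by
  have n1 := Λ.free.ne a₁
  have n2 := Λ.free.ne a₂
  have n3 := h.ne_iota
  have n4 : a₂ ≠ Λ.iota a₁ := fun h' => n3 (by rw [h', Λ.free.invol])
  have n5 := h.ne
  have n6 : Λ.iota a₁ ≠ Λ.iota a₂ := h.iota.ne
  rw [h.dying_eq, Finset.prod_insert, Finset.prod_insert, Finset.prod_insert,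
    Finset.prod_singleton, Λ.weight_iota, Λ.weight_iota]
  · ring
  all_goals simp only [Finset.mem_insert, Finset.mem_singleton]; grind

theorem Site.IsJoin.prod_born {a₁ a₂ e : E} (h : s.IsJoin Λ a₁ a₂ e) :
    ∏ d ∈ s.born, Λ.weight d = Λ.weight e ^ 2 := by
  rw [h.born_eq, Finset.prod_pair (Λ.free.ne e).symm, Λ.weight_iota, sq]

theorem Site.IsJoin.sum_eq {a₁ a₂ e : E} (h : s.IsJoin Λ a₁ a₂ e) :
    ∑ d ∈ s.dying, Λ.weight d = ∑ d ∈ s.born, Λ.weight d := by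
  have n1 := Λ.free.ne a₁
  have n2 := Λ.free.ne a₂
  have n3 := h.ne_iota
  have n4 : a₂ ≠ Λ.iota a₁ := fun h' => n3 (by rw [h', Λ.free.invol])
  have n5 := h.ne
  have n6 : Λ.iota a₁ ≠ Λ.iota a₂ := h.iota.ne
  rw [h.dying_eq, h.born_eq, Finset.sum_pair (Λ.free.ne e).symm, Finset.sum_insert,
    Finset.sum_insert, Finset.sum_pair, Λ.weight_iota, Λ.weight_iota, Λ.weight_iota, h.weight_eq]
  · ring
  · exact n6
  all_goals simp only [Finset.mem_insert, Finset.mem_singleton]; grind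

/-- The number of steps across a cut: read from the right to the left, a cut is a join, for which
the steps from a state have been counted. As all states over the same edges have the same number
of steps, it is enough to compare the numbers of states on both sides. -/
theorem IsState.card_isStep_cut [Finite E] {a₁ a₂ e : E} (hω : IsState Λ (tau n) s.before ω)
    (h : s.reverse.IsJoin Λ a₁ a₂ e) :
    Nat.card {q : Perm (Fin n ⊕ Fin n) × (Perm (Fin n ⊕ Fin n) × (Fin n ⊕ Fin n → E)) //
      IsStep Λ (tau n) s ω q.1 q.2} = 2 * Λ.weight e := by
  have hτ := tau_isFreeInvolution n
  let X := {ω : Perm (Fin n ⊕ Fin n) × (Fin n ⊕ Fin n → E) // IsState Λ (tau n) s.before ω}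
  let Y := {ω : Perm (Fin n ⊕ Fin n) × (Fin n ⊕ Fin n → E) // IsState Λ (tau n) s.after ω}
  let R : Perm (Fin n ⊕ Fin n) × (Fin n ⊕ Fin n → E) → Type _ := fun ω =>
    {q : Perm (Fin n ⊕ Fin n) × (Perm (Fin n ⊕ Fin n) × (Fin n ⊕ Fin n → E)) //
      IsStep Λ (tau n) s ω q.1 q.2}
  let R' : Perm (Fin n ⊕ Fin n) × (Fin n ⊕ Fin n → E) → Type _ := fun ω =>
    {q : Perm (Fin n ⊕ Fin n) × (Perm (Fin n ⊕ Fin n) × (Fin n ⊕ Fin n → E)) //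
      IsStep Λ (tau n) s.reverse ω q.1 q.2}
  have hR : ∀ x : X, Nat.card (R x.1) = Nat.card (R ω) := by
    intro x
    obtain ⟨ψ, hψ, hx⟩ := hω.exists_transport x.2 hτ
    rw [← hx]
    exact card_isStep_transport hψ
  have hR' : ∀ y : Y, Nat.card (R' y.1) = 2 * (Λ.weight a₁ * Λ.weight a₂) := fun y =>
    IsState.card_isStep_join (s := s.reverse) y.2 hτ h
  -- the steps from left to right are those from right to left
  have hXY : Nat.card (Σ x : X, R x.1) = Nat.card (Σ y : Y, R' y.1) := by
    refine Nat.card_congr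
      { toFun := fun x => ⟨⟨x.2.1.2, x.2.2.isState⟩, ⟨(x.2.1.1, x.1.1), x.2.2.reverse hτ x.1.2⟩⟩
        invFun := fun y => ⟨⟨y.2.1.2, y.2.2.isState⟩, ⟨(y.2.1.1, y.1.1),
          IsStep.reverse (s := s.reverse) hτ y.2.2 y.1.2⟩⟩
        left_inv := fun x => rfl
        right_inv := fun y => rfl }
  have : Fintype X := Fintype.ofFinite _
  have : Fintype Y := Fintype.ofFinite _
  rw [Nat.card_sigma, Nat.card_sigma, Finset.sum_congr rfl fun x _ => hR x,
    Finset.sum_congr rfl fun y _ => hR' y, Finset.sum_const, Finset.sum_const, Finset.card_univ,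
    Finset.card_univ, ← Nat.card_eq_fintype_card, ← Nat.card_eq_fintype_card, smul_eq_mul,
    smul_eq_mul] at hXY
  -- the formula for the number of states requires that the edges on the right side are stable
  -- under `iota`
  have hdb : ∀ e ∈ s.after, Λ.iota e ∈ s.after := by
    intro d hd
    have hb : s.born = {a₁, a₂, Λ.iota a₁, Λ.iota a₂} := h.dying_eq
    have hdy : s.dying = {e, Λ.iota e} := h.born_eq
    by_cases hdb : d ∈ s.born
    · apply s.born_subset
      rw [hb] at hdb ⊢
      have := Λ.free.invol
      simp only [Finset.mem_insert, Finset.mem_singleton] at hdb ⊢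
      grind
    · have h1 : d ∈ s.before \ s.dying := by rw [s.sdiff_eq]; exact Finset.mem_sdiff.2 ⟨hd, hdb⟩
      have h2 : Λ.iota d ∈ s.before \ s.dying := by
        rw [Finset.mem_sdiff] at h1 ⊢
        refine ⟨hω.iota_mem d h1.1, fun h2 => h1.2 ?_⟩
        rw [hdy] at h2 ⊢
        have := Λ.free.invol
        simp only [Finset.mem_insert, Finset.mem_singleton] at h2 ⊢
        grind
      rw [s.sdiff_eq] at h2
      exact (Finset.mem_sdiff.1 h2).1
  have hsum := hω.sum_weight
  have hcard : Fintype.card (Fin n ⊕ Fin n) = 2 * n := by simp [two_mul]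
  rw [hcard] at hsum
  have hsum' : ∑ e ∈ s.after, Λ.weight e = 2 * n := by
    rw [← hsum, ← Finset.sum_sdiff s.dying_subset, ← Finset.sum_sdiff s.born_subset, s.sdiff_eq]
    exact congrArg _ h.sum_eq
  have c1 := card_isState_sq hω.iota_mem hsum
  have c2 := card_isState_sq hdb hsum'
  rw [← Finset.prod_sdiff s.dying_subset, show ∏ e ∈ s.dying, Λ.weight e = Λ.weight e ^ 2
    from h.prod_born] at c1
  rw [← Finset.prod_sdiff s.born_subset, show ∏ e ∈ s.born, Λ.weight e =
    (Λ.weight a₁ * Λ.weight a₂) ^ 2 from h.prod_dying, ← s.sdiff_eq] at c2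
  set p := ∏ e ∈ s.before \ s.dying, Λ.weight e
  have hp : 0 < p := Finset.prod_pos fun e _ => Λ.weight_pos e
  have hX : 0 < Nat.card X := Nat.card_pos_iff.2 ⟨⟨⟨ω, hω⟩⟩, inferInstance⟩
  have w1 := Λ.weight_pos a₁
  have w2 := Λ.weight_pos a₂
  change Nat.card (R ω) = _
  change Nat.card X ^ 2 * _ = _ at c1
  change Nat.card Y ^ 2 * _ = _ at c2
  set r := Nat.card (R ω)
  set x := Nat.card X
  set y := Nat.card Y
  set w := Λ.weight a₁ * Λ.weight a₂
  have hw : 0 < w := Nat.mul_pos w1 w2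
  -- `x r = 2 y w`, `x² p e² = y² p w²`
  have e1 : (x * Λ.weight e) ^ 2 = (y * w) ^ 2 := by
    apply Nat.eq_of_mul_eq_mul_left hp
    calc p * (x * Λ.weight e) ^ 2 = x ^ 2 * (p * Λ.weight e ^ 2) := by ring
      _ = y ^ 2 * (p * w ^ 2) := by rw [c1, c2]
      _ = _ := by ring
  have e2 : x * Λ.weight e = y * w := Nat.pow_left_injective (by norm_num) e1
  apply Nat.eq_of_mul_eq_mul_left hX
  rw [hXY]
  linarith

/-- The branch point lies under a join, a cut or a crossing, which contributes the factor `c` to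
the product of the vertex factors `ω_V - 1`. -/
def Site.HasFactor (Λ : PairedEdges E) (s : Site E V) (c : ℕ) : Prop :=
  (∃ a₁ a₂ e, (s.IsJoin Λ a₁ a₂ e ∨ s.reverse.IsJoin Λ a₁ a₂ e) ∧ c = 1) ∨
    ∃ a e, s.IsCross Λ a e ∧ c = Λ.weight a - 1

/-- The number of steps from a state, in a form that is the same for joins, cuts and crossings. -/
theorem IsState.card_isStep_sq [Finite E] {c : ℕ} (hω : IsState Λ (tau n) s.before ω)
    (h : s.HasFactor Λ c) :
    Nat.card {q : Perm (Fin n ⊕ Fin n) × (Perm (Fin n ⊕ Fin n) × (Fin n ⊕ Fin n → E)) //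
      IsStep Λ (tau n) s ω q.1 q.2} ^ 2 = (2 * c) ^ 2 * ∏ d ∈ s.dying, Λ.weight d := by
  rcases h with ⟨a₁, a₂, e, h | h, rfl⟩ | ⟨a, e, h, rfl⟩
  · rw [hω.card_isStep_join (tau_isFreeInvolution n) h, h.prod_dying]
    ring
  · rw [hω.card_isStep_cut h, show ∏ e ∈ s.dying, Λ.weight e = Λ.weight e ^ 2 from h.prod_born]
    ring
  · rw [hω.card_isStep_cross (tau_isFreeInvolution n) h, h.dying_eq,
      Finset.prod_pair (Λ.free.ne a).symm, Λ.weight_iota]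
    ring

end CountSteps

/-- Counting paths: if the number of steps from a state at time `i` is always `R i`, then the
number of paths is the product of these numbers with the number of initial states. -/
theorem card_paths {Ω L : Type*} [Finite Ω] [Finite L] :
    ∀ (b : ℕ) (I : Ω → Prop) (St : Fin b → Ω → L → Ω → Prop) (Inv : Fin b → Ω → Prop)
      (R : Fin b → ℕ),
    (∀ (h : 0 < b) ω, I ω → Inv ⟨0, h⟩ ω) →
    (∀ (i : Fin b) (h : i.1 + 1 < b) ω l ω', St i ω l ω' → Inv ⟨i.1 + 1, h⟩ ω') →
    (∀ i ω, Inv i ω → Nat.card {q : L × Ω // St i ω q.1 q.2} = R i) →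
    Nat.card {x : (Fin (b + 1) → Ω) × (Fin b → L) //
      I (x.1 0) ∧ ∀ i : Fin b, St i (x.1 i.castSucc) (x.2 i) (x.1 i.succ)} =
      Nat.card {ω // I ω} * ∏ i, R i := by
  intro b
  induction b with
  | zero =>
    intro I St Inv R _ _ _
    rw [Finset.univ_eq_empty, Finset.prod_empty, mul_one]
    refine Nat.card_congr
      { toFun := fun x => ⟨x.1.1 0, x.2.1⟩
        invFun := fun ω => ⟨(fun _ => ω.1, Fin.elim0), ω.2, fun i => i.elim0⟩
        left_inv := fun x => ?_
        right_inv := fun ω => rfl }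
    ext i
    · rw [Fin.eq_zero i]
    · exact i.elim0
  | succ b ih =>
    intro I St Inv R h0 hs hR
    rw [Fin.prod_univ_castSucc, ← mul_assoc, ← ih I (fun i => St i.castSucc)
      (fun i => Inv i.castSucc) (fun i => R i.castSucc) (fun h => h0 (by lia))
      (fun i h => hs i.castSucc (by simp)) (fun i => hR i.castSucc)]
    -- split off the last step
    let Y := {x : (Fin (b + 1) → Ω) × (Fin b → L) //
      I (x.1 0) ∧ ∀ i : Fin b, St i.castSucc (x.1 i.castSucc) (x.2 i) (x.1 i.succ)}
    have hY : ∀ y : Y, Inv (Fin.last b) (y.1.1 (Fin.last b)) := by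
      rintro ⟨⟨x, l⟩, hx0, hx⟩
      cases b with
      | zero => exact h0 (by lia) _ hx0
      | succ b => exact hs (Fin.last b).castSucc (by simp) _ _ _ (hx (Fin.last b))
    have : Fintype Y := Fintype.ofFinite _
    have hcard : Nat.card (Σ y : Y, {q : L × Ω //
        St (Fin.last b) (y.1.1 (Fin.last b)) q.1 q.2}) = Nat.card Y * R (Fin.last b) := by
      rw [Nat.card_sigma, Finset.sum_congr rfl fun y _ => hR _ _ (hY y), Finset.sum_const,
        Finset.card_univ, Nat.card_eq_fintype_card, smul_eq_mul]
    rw [← hcard]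
    refine Nat.card_congr
      { toFun := fun x => ⟨⟨(fun i => x.1.1 i.castSucc, fun i => x.1.2 i.castSucc), x.2.1,
          fun i => x.2.2 i.castSucc⟩, ⟨(x.1.2 (Fin.last b), x.1.1 (Fin.last (b + 1))),
          x.2.2 (Fin.last b)⟩⟩
        invFun := fun y => ⟨(Fin.snoc (α := fun _ => Ω) y.1.1.1 y.2.1.2,
          Fin.snoc (α := fun _ => L) y.1.1.2 y.2.1.1), ?_, ?_⟩
        left_inv := fun x => ?_
        right_inv := fun y => ?_ }
    · have h1 := y.1.2.1
      have : (0 : Fin (b + 1 + 1)) = Fin.castSucc 0 := rfl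
      simp only [this, Fin.snoc_castSucc]
      exact h1
    · intro i
      refine Fin.lastCases ?_ (fun i => ?_) i
      · simp only [Fin.snoc_castSucc, Fin.succ_last, Fin.snoc_last]
        exact y.2.2
      · simp only [Fin.succ_castSucc, Fin.snoc_castSucc]
        exact y.1.2.2 i
    · ext1
      refine Prod.ext ?_ ?_
      · funext i
        refine Fin.lastCases ?_ (fun i => ?_) i <;> simp
      · funext i
        refine Fin.lastCases ?_ (fun i => ?_) i <;> simp
    · obtain ⟨⟨⟨x, l⟩, h1, h2⟩, ⟨l', ω⟩, h3⟩ := y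
      refine Sigma.subtype_ext (Subtype.ext ?_) ?_ <;> simp

/-! ### The sites of a cover -/

section Cover

open scoped Classical

variable {n g : ℕ} {μ ν : n.Partition} {p : Fin (numBranch g μ ν) → ℝ}
variable (X : TwistedTropicalCover g μ ν p)

/-- No edge is contracted. Covers with a contracted edge have multiplicity zero. -/
def Nondegenerate : Prop := ∀ h, X.slope h ≠ 0

/-- The index of the branch point under a vertex. -/
noncomputable def time (v : X.V) : Fin (numBranch g μ ν) := (X.pos_mem v).choose

theorem pos_eq (v : X.V) : X.pos v = p (time X v) := (X.pos_mem v).choose_spec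

/-- Every edge is represented by its half-edge at the right end, or by its only half-edge if there
is no vertex at the right end. -/
def IsRep (h : X.H) : Prop := X.slope h < 0 ∨ X.inv h = h

/-- The number of the branch points that are passed before the edge starts; zero for the ends over
the left ray. -/
noncomputable def birth (h : X.H) : ℕ :=
  if X.inv h = h ∧ X.slope h < 0 then 0 else time X (X.root (X.inv h)) + 1

/-- The index of the branch point at which the edge ends; the number of branch points for the ends
over the right ray. -/
noncomputable def death (h : X.H) : ℕ :=
  if X.slope h < 0 then time X (X.root h) else numBranch g μ ν

/-- The edges over the points between the branch points with the indices `k - 1` and `k`. -/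
noncomputable def alive (k : ℕ) : Finset X.H :=
  Finset.univ.filter fun h => IsRep X h ∧ birth X h ≤ k ∧ k ≤ death X h

variable {X}

theorem mem_alive {k : ℕ} {h : X.H} :
    h ∈ alive X k ↔ IsRep X h ∧ birth X h ≤ k ∧ k ≤ death X h := by
  simp [alive]

theorem time_eq_iff (hp : StrictMono p) {v : X.V} {i : Fin (numBranch g μ ν)} :
    time X v = i ↔ X.pos v = p i := by
  rw [pos_eq, hp.injective.eq_iff]

theorem time_iotaV (hp : StrictMono p) (v : X.V) : time X (X.iotaV v) = time X v := by
  rw [time_eq_iff hp, X.iota_pos, pos_eq]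

theorem slope_inv_pos (hX : Nondegenerate X) {h : X.H} (hh : IsRep X h)
    (hl : ¬ (X.inv h = h ∧ X.slope h < 0)) : 0 < X.slope (X.inv h) := by
  by_cases h1 : X.inv h = h
  · rw [h1]
    have := hX h
    rcases hh with h2 | h2
    · exact absurd ⟨h1, h2⟩ hl
    · by_contra h3
      exact hl ⟨h1, by lia⟩
  · rw [X.slope_inv h h1]
    have := hh.resolve_right h1
    lia

theorem birth_le_death (hp : StrictMono p) (h : X.H) :
    birth X h ≤ death X h := by
  rw [birth, death]
  split_ifs with h1 h2 h2
  · exact Nat.zero_le _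
  · exact Nat.zero_le _
  · have h3 : X.inv h ≠ h := fun h3 => h1 ⟨h3, h2⟩
    have h4 := X.pos_inv h h3
    have h5 : X.length h ≠ ⊤ := fun h5 => h3 ((X.length_eq_top_iff h).1 h5)
    have h6 : 0 < (X.length h).toReal := ENNReal.toReal_pos (X.length_pos h).ne' h5
    have h7 : (X.slope h : ℝ) < 0 := by exact_mod_cast h2
    have h8 : X.pos (X.root (X.inv h)) < X.pos (X.root h) := by
      rw [h4]; nlinarith
    rw [pos_eq, pos_eq, hp.lt_iff_lt] at h8
    exact h8
  · exact (time X _).2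

variable (X) in
/-- The site of a cover at a branch point. -/
noncomputable def site (hp : StrictMono p) (i : ℕ) : Site X.H X.V where
  before := alive X i
  after := alive X (i + 1)
  dying := Finset.univ.filter fun h => IsRep X h ∧ death X h = i
  born := Finset.univ.filter fun h => IsRep X h ∧ birth X h = i + 1
  tgt h := X.root h
  src h := X.root (X.inv h)
  dying_subset h hh := by
    have h1 := (Finset.mem_filter.1 hh).2
    have := birth_le_death hp h
    exact mem_alive.2 ⟨h1.1, by lia, by lia⟩
  born_subset h hh := by
    have h1 := (Finset.mem_filter.1 hh).2
    have := birth_le_death hp h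
    exact mem_alive.2 ⟨h1.1, by lia, by lia⟩
  sdiff_eq := by
    ext h
    simp only [Finset.mem_sdiff, mem_alive, Finset.mem_filter, Finset.mem_univ, true_and]
    grind
  disjoint_born := by
    rw [Finset.disjoint_left]
    intro h h1 h2
    have h1 := mem_alive.1 h1
    have h2 := (Finset.mem_filter.1 h2).2
    lia
  disjoint_dying := by
    rw [Finset.disjoint_left]
    intro h h1 h2
    have h1 := mem_alive.1 h1
    have h2 := (Finset.mem_filter.1 h2).2
    lia

theorem mem_dying (hp : StrictMono p) (i : Fin (numBranch g μ ν)) (h : X.H) :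
    h ∈ (site X hp i).dying ↔ X.slope h < 0 ∧ time X (X.root h) = i := by
  refine Finset.mem_filter.trans ?_
  simp only [Finset.mem_univ, true_and, IsRep, death]
  constructor
  · rintro ⟨-, h2⟩
    split_ifs at h2 with h3
    · exact ⟨h3, Fin.ext h2⟩
    · have := i.2; lia
  · rintro ⟨h1, h2⟩
    exact ⟨.inl h1, by rw [if_pos h1, h2]⟩

theorem isRep_inv {h : X.H} (hh : 0 < X.slope h) : IsRep X (X.inv h) := by
  by_cases h1 : X.inv h = h
  · exact .inr (by rw [X.inv_inv, h1])
  · left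
    rw [X.slope_inv h h1]; lia

theorem mem_born (hp : StrictMono p) (hX : Nondegenerate X) (i : Fin (numBranch g μ ν)) (h : X.H) :
    h ∈ (site X hp i).born ↔ 0 < X.slope (X.inv h) ∧ time X (X.root (X.inv h)) = i := by
  refine Finset.mem_filter.trans ?_
  simp only [Finset.mem_univ, true_and, birth]
  constructor
  · rintro ⟨h1, h2⟩
    split_ifs at h2 with h3
    exact ⟨slope_inv_pos hX h1 h3, Fin.ext (by lia)⟩
  · rintro ⟨h1, h2⟩
    refine ⟨by simpa [X.inv_inv] using isRep_inv h1, ?_⟩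
    rw [if_neg, h2]
    rintro ⟨h3, h4⟩
    rw [h3] at h1
    lia

theorem slope_natAbs_iota (h : X.H) : X.weight (X.iotaH h) = X.weight h := by
  simp [TropicalCover.weight, X.iota_slope]

variable (X) in
/-- The edges of a cover with their weights and the involution. -/
def pairedEdges (hX : Nondegenerate X) : PairedEdges X.H where
  iota := X.iotaH
  free := ⟨X.iotaH_iotaH, fun h => (X.iotaH_ne h).1⟩
  weight := X.weight
  weight_pos h := Int.natAbs_pos.2 (hX h)
  weight_iota := slope_natAbs_iota

theorem weight_inv (h : X.H) : X.weight (X.inv h) = X.weight h := by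
  by_cases h1 : X.inv h = h
  · rw [h1]
  · simp [TropicalCover.weight, X.slope_inv h h1]

variable (X) in
/-- The half-edges at a vertex that leave it to the left. -/
noncomputable def inward (v : X.V) : Finset X.H :=
  Finset.univ.filter fun h => X.root h = v ∧ X.slope h < 0

variable (X) in
/-- The half-edges at a vertex that leave it to the right. -/
noncomputable def outward (v : X.V) : Finset X.H :=
  Finset.univ.filter fun h => X.root h = v ∧ 0 < X.slope h

theorem mem_inward {v : X.V} {h : X.H} : h ∈ inward X v ↔ X.root h = v ∧ X.slope h < 0 := by
  simp [inward]

theorem mem_outward {v : X.V} {h : X.H} : h ∈ outward X v ↔ X.root h = v ∧ 0 < X.slope h := by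
  simp [outward]

theorem sum_inward (v : X.V) : ∑ h ∈ inward X v, X.weight h = ∑ h ∈ outward X v, X.weight h :=
  X.harmonic v

theorem card_inward_add (hX : Nondegenerate X) (v : X.V) :
    (inward X v).card + (outward X v).card = X.valence v := by
  rw [TropicalCurve.valence, Nat.card_eq_fintype_card, Fintype.card_subtype,
    ← Finset.card_union_of_disjoint]
  · congr 1
    ext h
    simp only [Finset.mem_union, mem_inward, mem_outward, Finset.mem_filter, Finset.mem_univ,
      true_and]
    have := hX h
    grind
  · rw [Finset.disjoint_left]
    intro h h1 h2
    have := mem_inward.1 h1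
    have := mem_outward.1 h2
    lia

theorem inward_nonempty_iff (hX : Nondegenerate X) (v : X.V) :
    (inward X v).Nonempty ↔ (outward X v).Nonempty := by
  have aux : ∀ s : Finset X.H, s.Nonempty ↔ 0 < ∑ h ∈ s, X.weight h := by
    intro s
    rw [pos_iff_ne_zero, Ne, Finset.sum_eq_zero_iff, Finset.nonempty_iff_ne_empty, not_iff_not]
    constructor
    · rintro rfl; simp
    · intro h
      rw [Finset.eq_empty_iff_forall_notMem]
      intro a ha
      exact hX a (Int.natAbs_eq_zero.1 (h a ha))
  rw [aux, aux, sum_inward]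

theorem mem_dying_iff_inward (hp : StrictMono p) (i : Fin (numBranch g μ ν)) (h : X.H) :
    h ∈ (site X hp i).dying ↔ ∃ v, time X v = i ∧ h ∈ inward X v := by
  rw [mem_dying]
  simp only [mem_inward]
  constructor
  · rintro ⟨h1, h2⟩
    exact ⟨_, h2, rfl, h1⟩
  · rintro ⟨v, h1, rfl, h2⟩
    exact ⟨h2, h1⟩

theorem mem_born_iff_outward (hp : StrictMono p) (hX : Nondegenerate X)
    (i : Fin (numBranch g μ ν)) (h : X.H) :
    h ∈ (site X hp i).born ↔ ∃ v, time X v = i ∧ X.inv h ∈ outward X v := by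
  rw [mem_born hp hX]
  simp only [mem_outward]
  constructor
  · rintro ⟨h1, h2⟩
    exact ⟨_, h2, rfl, h1⟩
  · rintro ⟨v, h1, h3, h2⟩
    exact ⟨h2, h3 ▸ h1⟩

theorem iotaH_mem_inward {v : X.V} {h : X.H} :
    X.iotaH h ∈ inward X v ↔ h ∈ inward X (X.iotaV v) := by
  rw [mem_inward, mem_inward, X.iota_root, X.iota_slope]
  exact and_congr_left fun _ => ⟨fun h => by rw [← h, X.iotaV_iotaV],
    fun h => by rw [h, X.iotaV_iotaV]⟩

theorem iotaH_mem_outward {v : X.V} {h : X.H} :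
    X.iotaH h ∈ outward X v ↔ h ∈ outward X (X.iotaV v) := by
  rw [mem_outward, mem_outward, X.iota_root, X.iota_slope]
  exact and_congr_left fun _ => ⟨fun h => by rw [← h, X.iotaV_iotaV],
    fun h => by rw [h, X.iotaV_iotaV]⟩

variable (X) in
/-- The product of the vertex factors `ω_V - 1` over a branch point. -/
noncomputable def vertexFactor (i : Fin (numBranch g μ ν)) : ℕ :=
  ∏ v ∈ Finset.univ.filter (fun v => X.valence v = 4 ∧ time X v = i), (X.vertexWeight v - 1)

/-- The two pictures over a branch point with two three-valent vertices. -/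
theorem isJoin_of_inward (hp : StrictMono p) (hX : Nondegenerate X) {i : Fin (numBranch g μ ν)}
    {v : X.V} (hv : X.iotaV v ≠ v) (hfib : ∀ u, time X u = i ↔ u = v ∨ u = X.iotaV v)
    (hval : X.valence v = 3) :
    ∃ a₁ a₂ e, (site X hp i).IsJoin (pairedEdges X hX) a₁ a₂ e ∨
      (site X hp i).reverse.IsJoin (pairedEdges X hX) a₁ a₂ e := by
  have hcard := card_inward_add hX v
  have hsum := sum_inward v
  have hne := inward_nonempty_iff hX v
  rw [← Finset.card_pos, ← Finset.card_pos] at hne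
  have hd : ∀ h, h ∈ (site X hp i).dying ↔ h ∈ inward X v ∨ X.iotaH h ∈ inward X v := by
    intro h
    rw [mem_dying_iff_inward, iotaH_mem_inward]
    simp only [hfib]
    grind
  have hb : ∀ h, h ∈ (site X hp i).born ↔
      X.inv h ∈ outward X v ∨ X.inv (X.iotaH h) ∈ outward X v := by
    intro h
    rw [mem_born_iff_outward hp hX, X.iota_inv, iotaH_mem_outward]
    simp only [hfib]
    grind
  have inv2 := X.inv_inv
  have iota2 := X.iotaH_iotaH
  have iinv := X.iota_inv
  have rin : ∀ {h}, h ∈ inward X v → X.root h = v := fun h => (mem_inward.1 h).1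
  have rout : ∀ {h}, h ∈ outward X v → X.root h = v := fun h => (mem_outward.1 h).1
  -- one edge on one side of the vertex and two on the other: a join or a cut
  have hcases : ((inward X v).card = 2 ∧ (outward X v).card = 1) ∨
      ((inward X v).card = 1 ∧ (outward X v).card = 2) := by lia
  rcases hcases with ⟨h2, h1⟩ | ⟨h1, h2⟩
  · obtain ⟨a₁, a₂, hne, hin⟩ := Finset.card_eq_two.1 h2
    obtain ⟨h, hout⟩ := Finset.card_eq_one.1 h1
    have r1 : X.root a₁ = v := rin (by simp [hin])
    have r2 : X.root a₂ = v := rin (by simp [hin])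
    have r3 : X.root h = v := rout (by simp [hout])
    rw [hin, hout, Finset.sum_pair hne, Finset.sum_singleton] at hsum
    refine ⟨a₁, a₂, X.inv h, .inl ⟨?_, ?_, hne, ?_, ?_, ?_, ?_, ?_, ?_, ?_⟩⟩
    · ext c
      rw [hd, hin]
      simp only [Finset.mem_insert, Finset.mem_singleton, pairedEdges]
      grind
    · ext c
      rw [hb, hout]
      simp only [Finset.mem_insert, Finset.mem_singleton, pairedEdges]
      grind
    · rintro h'
      apply hv
      rw [← r2, ← X.iota_root]
      change a₁ = X.iotaH a₂ at h'
      rw [← h', r1, r2]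
    · simp only [site, inv2, r1, r3]
    · simp only [site, inv2, r2, r3]
    · simp only [site, pairedEdges, ← iinv, inv2, X.iota_root, r1, r3]
    · simp only [site, pairedEdges, ← iinv, inv2, X.iota_root, r2, r3]
    · simp only [site, pairedEdges, ← iinv, inv2, X.iota_root, r3]
      exact hv.symm
    · simp only [pairedEdges, weight_inv, hsum]
  · obtain ⟨a₁, a₂, hne, hout⟩ := Finset.card_eq_two.1 h2
    obtain ⟨h, hin⟩ := Finset.card_eq_one.1 h1
    have r1 : X.root a₁ = v := rout (by simp [hout])
    have r2 : X.root a₂ = v := rout (by simp [hout])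
    have r3 : X.root h = v := rin (by simp [hin])
    rw [hin, hout, Finset.sum_pair hne, Finset.sum_singleton] at hsum
    refine ⟨X.inv a₁, X.inv a₂, h, .inr ⟨?_, ?_, ?_, ?_, ?_, ?_, ?_, ?_, ?_, ?_⟩⟩
    · ext c
      simp only [Site.reverse]
      rw [hb, hout]
      simp only [Finset.mem_insert, Finset.mem_singleton, pairedEdges]
      grind
    · ext c
      simp only [Site.reverse]
      rw [hd, hin]
      simp only [Finset.mem_insert, Finset.mem_singleton, pairedEdges]
      grind
    · exact fun h' => hne (by rw [← inv2 a₁, h', inv2])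
    · rintro h'
      apply hv
      change X.inv a₁ = X.iotaH (X.inv a₂) at h'
      have h'' : a₁ = X.iotaH a₂ := by rw [← inv2 a₁, h', ← iinv, inv2]
      rw [← r2, ← X.iota_root, ← h'', r1, r2]
    · simp only [site, Site.reverse, inv2, r1, r3]
    · simp only [site, Site.reverse, inv2, r2, r3]
    · simp only [site, Site.reverse, pairedEdges, ← iinv, inv2, X.iota_root, r1, r3]
    · simp only [site, Site.reverse, pairedEdges, ← iinv, inv2, X.iota_root, r2, r3]
    · simp only [site, Site.reverse, pairedEdges, X.iota_root, r3]
      exact hv.symm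
    · simp only [pairedEdges, weight_inv, hsum]

/-- The picture over a branch point with a four-valent vertex. -/
theorem isCross_of_inward (hp : StrictMono p) (hX : Nondegenerate X) {i : Fin (numBranch g μ ν)}
    {v : X.V} (hv : X.iotaV v = v) (hfib : ∀ u, time X u = i ↔ u = v) (hval : X.valence v = 4) :
    ∃ a e, (site X hp i).IsCross (pairedEdges X hX) a e ∧ X.root a = v := by
  have hcard := card_inward_add hX v
  have hsum := sum_inward v
  have hne := inward_nonempty_iff hX v
  have hd : ∀ h, h ∈ (site X hp i).dying ↔ h ∈ inward X v := by
    intro h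
    rw [mem_dying_iff_inward]
    simp only [hfib, exists_eq_left]
  have hb : ∀ h, h ∈ (site X hp i).born ↔ X.inv h ∈ outward X v := by
    intro h
    rw [mem_born_iff_outward hp hX]
    simp only [hfib, exists_eq_left]
  obtain ⟨a, ha⟩ : (inward X v).Nonempty := by
    rw [← Finset.card_pos]
    rw [← Finset.card_pos, ← Finset.card_pos] at hne
    lia
  obtain ⟨h, hh⟩ := hne.1 ⟨a, ha⟩
  have ra : X.root a = v := (mem_inward.1 ha).1
  have rh : X.root h = v := (mem_outward.1 hh).1
  have ha' : X.iotaH a ∈ inward X v := by rwa [iotaH_mem_inward, hv]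
  have hh' : X.iotaH h ∈ outward X v := by rwa [iotaH_mem_outward, hv]
  have hw : ∀ k, X.root k = v → X.weight k = X.weight a := by
    intro k hk
    exact X.weight_fourValent k a (by rw [hk, ra]) (by rw [hk, hval])
  have hwa : 0 < X.weight a := Int.natAbs_pos.2 (hX a)
  rw [Finset.sum_congr rfl fun k hk => hw k (mem_inward.1 hk).1,
    Finset.sum_congr rfl fun k hk => hw k (mem_outward.1 hk).1, Finset.sum_const,
    Finset.sum_const, smul_eq_mul, smul_eq_mul] at hsum
  -- as all weights at the vertex agree, harmonicity says that two edges leave to either side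
  have hsum' := Nat.eq_of_mul_eq_mul_right hwa hsum
  have hin : inward X v = {a, X.iotaH a} := by
    symm
    refine Finset.eq_of_subset_of_card_le ?_ ?_
    · simp [Finset.insert_subset_iff, ha, ha']
    · rw [Finset.card_pair (X.iotaH_ne a).1.symm]; lia
  have hout : outward X v = {h, X.iotaH h} := by
    symm
    refine Finset.eq_of_subset_of_card_le ?_ ?_
    · simp [Finset.insert_subset_iff, hh, hh']
    · rw [Finset.card_pair (X.iotaH_ne h).1.symm]; lia
  have inv2 := X.inv_inv
  have iota2 := X.iotaH_iotaH
  have iinv := X.iota_inv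
  refine ⟨a, X.inv h, ⟨?_, ?_, ?_, ?_, ?_, ?_⟩, ra⟩
  · ext c
    rw [hd, hin]; rfl
  · ext c
    rw [hb, hout]
    simp only [Finset.mem_insert, Finset.mem_singleton, pairedEdges]
    grind
  · simp only [site, pairedEdges, X.iota_root, ra, hv]
  · simp only [site, inv2, ra, rh]
  · simp only [site, pairedEdges, ← iinv, inv2, X.iota_root, rh, ra, hv]
  · simp only [pairedEdges, weight_inv, hw h rh]

/-- Over a branch point there is a join, a cut or a crossing. -/
theorem hasFactor_site (hp : StrictMono p) (hX : Nondegenerate X) (i : Fin (numBranch g μ ν)) :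
    (site X hp i).HasFactor (pairedEdges X hX) (vertexFactor X i) := by
  rcases X.fibre i with ⟨v, w, hvw, hset, hv3, hw3⟩ | ⟨v, hset, hv4⟩
  · have hfib : ∀ u, time X u = i ↔ u = v ∨ u = w := by
      intro u
      rw [time_eq_iff hp]
      exact Set.ext_iff.1 hset u
    have hιv : X.iotaV v ≠ v := fun h => by
      rw [X.fixed_iff, hv3] at h
      lia
    have hιw : X.iotaV v = w := by
      have := (hfib (X.iotaV v)).1 (by rw [time_iotaV hp, hfib]; simp)
      exact this.resolve_left hιv
    obtain ⟨a₁, a₂, e, h⟩ := isJoin_of_inward hp hX hιv (by rwa [hιw]) hv3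
    refine .inl ⟨a₁, a₂, e, h, ?_⟩
    rw [vertexFactor, Finset.filter_eq_empty_iff.2, Finset.prod_empty]
    rintro u - ⟨h1, h2⟩
    rcases (hfib u).1 h2 with rfl | rfl <;> lia
  · have hfib : ∀ u, time X u = i ↔ u = v := by
      intro u
      rw [time_eq_iff hp]
      exact Set.ext_iff.1 hset u
    have hιv := (X.fixed_iff v).2 hv4
    obtain ⟨a, e, h, ha⟩ := isCross_of_inward hp hX hιv hfib hv4
    refine .inr ⟨a, e, h, ?_⟩
    have : Finset.univ.filter (fun u => X.valence u = 4 ∧ time X u = i) = {v} := by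
      ext u
      simp only [Finset.mem_filter, Finset.mem_univ, true_and, Finset.mem_singleton, hfib]
      exact ⟨fun h => h.2, fun h => ⟨h ▸ hv4, h⟩⟩
    rw [vertexFactor, this, Finset.prod_singleton]
    congr 1
    rw [TwistedTropicalCover.vertexWeight]
    apply le_antisymm
    · refine Finset.sup_le fun k hk => ?_
      have hk' : X.root k = v := by simpa using hk
      exact (X.weight_fourValent k a (by rw [hk', ha]) (by rw [hk', hv4])).le
    · exact Finset.le_sup (f := X.weight) (by simpa using ha)

end Cover

/-! ### The number of labellings of a cover -/

section Labelling

open scoped Classical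

variable {n g : ℕ} {μ ν : n.Partition} {p : Fin (numBranch g μ ν) → ℝ}
variable {X : TwistedTropicalCover g μ ν p}

/-- Sequences of permutations with labellings of the points by the edges of `X`, together with the
permutations by which the steps are made. -/
abbrev Movie (X : TwistedTropicalCover g μ ν p) : Type :=
  (Fin (numBranch g μ ν + 1) → Perm (Fin n ⊕ Fin n) × (Fin n ⊕ Fin n → X.H)) ×
    (Fin (numBranch g μ ν) → Perm (Fin n ⊕ Fin n))

/-- A labelling of a cover: a twisted factorisation, given by its intermediate products, whose
cycles are labelled by the edges of the cover, such that the steps happen at its vertices. -/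
def IsLabelling (hp : StrictMono p) (hX : Nondegenerate X) (x : Movie X) : Prop :=
  IsState (pairedEdges X hX) (tau n) (alive X 0) (x.1 0) ∧
    ∀ i : Fin (numBranch g μ ν), IsStep (pairedEdges X hX) (tau n) (site X hp i)
      (x.1 i.castSucc) (x.2 i) (x.1 i.succ)

theorem IsLabelling.isState {hp : StrictMono p} {hX : Nondegenerate X} {x : Movie X}
    (h : IsLabelling hp hX x) (i : Fin (numBranch g μ ν + 1)) :
    IsState (pairedEdges X hX) (tau n) (alive X i) (x.1 i) := by
  refine Fin.cases h.1 (fun i => ?_) i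
  exact (h.2 i).isState

theorem mem_alive_zero {h : X.H} : h ∈ alive X 0 ↔ X.inv h = h ∧ X.slope h < 0 := by
  rw [mem_alive, birth]
  constructor
  · rintro ⟨-, h2, -⟩
    by_contra h3
    rw [if_neg h3] at h2
    lia
  · intro h3
    simp [IsRep, h3]

theorem map_weight_alive_zero : (alive X 0).val.map X.weight = 2 • μ.parts := by
  rw [← X.left_ends]
  congr 2
  ext h
  rw [mem_alive_zero]
  simp

/-- The weights of the edges over any interval have the sum `2n`. -/
theorem sum_alive (hp : StrictMono p) (hX : Nondegenerate X) :
    ∀ i ≤ numBranch g μ ν, ∑ h ∈ alive X i, (pairedEdges X hX).weight h = 2 * n := by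
  intro i
  induction i with
  | zero =>
    intro _
    change ((alive X 0).val.map X.weight).sum = _
    rw [map_weight_alive_zero, Multiset.sum_nsmul, μ.parts_sum, smul_eq_mul]
  | succ i ih =>
    intro hi
    rw [← ih (by lia)]
    have h := hasFactor_site hp hX ⟨i, hi⟩
    set s := site X hp i
    have h1 : ∑ h ∈ s.dying, (pairedEdges X hX).weight h =
        ∑ h ∈ s.born, (pairedEdges X hX).weight h := by
      rcases h with ⟨a₁, a₂, e, h | h, -⟩ | ⟨a, e, h, -⟩
      · exact h.sum_eq
      · exact h.sum_eq.symm
      · rw [h.dying_eq, h.born_eq, Finset.sum_pair ((pairedEdges X hX).free.ne _).symm,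
          Finset.sum_pair ((pairedEdges X hX).free.ne _).symm, (pairedEdges X hX).weight_iota,
          (pairedEdges X hX).weight_iota, h.weight_eq]
    change ∑ h ∈ s.after, _ = ∑ h ∈ s.before, _
    rw [← Finset.sum_sdiff s.dying_subset, ← Finset.sum_sdiff s.born_subset, s.sdiff_eq, h1]

theorem iotaH_mem_alive (hp : StrictMono p) {k : ℕ} {h : X.H} (hh : h ∈ alive X k) :
    X.iotaH h ∈ alive X k := by
  have inj : ∀ a b, X.iotaH a = X.iotaH b ↔ a = b := fun a b =>
    ⟨fun h => by rw [← X.iotaH_iotaH a, h, X.iotaH_iotaH], fun h => by rw [h]⟩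
  rw [mem_alive] at hh ⊢
  simpa only [IsRep, birth, death, X.iota_inv, X.iota_slope, X.iota_root, time_iotaV hp, inj]
    using hh

theorem exists_isState_alive (hp : StrictMono p) (hX : Nondegenerate X) {i : ℕ}
    (hi : i ≤ numBranch g μ ν) :
    ∃ ω : Perm (Fin n ⊕ Fin n) × (Fin n ⊕ Fin n → X.H),
      IsState (pairedEdges X hX) (tau n) (alive X i) ω := by
  obtain ⟨T, hT⟩ := exists_isTransversal (pairedEdges X hX) (S := alive X i)
    (fun e he => iotaH_mem_alive hp he)
  exact hT.exists_isState (sum_alive hp hX i hi)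

/-- Every edge that ends at a vertex is either an end over the left ray or internal. -/
theorem prod_dying (hp : StrictMono p) :
    ∏ i : Fin (numBranch g μ ν), ∏ h ∈ (site X hp i).dying, X.weight h =
      (∏ h ∈ alive X 0, X.weight h) *
        ∏ h ∈ Finset.univ.filter (fun h => X.slope h < 0 ∧ X.inv h ≠ h), X.weight h := by
  have h1 : ∏ i : Fin (numBranch g μ ν), ∏ h ∈ (site X hp i).dying, X.weight h =
      ∏ h ∈ Finset.univ.filter (fun h => X.slope h < 0), X.weight h := by
    rw [← Finset.prod_fiberwise _ (fun h => time X (X.root h))]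
    refine Finset.prod_congr rfl fun i _ => Finset.prod_congr ?_ fun _ _ => rfl
    ext h
    rw [mem_dying]
    simp
  rw [h1, ← Finset.prod_filter_mul_prod_filter_not (Finset.univ.filter fun h => X.slope h < 0)
    (fun h => X.inv h = h)]
  congr 1
  · refine Finset.prod_congr ?_ fun _ _ => rfl
    ext h
    rw [mem_alive_zero]
    simp [and_comm]
  · refine Finset.prod_congr ?_ fun _ _ => rfl
    ext h
    simp

/-- Every internal edge of the quotient graph comes from two edges, each of which has a half-edge
that leaves its vertex to the left. -/
theorem prod_quotientEdge_sq [Fintype X.QuotientEdge] (hX : Nondegenerate X) :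
    ∏ h ∈ Finset.univ.filter (fun h => X.slope h < 0 ∧ X.inv h ≠ h), X.weight h =
      (∏ e : X.QuotientEdge, e.weight) ^ 2 := by
  let Y := {h : X.H // X.inv h ≠ h}
  let q : Y → X.QuotientEdge := Quotient.mk X.quotientEdgeSetoid
  have h1 : ∏ h ∈ Finset.univ.filter (fun h => X.slope h < 0 ∧ X.inv h ≠ h), X.weight h =
      ∏ y ∈ Finset.univ.filter (fun y : Y => X.slope y.1 < 0), X.weight y.1 := by
    symm
    refine Finset.prod_bij (fun y _ => y.1) ?_ ?_ ?_ ?_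
    · intro y hy
      simpa using ⟨by simpa using hy, y.2⟩
    · intro a _ b _ h
      exact Subtype.ext h
    · intro h hh
      have hh := (Finset.mem_filter.1 hh).2
      exact ⟨⟨h, hh.2⟩, by simpa using hh.1, rfl⟩
    · intro _ _; rfl
  rw [h1, ← Finset.prod_fiberwise _ q, ← Finset.prod_pow]
  refine Finset.prod_congr rfl fun e _ => ?_
  have hrep : ∃ y : Y, q y = e ∧ X.slope y.1 < 0 := by
    obtain ⟨y, rfl⟩ := Quotient.exists_rep e
    by_cases hy : X.slope y.1 < 0
    · exact ⟨y, rfl, hy⟩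
    · refine ⟨⟨X.inv y.1, fun h => y.2 (by rwa [X.inv_inv, eq_comm] at h)⟩, ?_, ?_⟩
      · refine Quotient.sound (s := X.quotientEdgeSetoid) ?_
        exact Or.inr (.inl (X.inv_inv _).symm)
      · have := hX y.1
        simp only [X.slope_inv _ y.2]
        lia
  obtain ⟨y, rfl, hy⟩ := hrep
  let y' : Y := ⟨X.iotaH y.1, fun h => y.2 (by
    rw [X.iota_inv] at h
    rw [← X.iotaH_iotaH (X.inv y.1), h, X.iotaH_iotaH])⟩
  -- the half-edges to the left in the class of `y` are `y` and its image
  have hset : (Finset.univ.filter (fun y : Y => X.slope y.1 < 0)).filter (fun z => q z = q y) =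
      {y, y'} := by
    ext z
    simp only [Finset.mem_filter, Finset.mem_univ, true_and, Finset.mem_insert,
      Finset.mem_singleton]
    constructor
    · rintro ⟨hz, hq⟩
      have hq : y.1 = z.1 ∨ y.1 = X.inv z.1 ∨ y.1 = X.iotaH z.1 ∨ y.1 = X.iotaH (X.inv z.1) :=
        Quotient.exact (s := X.quotientEdgeSetoid) hq
      have hs := X.slope_inv z.1 z.2
      rcases hq with h | h | h | h
      · exact .inl (Subtype.ext h.symm)
      · rw [h, hs] at hy; lia
      · exact .inr (Subtype.ext (by simp only [y', h, X.iotaH_iotaH]))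
      · rw [h, X.iota_slope, hs] at hy; lia
    · rintro (rfl | rfl)
      · exact ⟨hy, rfl⟩
      · refine ⟨by simpa only [y', X.iota_slope] using hy, ?_⟩
        refine Quotient.sound (s := X.quotientEdgeSetoid) ?_
        exact Or.inr (.inr (.inl (X.iotaH_iotaH _).symm))
  have hne : y ≠ y' := fun h => (X.iotaH_ne y.1).1 (congrArg Subtype.val h).symm
  rw [hset, Finset.prod_pair hne, sq]
  simp only [y', slope_natAbs_iota]
  rfl

/-- The number of labellings of a cover without contracted edges. -/
theorem card_isLabelling [Fintype X.QuotientEdge] (hp : StrictMono p) (hX : Nondegenerate X) :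
    Nat.card {x : Movie X // IsLabelling hp hX x} =
      Nat.doubleFactorial (2 * n) * 2 ^ numBranch g μ ν *
        (∏ v ∈ Finset.univ.filter (fun v => X.valence v = 4), (X.vertexWeight v - 1)) *
        ∏ e : X.QuotientEdge, e.weight := by
  -- the number `R i` of steps from a state does not depend on the state, its square being known
  have hex : ∀ i : Fin (numBranch g μ ν), ∃ R : ℕ,
      R ^ 2 = (2 * vertexFactor X i) ^ 2 * ∏ h ∈ (site X hp i).dying, X.weight h ∧
      ∀ ω, IsState (pairedEdges X hX) (tau n) (alive X i) ω →
        Nat.card {q : Perm (Fin n ⊕ Fin n) × (Perm (Fin n ⊕ Fin n) × (Fin n ⊕ Fin n → X.H)) //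
          IsStep (pairedEdges X hX) (tau n) (site X hp i) ω q.1 q.2} = R := by
    intro i
    obtain ⟨ω₀, h₀⟩ := exists_isState_alive hp hX i.2.le
    refine ⟨_, IsState.card_isStep_sq (s := site X hp i) h₀ (hasFactor_site hp hX i), ?_⟩
    intro ω hω
    have h1 := IsState.card_isStep_sq (s := site X hp i) hω (hasFactor_site hp hX i)
    have h2 := IsState.card_isStep_sq (s := site X hp i) h₀ (hasFactor_site hp hX i)
    exact Nat.pow_left_injective two_ne_zero (h1.trans h2.symm)
  choose R hR1 hR2 using hex
  have hpath := card_paths (numBranch g μ ν)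
    (fun ω => IsState (pairedEdges X hX) (tau n) (alive X 0) ω)
    (fun i ω η ω' => IsStep (pairedEdges X hX) (tau n) (site X hp i) ω η ω')
    (fun i ω => IsState (pairedEdges X hX) (tau n) (alive X i) ω) R
    (fun _ _ h => h) (fun i _ ω η ω' h => h.isState) hR2
  have h0 := card_isState_sq (Λ := pairedEdges X hX) (S := alive X 0) (n := n)
    (fun e he => iotaH_mem_alive hp he) (sum_alive hp hX 0 (Nat.zero_le _))
  have hpos : 0 < ∏ h ∈ alive X 0, (pairedEdges X hX).weight h :=
    Finset.prod_pos fun e _ => (pairedEdges X hX).weight_pos e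
  have hfac : ∏ i, vertexFactor X i =
      ∏ v ∈ Finset.univ.filter (fun v => X.valence v = 4), (X.vertexWeight v - 1) := by
    rw [← Finset.prod_fiberwise _ (fun v => time X v)]
    refine Finset.prod_congr rfl fun i _ => ?_
    rw [vertexFactor, Finset.filter_filter]
  have hRsq : (∏ i, R i) ^ 2 = (2 ^ numBranch g μ ν * ∏ i, vertexFactor X i) ^ 2 *
      ((∏ h ∈ alive X 0, X.weight h) * (∏ e : X.QuotientEdge, e.weight) ^ 2) := by
    rw [← prod_quotientEdge_sq hX, ← prod_dying hp, ← Finset.prod_pow,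
      Finset.prod_congr rfl fun i _ => hR1 i, Finset.prod_mul_distrib, Finset.prod_pow,
      Finset.prod_mul_distrib]
    simp
  change Nat.card {x : Movie X // IsLabelling hp hX x} = _ at hpath
  rw [hpath]
  apply Nat.pow_left_injective (n := 2) two_ne_zero
  simp only
  rw [mul_pow, hRsq, ← hfac]
  change _ ^ 2 * (∏ h ∈ alive X 0, X.weight h) = _ at h0
  calc _ = (Nat.card {ω : Perm (Fin n ⊕ Fin n) × (Fin n ⊕ Fin n → X.H) //
        IsState (pairedEdges X hX) (tau n) (alive X 0) ω} ^ 2 *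
        (∏ h ∈ alive X 0, X.weight h)) * ((2 ^ numBranch g μ ν * ∏ i, vertexFactor X i) ^ 2 *
        (∏ e : X.QuotientEdge, e.weight) ^ 2) := by ring
    _ = _ := by rw [h0]; ring

instance finite_quotientEdge : Finite X.QuotientEdge :=
  inferInstanceAs (Finite (Quotient X.quotientEdgeSetoid))

instance finite_iso (Y : TwistedTropicalCover g μ ν p) : Finite (TwistedTropicalCover.Iso X Y) := by
  refine Finite.of_injective (fun f => (f.onV, f.onH)) fun f f' h => ?_
  have h := Prod.mk.inj h
  exact TwistedTropicalCover.Iso.ext h.1 h.2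

theorem autCard_pos : 0 < X.autCard :=
  Nat.card_pos_iff.2 ⟨⟨TwistedTropicalCover.Iso.refl X⟩, inferInstance⟩

/-- The multiplicity counts the labellings up to automorphisms of the cover and renamings of the
points. -/
theorem card_isLabelling_eq_multiplicity (hp : StrictMono p) (hX : Nondegenerate X) :
    (Nat.card {x : Movie X // IsLabelling hp hX x} : ℚ) =
      Nat.doubleFactorial (2 * n) * X.autCard * X.multiplicity := by
  have : Fintype X.QuotientEdge := Fintype.ofFinite _
  rw [card_isLabelling hp hX, TwistedTropicalCover.multiplicity, finprod_eq_prod_of_fintype,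
    finprod_eq_prod_of_fintype]
  have h1 : ∏ v : {v : X.V // X.valence v = 4}, ((X.vertexWeight v.1 : ℚ) - 1) =
      ((∏ v ∈ Finset.univ.filter (fun v => X.valence v = 4), (X.vertexWeight v - 1) : ℕ) : ℚ) := by
    rw [Nat.cast_prod]
    have hw : ∀ v ∈ Finset.univ.filter (fun v => X.valence v = 4),
        ((X.vertexWeight v - 1 : ℕ) : ℚ) = (X.vertexWeight v : ℚ) - 1 := by
      intro v hv
      have hv : X.valence v = 4 := by simpa using hv
      rw [Nat.cast_sub, Nat.cast_one]
      have : Nat.card {h // X.root h = v} ≠ 0 := by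
        rw [TropicalCurve.valence] at hv
        lia
      obtain ⟨⟨h, hh⟩⟩ := (Nat.card_ne_zero.1 this).1
      refine le_trans (Int.natAbs_pos.2 (hX h)) (Finset.le_sup (f := X.weight) ?_)
      simpa using hh
    rw [Finset.prod_congr rfl hw]
    exact Finset.prod_subtype (p := fun v => X.valence v = 4) _ (by simp)
      (fun v => (X.vertexWeight v : ℚ) - 1) |>.symm
  rw [h1]
  have h2 : (X.autCard : ℚ) ≠ 0 := by exact_mod_cast autCard_pos.ne'
  push_cast
  field_simp

theorem multiplicity_eq_zero (hX : ¬ Nondegenerate X) : X.multiplicity = 0 := by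
  simp only [Nondegenerate, not_forall, not_not] at hX
  obtain ⟨h, hh⟩ := hX
  have hi : X.inv h ≠ h := fun hi => X.slope_end h hi hh
  have : Fintype X.QuotientEdge := Fintype.ofFinite _
  rw [TwistedTropicalCover.multiplicity]
  refine mul_eq_zero_of_right _ ?_
  rw [finprod_eq_prod_of_fintype]
  let e : X.QuotientEdge := Quotient.mk X.quotientEdgeSetoid ⟨h, hi⟩
  refine Finset.prod_eq_zero (Finset.mem_univ e) ?_
  change ((X.weight h : ℕ) : ℚ) = 0
  simp [TropicalCover.weight, hh]

end Labelling

/-! ### What a step determines -/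

section Uniqueness

section Step

variable {P E V : Type*} [Fintype P] [DecidableEq P] [DecidableEq E]
variable {Λ : PairedEdges E} {τ : Perm P} {s : Site E V} {ω ω' : Perm P × (P → E)} {η : Perm P}

theorem IsState.touched_iff {x y : P} (hω : IsState Λ τ s.before ω) (hxy : x ≠ y) (z : P) :
    Touched (swap x y) ω.1 z ↔ ω.2 z = ω.2 x ∨ ω.2 z = ω.2 y := by
  rw [touched_swap hxy, hω.sameCycle, hω.sameCycle]

omit [DecidableEq E] in
theorem PairedEdges.iota_eq_iff (Λ : PairedEdges E) {a b : E} : Λ.iota a = b ↔ a = Λ.iota b :=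
  ⟨fun h => by rw [← h, Λ.free.invol], fun h => by rw [h, Λ.free.invol]⟩

theorem IsStep.dying_iff_and_tgt_iff_of_join {a₁ a₂ e : E} (hω : IsState Λ τ s.before ω)
    (h : s.IsJoin Λ a₁ a₂ e) {x y : P} (hx : ω.2 x = a₁) (hy : ω.2 y = a₂) :
    (∀ z, ω.2 z ∈ s.dying ↔ Touched (swap x y) ω.1 z ∨ Touched (swap x y) ω.1 (τ z)) ∧
      ∀ z u, ω.2 z ∈ s.dying → ω.2 u ∈ s.dying → (s.tgt (ω.2 z) = s.tgt (ω.2 u) ↔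
        (Touched (swap x y) ω.1 z ∧ Touched (swap x y) ω.1 u) ∨
          (Touched (swap x y) ω.1 (τ z) ∧ Touched (swap x y) ω.1 (τ u))) := by
  have hxy : x ≠ y := fun h' => h.ne (by rw [← hx, h', hy])
  have hd : ∀ c, c ∈ s.dying ↔ (c = a₁ ∨ c = a₂) ∨ c = Λ.iota a₁ ∨ c = Λ.iota a₂ := by
    simp [h.dying_eq, or_assoc]
  simp only [hω.touched_iff hxy, hω.label_tau, hx, hy, hd, Λ.iota_eq_iff]
  refine ⟨fun z => by trivial, fun z u hz hu => ?_⟩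
  have t1 : ∀ c, c = a₁ ∨ c = a₂ → s.tgt c = s.src e := by
    rintro _ (rfl | rfl)
    exacts [h.tgt₁, h.tgt₂]
  have t2 : ∀ c, c = Λ.iota a₁ ∨ c = Λ.iota a₂ → s.tgt c = s.src (Λ.iota e) := by
    rintro _ (rfl | rfl)
    exacts [h.tgt_iota₁, h.tgt_iota₂]
  have t5 := h.src_ne
  rcases hz with hz | hz <;> rcases hu with hu | hu
  · exact ⟨fun _ => .inl ⟨hz, hu⟩, fun _ => (t1 _ hz).trans (t1 _ hu).symm⟩
  · refine ⟨fun h' => absurd ?_ t5, ?_⟩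
    · rw [← t1 _ hz, h', t2 _ hu]
    · rintro (⟨-, h'⟩ | ⟨h', -⟩)
      · exact (t1 _ hz).trans (t1 _ h').symm
      · exact (t2 _ h').trans (t2 _ hu).symm
  · refine ⟨fun h' => absurd ?_ t5, ?_⟩
    · rw [← t1 _ hu, ← h', t2 _ hz]
    · rintro (⟨h', -⟩ | ⟨-, h'⟩)
      · exact (t1 _ h').trans (t1 _ hu).symm
      · exact (t2 _ hz).trans (t2 _ h').symm
  · exact ⟨fun _ => .inr ⟨hz, hu⟩, fun _ => (t2 _ hz).trans (t2 _ hu).symm⟩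

/-- The transposition of a step determines which edges end, and which of them end at the same
vertex. -/
theorem IsStep.dying_iff_and_tgt_iff {c : ℕ} (hs : IsStep Λ τ s ω η ω')
    (hω : IsState Λ τ s.before ω) (hτ : IsFreeInvolution τ) (hf : s.HasFactor Λ c) :
    (∀ z, ω.2 z ∈ s.dying ↔ Touched η ω.1 z ∨ Touched η ω.1 (τ z)) ∧
      ∀ z u, ω.2 z ∈ s.dying → ω.2 u ∈ s.dying → (s.tgt (ω.2 z) = s.tgt (ω.2 u) ↔
        (Touched η ω.1 z ∧ Touched η ω.1 u) ∨ (Touched η ω.1 (τ z) ∧ Touched η ω.1 (τ u))) := by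
  rcases hf with ⟨a₁, a₂, e, h | h, -⟩ | ⟨a, e, h, -⟩
  · obtain ⟨⟨x, y, ⟨hx, hy⟩ | ⟨hx, hy⟩, rfl⟩, -⟩ := hs.eq_of_join hω hτ h
    · exact IsStep.dying_iff_and_tgt_iff_of_join hω h hx hy
    · exact IsStep.dying_iff_and_tgt_iff_of_join hω h.iota hx hy
  -- a cut: the two points moved lie on one cycle, since the vertex has only one incoming edge
  · have hmov := hs.moved
    obtain ⟨x, y, hxy, rfl⟩ := hs.isSwap
    obtain ⟨hx, hy⟩ := hmov x (by simpa using hxy.symm)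
    have hy' := (hmov y (by simpa using hxy)).1
    rw [swap_apply_left] at hy
    have hd : ∀ c, c ∈ s.dying ↔ c = e ∨ c = Λ.iota e := by
      intro c
      have := h.born_eq
      simp only [Site.reverse] at this
      simp [this]
    have t5 : s.tgt e ≠ s.tgt (Λ.iota e) := h.src_ne
    have n3 := Λ.free.ne e
    have hyx : ω.2 y = ω.2 x := by
      rw [hd] at hx hy'
      rcases hx with h1 | h1 <;> rcases hy' with h2 | h2
      · rw [h1, h2]
      · exact absurd (by rw [h1, h2] at hy; exact hy.symm) t5
      · exact absurd (by rw [h1, h2] at hy; exact hy) t5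
      · rw [h1, h2]
    simp only [hω.touched_iff hxy, hω.label_tau, hyx, or_self, Λ.iota_eq_iff]
    rw [hd] at hx
    obtain ⟨e', he', hd'⟩ : ∃ e', ω.2 x = e' ∧ ∀ c, c ∈ s.dying ↔ c = e' ∨ c = Λ.iota e' := by
      rcases hx with hx | hx
      · exact ⟨e, hx, hd⟩
      · exact ⟨_, hx, fun c => by rw [hd, Λ.free.invol, or_comm]⟩
    have t6 : s.tgt e' ≠ s.tgt (Λ.iota e') := by
      rcases hx with hx | hx
      · rwa [← he', hx]
      · rw [← he', hx, Λ.free.invol]; exact t5.symm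
    simp only [he', hd']
    refine ⟨fun z => by trivial, fun z u hz hu => ?_⟩
    have n4 := Λ.free.ne e'
    rcases hz with hz | hz <;> rcases hu with hu | hu <;> simp [hz, hu, t6, t6.symm, n4, n4.symm]
  · obtain ⟨x, y, c, hx, hy, hne, -, rfl, -⟩ := hs.eq_of_cross hω hτ h
    have hd : ∀ c, c ∈ s.dying ↔ c = a ∨ c = Λ.iota a := by
      simp [h.dying_eq]
    have n3 := Λ.free.ne a
    have hxy : x ≠ y := fun h' => n3 (by rw [← hy, ← h', hx])
    simp only [hω.touched_iff hxy, hω.label_tau, hx, hy, hd, Λ.iota_eq_iff, Λ.free.invol]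
    refine ⟨fun z => by tauto, fun z u hz hu => ?_⟩
    refine ⟨fun _ => .inl ⟨hz, hu⟩, fun _ => ?_⟩
    rcases hz with hz | hz <;> rcases hu with hu | hu <;> simp [hz, hu, h.tgt_iota]

end Step

end Uniqueness

/-! ### Labellings over the same factorisation -/

section LabellingUniqueness

open scoped Classical

variable {n g : ℕ} {μ ν : n.Partition} {p : Fin (numBranch g μ ν) → ℝ}
variable {X Y : TwistedTropicalCover g μ ν p}

theorem mem_alive_numBranch (hp : StrictMono p) {h : X.H} :
    h ∈ alive X (numBranch g μ ν) ↔ IsRep X h ∧ ¬ X.slope h < 0 := by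
  rw [mem_alive]
  have h1 := birth_le_death hp h
  refine and_congr_right fun _ => ?_
  by_cases hs : X.slope h < 0
  · have : death X h < numBranch g μ ν := by
      rw [death, if_pos hs]
      exact (time X _).2
    simp [hs, this]
  · have : death X h = numBranch g μ ν := by rw [death, if_neg hs]
    rw [this] at h1 ⊢
    simp [hs, h1]

theorem death_le (h : X.H) : death X h ≤ numBranch g μ ν := by
  rw [death]
  split_ifs
  · exact (time X _).2.le
  · exact le_rfl

theorem inv_eq_iff_of_isRep (hp : StrictMono p) {h : X.H} (hh : IsRep X h) :
    X.inv h = h ↔ h ∈ alive X 0 ∨ h ∈ alive X (numBranch g μ ν) := by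
  rw [mem_alive_zero, mem_alive_numBranch hp]
  rcases hh with h1 | h1 <;> by_cases h2 : X.slope h < 0 <;> simp [IsRep, *] at *

theorem inward_nonempty (hX : Nondegenerate X) (v : X.V) : (inward X v).Nonempty := by
  have h1 := card_inward_add hX v
  have h2 := inward_nonempty_iff hX v
  rw [← Finset.card_pos, ← Finset.card_pos] at h2
  rw [← Finset.card_pos]
  have h3 : X.valence v = 3 ∨ X.valence v = 4 := by
    obtain ⟨i, hi⟩ := X.pos_mem v
    rcases X.fibre i with ⟨a, b, -, hset, ha, hb⟩ | ⟨a, hset, ha⟩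
    · have : v ∈ ({a, b} : Set X.V) := hset ▸ hi
      rcases this with rfl | rfl
      · exact .inl ha
      · exact .inl hb
    · have : v ∈ ({a} : Set X.V) := hset ▸ hi
      obtain rfl : v = a := this
      exact .inr ha
  lia

/-- The points on whose cycles, or on the images of whose cycles under `τ`, the `i`-th
transposition moves a point. -/
def Active (σ : Fin (numBranch g μ ν + 1) → Perm (Fin n ⊕ Fin n))
    (η : Fin (numBranch g μ ν) → Perm (Fin n ⊕ Fin n)) (i : Fin (numBranch g μ ν))
    (z : Fin n ⊕ Fin n) : Prop :=
  Touched (η i) (σ i.castSucc) z ∨ Touched (η i) (σ i.castSucc) (tau n z)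

section

variable {hp : StrictMono p} {hX : Nondegenerate X} {x : Movie X}

theorem IsLabelling.mem_dying_iff (h : IsLabelling hp hX x) (i : Fin (numBranch g μ ν))
    (z : Fin n ⊕ Fin n) : (x.1 i.castSucc).2 z ∈ (site X hp i).dying ↔
      Active (fun k => (x.1 k).1) x.2 i z :=
  ((h.2 i).dying_iff_and_tgt_iff (h.isState i.castSucc) (tau_isFreeInvolution n)
    (hasFactor_site hp hX i)).1 z

/-- The identifications between the vertices are determined by the factorisation. -/
theorem IsLabelling.root_eq_iff (h : IsLabelling hp hX x) {i j : Fin (numBranch g μ ν)}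
    {z u : Fin n ⊕ Fin n} (hz : Active (fun k => (x.1 k).1) x.2 i z)
    (hu : Active (fun k => (x.1 k).1) x.2 j u) :
    X.root ((x.1 i.castSucc).2 z) = X.root ((x.1 j.castSucc).2 u) ↔ i = j ∧
      ((Touched (x.2 i) (x.1 i.castSucc).1 z ∧ Touched (x.2 i) (x.1 i.castSucc).1 u) ∨
      (Touched (x.2 i) (x.1 i.castSucc).1 (tau n z) ∧
        Touched (x.2 i) (x.1 i.castSucc).1 (tau n u))) := by
  rw [← h.mem_dying_iff] at hz hu
  constructor
  · intro h'
    have h1 := ((mem_dying hp _ _).1 hz).2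
    have h2 := ((mem_dying hp _ _).1 hu).2
    obtain rfl : i = j := by rw [← h1, ← h2, h']
    exact ⟨rfl, (((h.2 i).dying_iff_and_tgt_iff (h.isState i.castSucc) (tau_isFreeInvolution n)
      (hasFactor_site hp hX i)).2 z u hz hu).1 h'⟩
  · rintro ⟨rfl, h'⟩
    exact (((h.2 i).dying_iff_and_tgt_iff (h.isState i.castSucc) (tau_isFreeInvolution n)
      (hasFactor_site hp hX i)).2 z u hz hu).2 h'

theorem IsLabelling.label_eq_of_not_active (h : IsLabelling hp hX x)
    {k j : Fin (numBranch g μ ν + 1)} (hkj : k ≤ j) {z : Fin n ⊕ Fin n}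
    (hz : ∀ i : Fin (numBranch g μ ν), k ≤ i.castSucc → i.castSucc < j →
      ¬ Active (fun k => (x.1 k).1) x.2 i z) : (x.1 j).2 z = (x.1 k).2 z := by
  induction j using Fin.induction with
  | zero => rw [Fin.le_zero_iff.1 hkj]
  | succ i ih =>
    rcases hkj.eq_or_lt with rfl | hlt
    · rfl
    · have hki : k ≤ i.castSucc := Fin.le_castSucc_iff.2 hlt
      rw [← ih hki fun i' h1 h2 => hz i' h1 (h2.trans (Fin.castSucc_lt_succ))]
      refine (h.2 i).stay z ?_
      rw [h.mem_dying_iff]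
      exact hz i hki Fin.castSucc_lt_succ

/-- The identifications between the labels are determined by the factorisation. -/
theorem IsLabelling.label_eq_iff (h : IsLabelling hp hX x) {k j : Fin (numBranch g μ ν + 1)}
    (hkj : k ≤ j) (z u : Fin n ⊕ Fin n) :
    (x.1 k).2 z = (x.1 j).2 u ↔ (∀ i : Fin (numBranch g μ ν), k ≤ i.castSucc →
      i.castSucc < j → ¬ Active (fun k => (x.1 k).1) x.2 i z) ∧ (x.1 j).1.SameCycle z u := by
  rw [(h.isState j).sameCycle]
  constructor
  · intro h'
    have key : ∀ i : Fin (numBranch g μ ν), k ≤ i.castSucc → i.castSucc < j →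
        ¬ Active (fun k => (x.1 k).1) x.2 i z := by
      intro i
      induction hi : (i : ℕ) using Nat.strong_induction_on generalizing i with
      | _ m ih =>
        subst hi
        intro h1 h2 h3
        rw [← h.mem_dying_iff, h.label_eq_of_not_active h1 fun i' h4 h5 =>
          ih i' (by simpa using h5) i' rfl h4 (h5.trans h2), h'] at h3
        have h4 := (mem_alive.1 ((h.isState j).mem u)).2.2
        have h5 := (Finset.mem_filter.1 h3).2.2
        rw [h5] at h4
        exact absurd h2 (not_lt.2 h4)
    exact ⟨key, by rw [h.label_eq_of_not_active hkj key, h']⟩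
  · rintro ⟨h1, h2⟩
    rw [← h2, h.label_eq_of_not_active hkj h1]

theorem IsLabelling.exists_label (h : IsLabelling hp hX x) {e : X.H}
    {k : Fin (numBranch g μ ν + 1)} (he : e ∈ alive X k) : ∃ z, (x.1 k).2 z = e :=
  (h.isState k).exists_eq he

theorem IsLabelling.exists_label_of_isRep (h : IsLabelling hp hX x) {e : X.H}
    (he : IsRep X e) : ∃ k z, (x.1 k).2 z = e := by
  have h1 := birth_le_death hp e
  have h2 := death_le e
  exact ⟨⟨birth X e, by lia⟩, h.exists_label (k := ⟨birth X e, by lia⟩)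
    (mem_alive.2 ⟨he, le_rfl, h1⟩)⟩

theorem IsLabelling.exists_root (h : IsLabelling hp hX x) (v : X.V) :
    ∃ i z, Active (fun k => (x.1 k).1) x.2 i z ∧ X.root ((x.1 i.castSucc).2 z) = v := by
  obtain ⟨e, he⟩ := inward_nonempty hX v
  rw [mem_inward] at he
  have h1 := (mem_dying hp (time X v) e).2 ⟨he.2, by rw [he.1]⟩
  obtain ⟨z, hz⟩ := h.exists_label (k := (time X v).castSucc) ((site X hp _).dying_subset h1)
  refine ⟨time X v, z, ?_, by rw [hz, he.1]⟩
  rwa [← h.mem_dying_iff, hz]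

/-- An edge that is not an end over the left ray starts at a vertex where the edge labelling the
same point in the previous state ends. -/
theorem IsLabelling.exists_root_inv (h : IsLabelling hp hX x) {e : X.H} (he : IsRep X e)
    (he0 : e ∉ alive X 0) : ∃ i z, Active (fun k => (x.1 k).1) x.2 i z ∧
      (x.1 i.succ).2 z = e ∧ X.root ((x.1 i.castSucc).2 z) = X.root (X.inv e) := by
  rw [mem_alive_zero] at he0
  set i := time X (X.root (X.inv e)) with hi
  have h1 : e ∈ (site X hp i).born := (mem_born hp hX _ _).2 ⟨slope_inv_pos hX he he0, rfl⟩
  obtain ⟨z, hz⟩ := h.exists_label (k := i.succ) ((site X hp _).born_subset h1)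
  have h2 := ((h.2 i).born_iff (h.isState i.castSucc) z).1 (by rwa [hz])
  refine ⟨i, z, (h.mem_dying_iff i z).1 h2, hz, ?_⟩
  have := ((h.2 i).pass z h2).2
  rw [hz] at this
  exact this.symm

end

theorem isRep_inv_of_not (hX : Nondegenerate X) {h : X.H} (hh : ¬ IsRep X h) :
    IsRep X (X.inv h) := by
  refine isRep_inv ?_
  have := hX h
  simp only [IsRep, not_or] at hh
  lia

/-- A bijection between the half-edges that represent the edges extends to an isomorphism if it is
compatible with all structures, also at the other halves of the edges. -/
theorem exists_iso_of_isRep (hX : Nondegenerate X) (hY : Nondegenerate Y)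
    (Φ : {h // IsRep X h} ≃ {h // IsRep Y h})
    (Ψ : X.V ≃ Y.V) (hslope : ∀ h, Y.slope (Φ h) = X.slope h)
    (hinv : ∀ h, Y.inv (Φ h) = Φ h ↔ X.inv h = h)
    (hroot : ∀ h, Y.root (Φ h) = Ψ (X.root h))
    (hroot' : ∀ h, Y.root (Y.inv (Φ h)) = Ψ (X.root (X.inv h)))
    (hlength : ∀ h, Y.length (Φ h) = X.length h) (hpos : ∀ v, Y.pos (Ψ v) = X.pos v)
    (hiota : ∀ h k : {h // IsRep X h}, k.1 = X.iotaH h → (Φ k).1 = Y.iotaH (Φ h)) :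
    ∃ φ : TwistedTropicalCover.Iso X Y, ∀ h, φ.onH h.1 = Φ h := by
  have hnon : ∀ h, ¬ IsRep X h → IsRep X (X.inv h) := fun h => isRep_inv_of_not hX
  have hnonY : ∀ h : {h // IsRep X h}, X.inv h ≠ h → ¬ IsRep Y (Y.inv (Φ h)) := by
    rintro h h1 (h2 | h2)
    · rw [Y.slope_inv _ (by rwa [Ne, hinv]), hslope] at h2
      have := h.2.resolve_right h1
      lia
    · rw [Y.inv_inv, eq_comm, hinv] at h2
      exact h1 h2
  let F : X.H → Y.H := fun h =>
    if hh : IsRep X h then Φ ⟨h, hh⟩ else Y.inv (Φ ⟨X.inv h, hnon h hh⟩)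
  have hF1 : ∀ h : {h // IsRep X h}, F h = Φ h := fun h => by simp [F, h.2]
  have hne : ∀ h, ¬ IsRep X h → X.inv (X.inv h) ≠ X.inv h := by
    intro h hh h1
    rw [X.inv_inv] at h1
    exact hh (.inr h1.symm)
  have hF2 : ∀ h (hh : ¬ IsRep X h), F h = Y.inv (Φ ⟨X.inv h, hnon h hh⟩) := fun h hh => by
    simp [F, hh]
  have hFinv : ∀ h, Y.inv (F h) = F (X.inv h) := by
    intro h
    by_cases hh : IsRep X h
    · rw [hF1 ⟨h, hh⟩]
      by_cases h1 : X.inv h = h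
      · rw [h1, hF1 ⟨h, hh⟩, hinv]
        exact h1
      · rw [hF2]
        · congr 3
          exact Subtype.ext (X.inv_inv h).symm
        · rintro (h2 | h2)
          · rw [X.slope_inv _ h1] at h2
            have := hh.resolve_right h1
            lia
          · rw [X.inv_inv] at h2
            exact h1 h2.symm
    · rw [hF2 h hh, Y.inv_inv, ← hF1]
  have hFrep : ∀ h, IsRep Y (F h) ↔ IsRep X h := by
    intro h
    by_cases hh : IsRep X h
    · rw [hF1 ⟨h, hh⟩]
      simp [hh, (Φ ⟨h, hh⟩).2]
    · rw [hF2 h hh]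
      simpa [hh] using hnonY ⟨_, hnon h hh⟩ (hne h hh)
  have hbij : Function.Bijective F := by
    have hinj : ∀ h k, IsRep X h → IsRep X k → F h = F k → h = k := by
      intro h k hh hk h1
      rw [hF1 ⟨h, hh⟩, hF1 ⟨k, hk⟩] at h1
      exact congrArg Subtype.val (Φ.injective (Subtype.ext h1))
    refine ⟨fun h k h1 => ?_, fun y => ?_⟩
    · by_cases hh : IsRep X h
      · exact hinj h k hh (by rwa [← hFrep, ← h1, hFrep]) h1
      · have hk : ¬ IsRep X k := by rwa [← hFrep, ← h1, hFrep]
        have := hinj _ _ (hnon h hh) (hnon k hk) (by rw [← hFinv, ← hFinv, h1])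
        rw [← X.inv_inv h, this, X.inv_inv]
    · by_cases hy : IsRep Y y
      · exact ⟨(Φ.symm ⟨y, hy⟩).1, by rw [hF1]; simp⟩
      · have hy' : IsRep Y (Y.inv y) := isRep_inv_of_not hY hy
        refine ⟨X.inv (Φ.symm ⟨_, hy'⟩).1, ?_⟩
        rw [← hFinv, hF1]
        simp [Y.inv_inv]
  have hFroot : ∀ h, Y.root (F h) = Ψ (X.root h) := by
    intro h
    by_cases hh : IsRep X h
    · rw [hF1 ⟨h, hh⟩, hroot]
    · rw [hF2 h hh, hroot', X.inv_inv]
  have hFiota : ∀ h, Y.iotaH (F h) = F (X.iotaH h) := by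
    have key : ∀ h, IsRep X h → Y.iotaH (F h) = F (X.iotaH h) := by
      intro h hh
      have hk : IsRep X (X.iotaH h) := by
        rcases hh with h1 | h1
        · exact .inl (by rwa [X.iota_slope])
        · exact .inr (by rw [X.iota_inv, h1])
      rw [hF1 ⟨h, hh⟩, hF1 ⟨_, hk⟩]
      exact (hiota ⟨h, hh⟩ ⟨_, hk⟩ rfl).symm
    intro h
    by_cases hh : IsRep X h
    · exact key h hh
    · have := key _ (hnon h hh)
      rw [← hFinv, ← Y.iota_inv, ← X.iota_inv, ← hFinv] at this
      rw [← Y.inv_inv (Y.iotaH (F h)), this, Y.inv_inv]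
  refine ⟨⟨Ψ, Equiv.ofBijective F hbij, hFroot, hFinv, ?_, hpos, ?_, ?_, hFiota⟩, hF1⟩
  · intro h
    change Y.length (F h) = _
    by_cases hh : IsRep X h
    · rw [hF1 ⟨h, hh⟩, hlength]
    · rw [hF2 h hh, Y.length_inv, hlength, X.length_inv]
  · intro h
    change Y.slope (F h) = _
    by_cases hh : IsRep X h
    · rw [hF1 ⟨h, hh⟩, hslope]
    · rw [hF2 h hh, Y.slope_inv, hslope, X.slope_inv, neg_neg]
      · exact fun h1 => hh (.inr h1)
      · rw [Ne, hinv]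
        exact hne h hh
  · intro v
    obtain ⟨h, hh⟩ := inward_nonempty hX v
    rw [← (mem_inward.1 hh).1, ← hFroot, ← Y.iota_root, hFiota, hFroot, X.iota_root]

end LabellingUniqueness

/-! ### Isomorphisms and labellings -/

section LabellingIso

open scoped Classical

variable {n g : ℕ} {μ ν : n.Partition} {p : Fin (numBranch g μ ν) → ℝ}
variable {X Y : TwistedTropicalCover g μ ν p}
variable {hp : StrictMono p} {hX : Nondegenerate X} {hY : Nondegenerate Y}
  {x : Movie X} {y : Movie Y}

/-- The intermediate products of a factorisation are determined by the first permutation and the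
transpositions. -/
theorem IsLabelling.fst_eq (h : IsLabelling hp hX x) (h' : IsLabelling hp hY y)
    (h0 : (x.1 0).1 = (y.1 0).1) (hη : x.2 = y.2) :
    (fun k => (x.1 k).1) = fun k => (y.1 k).1 := by
  funext k
  induction k using Fin.induction with
  | zero => exact h0
  | succ i ih => rw [(h.2 i).fst, (h'.2 i).fst, ih, hη]

theorem IsLabelling.label_eq_iff_label_eq (h : IsLabelling hp hX x) (h' : IsLabelling hp hY y)
    (hσ : (fun k => (x.1 k).1) = fun k => (y.1 k).1) (hη : x.2 = y.2)
    (k j : Fin (numBranch g μ ν + 1)) (z u : Fin n ⊕ Fin n) :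
    (x.1 k).2 z = (x.1 j).2 u ↔ (y.1 k).2 z = (y.1 j).2 u := by
  have key : ∀ (k j : Fin (numBranch g μ ν + 1)) (z u : Fin n ⊕ Fin n), k ≤ j →
      ((x.1 k).2 z = (x.1 j).2 u ↔ (y.1 k).2 z = (y.1 j).2 u) := by
    intro k j z u hkj
    rw [h.label_eq_iff hkj, h'.label_eq_iff hkj, hσ, hη, congrFun hσ j]
  rcases le_total k j with hkj | hkj
  · exact key k j z u hkj
  · rw [eq_comm, key j k u z hkj, eq_comm]

/-- Two covers with labellings over the same factorisation are isomorphic. -/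
theorem IsLabelling.exists_iso (h : IsLabelling hp hX x) (h' : IsLabelling hp hY y)
    (h0 : (x.1 0).1 = (y.1 0).1) (hη : x.2 = y.2) :
    ∃ φ : TwistedTropicalCover.Iso X Y, ∀ k z, φ.onH ((x.1 k).2 z) = (y.1 k).2 z := by
  have hσ := h.fst_eq h' h0 hη
  -- edges are labels up to the same identifications in both covers, and so are vertices
  obtain ⟨Φ, hΦ⟩ := exists_equiv_of_surjective
    (f := fun q : Fin (numBranch g μ ν + 1) × (Fin n ⊕ Fin n) =>
      (⟨(x.1 q.1).2 q.2, (mem_alive.1 ((h.isState q.1).mem q.2)).1⟩ : {h // IsRep X h}))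
    (g := fun q => (⟨(y.1 q.1).2 q.2, (mem_alive.1 ((h'.isState q.1).mem q.2)).1⟩ :
      {h // IsRep Y h}))
    (by
      rintro ⟨e, he⟩
      obtain ⟨k, z, hz⟩ := h.exists_label_of_isRep he
      exact ⟨(k, z), Subtype.ext hz⟩)
    (by
      rintro ⟨e, he⟩
      obtain ⟨k, z, hz⟩ := h'.exists_label_of_isRep he
      exact ⟨(k, z), Subtype.ext hz⟩)
    (by
      rintro ⟨k, z⟩ ⟨j, u⟩
      simpa only [Subtype.mk.injEq] using h.label_eq_iff_label_eq h' hσ hη k j z u)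
  have hact : ∀ i z, Active (fun k => (x.1 k).1) x.2 i z ↔
      Active (fun k => (y.1 k).1) y.2 i z := fun i z => by rw [hσ, hη]
  obtain ⟨Ψ, hΨ⟩ := exists_equiv_of_surjective
    (f := fun q : {q : Fin (numBranch g μ ν) × (Fin n ⊕ Fin n) //
        Active (fun k => (x.1 k).1) x.2 q.1 q.2} => X.root ((x.1 q.1.1.castSucc).2 q.1.2))
    (g := fun q => Y.root ((y.1 q.1.1.castSucc).2 q.1.2))
    (by
      intro v
      obtain ⟨i, z, hz, hv⟩ := h.exists_root v
      exact ⟨⟨(i, z), hz⟩, hv⟩)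
    (by
      intro v
      obtain ⟨i, z, hz, hv⟩ := h'.exists_root v
      exact ⟨⟨(i, z), (hact i z).2 hz⟩, hv⟩)
    (by
      rintro ⟨⟨i, z⟩, hz⟩ ⟨⟨j, u⟩, hu⟩
      rw [h.root_eq_iff hz hu, h'.root_eq_iff ((hact i z).1 hz) ((hact j u).1 hu), hη,
        congrFun hσ])
  -- the edges over an interval are its labels
  have halive : ∀ (k : Fin (numBranch g μ ν + 1)) (e : {h // IsRep X h}),
      (Φ e).1 ∈ alive Y k ↔ e.1 ∈ alive X k := by
    intro k e
    constructor
    · intro he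
      obtain ⟨z, hz⟩ := h'.exists_label he
      have h1 := hΦ (k, z)
      have h2 : (⟨(x.1 k).2 z, (mem_alive.1 ((h.isState k).mem z)).1⟩ : {h // IsRep X h}) = e :=
        Φ.injective (h1.trans (Subtype.ext hz))
      rw [← h2]
      exact (h.isState k).mem z
    · intro he
      obtain ⟨z, hz⟩ := h.exists_label he
      have h1 := hΦ (k, z)
      have h2 : (⟨(x.1 k).2 z, (mem_alive.1 ((h.isState k).mem z)).1⟩ : {h // IsRep X h}) = e :=
        Subtype.ext hz
      simp only at h1
      rw [← h2, h1]
      exact (h'.isState k).mem z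
  have hlab : ∀ k z (he : IsRep X ((x.1 k).2 z)), (Φ ⟨(x.1 k).2 z, he⟩).1 = (y.1 k).2 z :=
    fun k z he => congrArg Subtype.val (hΦ (k, z))
  have hroot0 : ∀ i z, Active (fun k => (x.1 k).1) x.2 i z →
      Y.root ((y.1 i.castSucc).2 z) = Ψ (X.root ((x.1 i.castSucc).2 z)) :=
    fun i z hz => (hΨ ⟨(i, z), hz⟩).symm
  have hpos : ∀ v, Y.pos (Ψ v) = X.pos v := by
    intro v
    obtain ⟨i, z, hz, rfl⟩ := h.exists_root v
    rw [← hroot0 i z hz]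
    have h1 := (mem_dying hp _ _).1 ((h.mem_dying_iff i z).2 hz)
    have h2 := (mem_dying hp _ _).1 ((h'.mem_dying_iff i z).2 ((hact i z).1 hz))
    rw [pos_eq, pos_eq, h1.2, h2.2]
  have hneg : ∀ e : {h // IsRep X h}, Y.slope (Φ e) < 0 ↔ X.slope e < 0 := by
    intro e
    have h1 := halive (Fin.last _) e
    simp only [Fin.val_last, mem_alive_numBranch hp, e.2, (Φ e).2, true_and, not_iff_not] at h1
    exact h1
  have hweight : ∀ e : {h // IsRep X h}, Y.weight (Φ e) = X.weight e := by
    rintro ⟨e, he⟩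
    obtain ⟨k, z, rfl⟩ := h.exists_label_of_isRep he
    rw [hlab]
    refine ((h'.isState k).card _ ((h'.isState k).mem z)).symm.trans
      (Eq.trans ?_ ((h.isState k).card _ ((h.isState k).mem z)))
    simp only [h.label_eq_iff_label_eq h' hσ hη]
  have hslope : ∀ e : {h // IsRep X h}, Y.slope (Φ e) = X.slope e := by
    intro e
    have h1 := hweight e
    have h2 := hneg e
    simp only [TropicalCover.weight] at h1
    lia
  have hinv : ∀ e : {h // IsRep X h}, Y.inv (Φ e) = Φ e ↔ X.inv e = e := by
    intro e
    rw [inv_eq_iff_of_isRep hp (Φ e).2, inv_eq_iff_of_isRep hp e.2]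
    exact or_congr (halive 0 e) (by simpa using halive (Fin.last _) e)
  have hroot' : ∀ e : {h // IsRep X h}, e.1 ∉ alive X 0 →
      Y.root (Y.inv (Φ e)) = Ψ (X.root (X.inv e)) := by
    rintro ⟨e, he⟩ he0
    obtain ⟨i, z, hz, rfl, hr⟩ := h.exists_root_inv he he0
    rw [hlab, ← hr, ← hroot0 i z hz]
    exact ((h'.2 i).pass z ((h'.mem_dying_iff i z).2 ((hact i z).1 hz))).2
  have hroot : ∀ e : {h // IsRep X h}, Y.root (Φ e) = Ψ (X.root e) := by
    intro e
    by_cases he : X.slope e < 0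
    · obtain ⟨e, hrep⟩ := e
      obtain ⟨i, hi⟩ : ∃ i, time X (X.root e) = i := ⟨_, rfl⟩
      have hd := (mem_dying hp i e).2 ⟨he, hi⟩
      obtain ⟨z, rfl⟩ := h.exists_label (k := i.castSucc) ((site X hp _).dying_subset hd)
      rw [hlab, ← hroot0 i z ((h.mem_dying_iff i z).1 hd)]
    · have h1 : X.inv e = e := e.2.resolve_left he
      have h2 := hroot' e (by rw [mem_alive_zero]; tauto)
      rwa [(hinv e).2 h1, h1] at h2
  -- the length of an internal edge is determined by its slope and the positions of its vertices
  have hlength : ∀ e : {h // IsRep X h}, Y.length (Φ e) = X.length e := by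
    intro e
    by_cases h1 : X.inv e = e
    · rw [(X.length_eq_top_iff _).2 h1, (Y.length_eq_top_iff _).2 ((hinv e).2 h1)]
    · have h1' : Y.inv (Φ e) ≠ Φ e := fun h' => h1 ((hinv e).1 h')
      have h2 := X.pos_inv e h1
      have h3 := Y.pos_inv (Φ e) h1'
      rw [hroot, hroot' e (fun h' => h1 (mem_alive_zero.1 h').1), hpos, hpos, hslope, h2] at h3
      have h4 : (X.slope e : ℝ) ≠ 0 := by exact_mod_cast hX e
      have h5 := mul_left_cancel₀ h4 (add_left_cancel h3)
      exact ((ENNReal.toReal_eq_toReal_iff' (fun h' => h1 ((X.length_eq_top_iff _).1 h'))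
        (fun h' => h1' ((Y.length_eq_top_iff _).1 h'))).1 h5).symm
  have hiota : ∀ e k : {h // IsRep X h}, k.1 = X.iotaH e → (Φ k).1 = Y.iotaH (Φ e) := by
    rintro ⟨e, he⟩ ⟨k, hk⟩ hek
    obtain ⟨j, z, rfl⟩ := h.exists_label_of_isRep he
    obtain rfl : k = _ := hek.trans ((h.isState j).label_tau z).symm
    rw [hlab, hlab]
    exact (h'.isState j).label_tau z
  obtain ⟨φ, hφ⟩ := exists_iso_of_isRep hX hY Φ Ψ hslope hinv hroot (fun e => by
    by_cases he : e.1 ∈ alive X 0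
    · have h1 := (mem_alive_zero.1 he).1
      rw [(hinv e).2 h1, h1, hroot]
    · exact hroot' e he) hlength hpos hiota
  exact ⟨φ, fun k z => (hφ ⟨_, (mem_alive.1 ((h.isState k).mem z)).1⟩).trans (hlab k z _)⟩

/-- An isomorphism is determined by its effect on the labels, as every edge is a label. -/
theorem IsLabelling.iso_ext (h : IsLabelling hp hX x) {φ φ' : TwistedTropicalCover.Iso X Y}
    (hφ : ∀ k z, φ.onH ((x.1 k).2 z) = φ'.onH ((x.1 k).2 z)) : φ = φ' := by
  have h1 : ∀ e, IsRep X e → φ.onH e = φ'.onH e := by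
    intro e he
    obtain ⟨k, z, rfl⟩ := h.exists_label_of_isRep he
    exact hφ k z
  have h2 : ∀ e, φ.onH e = φ'.onH e := by
    intro e
    by_cases he : IsRep X e
    · exact h1 e he
    · have := h1 _ (isRep_inv_of_not hX he)
      rw [← X.inv_inv e, ← φ.map_inv, this, φ'.map_inv]
  refine TwistedTropicalCover.Iso.ext (Equiv.ext fun v => ?_) (Equiv.ext h2)
  obtain ⟨e, he⟩ := inward_nonempty hX v
  rw [← (mem_inward.1 he).1, ← φ.map_root, ← φ'.map_root, h2]

section Transport

variable (φ : TwistedTropicalCover.Iso X Y)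
include φ

theorem nondegenerate_of_iso (hX : Nondegenerate X) : Nondegenerate Y := by
  intro e
  obtain ⟨e, rfl⟩ := φ.onH.surjective e
  rw [φ.map_slope]
  exact hX e

theorem isRep_iso (e : X.H) : IsRep Y (φ.onH e) ↔ IsRep X e := by
  rw [IsRep, IsRep, φ.map_slope, φ.map_inv, φ.onH.apply_eq_iff_eq]

theorem time_iso (hp : StrictMono p) (v : X.V) : time Y (φ.onV v) = time X v := by
  rw [time_eq_iff hp, φ.map_pos, pos_eq]

theorem birth_iso (hp : StrictMono p) (e : X.H) : birth Y (φ.onH e) = birth X e := by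
  rw [birth, birth, φ.map_slope, φ.map_inv, φ.onH.apply_eq_iff_eq, φ.map_root, time_iso φ hp]

theorem death_iso (hp : StrictMono p) (e : X.H) : death Y (φ.onH e) = death X e := by
  rw [death, death, φ.map_slope, φ.map_root, time_iso φ hp]

theorem mem_alive_iso (hp : StrictMono p) {k : ℕ} {e : X.H} :
    φ.onH e ∈ alive Y k ↔ e ∈ alive X k := by
  rw [mem_alive, mem_alive, isRep_iso, birth_iso φ hp, death_iso φ hp]

theorem mem_dying_iso (hp : StrictMono p) {i : ℕ} {e : X.H} :
    φ.onH e ∈ (site Y hp i).dying ↔ e ∈ (site X hp i).dying := by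
  simp [site, isRep_iso, death_iso φ hp]

theorem mem_born_iso (hp : StrictMono p) {i : ℕ} {e : X.H} :
    φ.onH e ∈ (site Y hp i).born ↔ e ∈ (site X hp i).born := by
  simp [site, isRep_iso, birth_iso φ hp]

theorem IsState.iso (hX : Nondegenerate X) (hY : Nondegenerate Y) (hp : StrictMono p) {k : ℕ}
    {ω : Perm (Fin n ⊕ Fin n) × (Fin n ⊕ Fin n → X.H)}
    (h : IsState (pairedEdges X hX) (tau n) (alive X k) ω) :
    IsState (pairedEdges Y hY) (tau n) (alive Y k) (ω.1, φ.onH ∘ ω.2) where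
  balanced := h.balanced
  mem z := (mem_alive_iso φ hp).2 (h.mem z)
  label_tau z := by
    simp only [Function.comp_apply, h.label_tau]
    exact (φ.map_iotaH _).symm
  sameCycle z u := by
    simp only [Function.comp_apply, h.sameCycle, φ.onH.apply_eq_iff_eq]
  card e he := by
    obtain ⟨e, rfl⟩ := φ.onH.surjective e
    simp only [Function.comp_apply, φ.onH.apply_eq_iff_eq]
    rw [h.card e ((mem_alive_iso φ hp).1 he)]
    simp only [pairedEdges, TropicalCover.weight, φ.map_slope]

/-- Labellings are transported along isomorphisms. -/
theorem IsLabelling.iso (hY : Nondegenerate Y) (h : IsLabelling hp hX x) :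
    IsLabelling hp hY (fun k => ((x.1 k).1, φ.onH ∘ (x.1 k).2), x.2) := by
  refine ⟨h.1.iso φ hX hY hp, fun i => ⟨(h.2 i).isSwap, (h.2 i).ne, (h.2 i).fst, ?_, ?_, ?_,
    IsState.iso φ hX hY hp (h.2 i).isState⟩⟩
  · intro z hz
    simp only [Function.comp_apply, mem_dying_iso φ] at hz ⊢
    rw [(h.2 i).stay z hz]
  · intro z hz
    simp only [Function.comp_apply, mem_dying_iso φ] at hz
    refine ⟨(mem_born_iso φ hp).2 ((h.2 i).pass z hz).1, ?_⟩
    have := ((h.2 i).pass z hz).2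
    simp only [site, Function.comp_apply, φ.map_inv, φ.map_root] at this ⊢
    rw [this]
  · intro z hz
    have := (h.2 i).moved z hz
    simp only [Function.comp_apply, mem_dying_iso φ]
    refine ⟨this.1, ?_⟩
    have := this.2
    simp only [site, φ.map_root] at this ⊢
    rw [this]

end Transport

/-- The labellings over one factorisation are a torsor under the automorphisms. -/
theorem card_isLabelling_over (hx : IsLabelling hp hX x) :
    Nat.card {y : Movie X // IsLabelling hp hX y ∧ (y.1 0).1 = (x.1 0).1 ∧ y.2 = x.2} =
      X.autCard := by
  refine (Nat.card_congr (Equiv.ofBijective (fun φ : TwistedTropicalCover.Iso X X =>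
    (⟨(fun k => ((x.1 k).1, φ.onH ∘ (x.1 k).2), x.2), hx.iso φ hX, rfl, rfl⟩ :
      {y : Movie X // IsLabelling hp hX y ∧ (y.1 0).1 = (x.1 0).1 ∧ y.2 = x.2}))
    ⟨fun φ φ' h => ?_, ?_⟩)).symm
  · refine hx.iso_ext fun k z => ?_
    have h1 := congrArg (fun y : Movie X => (y.1 k).2 z) (congrArg Subtype.val h)
    exact h1
  · rintro ⟨y, hy, h0, hη⟩
    obtain ⟨φ, hφ⟩ := hx.exists_iso hy h0.symm hη.symm
    refine ⟨φ, Subtype.ext (Prod.ext (funext fun k => Prod.ext ?_ (funext fun z => hφ k z))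
      hη.symm)⟩
    exact congrFun (hx.fst_eq hy h0.symm hη.symm) k

end LabellingIso

/-! ### The factorisation under a labelling -/

section CycleType

variable {P E : Type*} [Fintype P] [DecidableEq P] [DecidableEq E]

/-- The weights of the edges of a state are the lengths of the cycles. -/
theorem IsState.partition_parts {Λ : PairedEdges E} {τ : Perm P} {S : Finset E}
    {ω : Perm P × (P → E)} (h : IsState Λ τ S ω) :
    ω.1.partition.parts = S.val.map Λ.weight := by
  obtain ⟨σ, f⟩ := ω
  rcases isEmpty_or_nonempty P with hP | hP
  · have hS : S = ∅ := Finset.eq_empty_of_forall_notMem fun e he =>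
      (hP.false (h.exists_eq he).choose).elim
    simp [hS, parts_partition, Subsingleton.elim σ 1]
  choose! b hb using fun e (he : e ∈ S) => h.exists_eq he
  simp only at hb
  have hfix : ∀ z, σ z = z ↔ Λ.weight (f z) = 1 := by
    intro z
    rw [← h.card _ (h.mem z), Finset.card_eq_one]
    constructor
    · intro hz
      refine ⟨z, ?_⟩
      ext u
      simp only [Finset.mem_filter, Finset.mem_univ, true_and, Finset.mem_singleton]
      rw [eq_comm, ← h.sameCycle]
      constructor
      · rintro ⟨k, rfl⟩
        exact zpow_apply_eq_self_of_apply_eq_self hz k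
      · rintro rfl
        exact SameCycle.refl _ _
    · rintro ⟨a, ha⟩
      have h1 : z ∈ ({a} : Finset P) := by rw [← ha]; simp
      have h2 : σ z ∈ ({a} : Finset P) := by
        rw [← ha]
        simp only [Finset.mem_filter, Finset.mem_univ, true_and]
        rw [← h.sameCycle]
        exact sameCycle_apply_left.2 (SameCycle.refl _ _)
      rw [Finset.mem_singleton] at h1 h2
      rw [h1, ← h1, h2, h1]
  -- the cycles of length one appear separately in `Perm.partition`
  rw [parts_partition]
  have hS : S.val.map Λ.weight = (S.filter fun e => Λ.weight e ≠ 1).val.map Λ.weight +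
      (S.filter fun e => ¬ Λ.weight e ≠ 1).val.map Λ.weight := by
    rw [Finset.filter_val, Finset.filter_val, ← Multiset.map_add, Multiset.filter_add_not]
  rw [hS]
  congr 1
  · rw [cycleType_def]
    symm
    refine Multiset.map_eq_map_of_bij_of_nodup _ _ (Finset.nodup _) (Finset.nodup _)
      (fun e _ => σ.cycleOf (b e)) ?_ ?_ ?_ ?_
    · intro e he
      have he := Finset.mem_filter.1 he
      change _ ∈ σ.cycleFactorsFinset
      rw [cycleOf_mem_cycleFactorsFinset_iff, mem_support, Ne, hfix, hb e he.1]
      exact he.2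
    · intro e he e' he' hee
      have he := Finset.mem_filter.1 he
      have he' := Finset.mem_filter.1 he'
      rw [← hb e he.1, ← hb e' he'.1, ← h.sameCycle]
      have h1 : b e ∈ (σ.cycleOf (b e)).support := by
        rw [mem_support_cycleOf_iff, mem_support, Ne, hfix, hb e he.1]
        exact ⟨SameCycle.refl _ _, he.2⟩
      rw [hee, mem_support_cycleOf_iff] at h1
      exact h1.1.symm
    · intro c hc
      have hc : c ∈ σ.cycleFactorsFinset := hc
      obtain ⟨z, hz⟩ := (mem_cycleFactorsFinset_iff.1 hc).1.nonempty_support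
      have h1 := cycle_is_cycleOf hz hc
      have h2 : σ z ≠ z := mem_support.1 (mem_cycleFactorsFinset_support_le hc hz)
      refine ⟨f z, ?_, ?_⟩
      · refine Finset.mem_filter.2 ⟨h.mem z, ?_⟩
        rwa [Ne, ← hfix]
      · rw [h1]
        apply SameCycle.cycleOf_eq
        rw [h.sameCycle]
        exact hb _ (h.mem z)
    · intro e he
      have he := Finset.mem_filter.1 he
      rw [Function.comp_apply, ← h.card e he.1]
      congr 1
      ext u
      rw [mem_support_cycleOf_iff, mem_support, Ne, hfix, hb e he.1, h.sameCycle]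
      simp only [hb e he.1]
      simp [he.2, eq_comm]
  · have h1 : ∀ e ∈ (S.filter fun e => ¬ Λ.weight e ≠ 1).val, Λ.weight e = 1 := by
      intro e he
      simpa using (Finset.mem_filter.1 he).2
    rw [Multiset.map_congr rfl h1, Multiset.map_const']
    congr 1
    rw [← Finset.card_compl]
    refine Finset.card_bij (fun z _ => f z) ?_ ?_ ?_
    · intro z hz
      have hz : σ z = z := by simpa using hz
      simpa [h.mem z] using (hfix z).1 hz
    · intro z hz u hu hzu
      have hz : σ z = z := by simpa using hz
      rw [← h.sameCycle] at hzu
      obtain ⟨k, rfl⟩ := hzu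
      exact (zpow_apply_eq_self_of_apply_eq_self hz k).symm
    · intro e he
      have he := Finset.mem_filter.1 he
      refine ⟨b e, ?_, hb e he.1⟩
      simpa [hfix, hb e he.1] using he.2

end CycleType

section Factorisation

/-- The set `B^∼_n` consists of the balanced permutations. -/
theorem mem_BTilde_iff {n : ℕ} {σ : Perm (Fin n ⊕ Fin n)} :
    σ ∈ BTilde n ↔ IsBalanced (tau n) σ := by
  have hτ := tau_isFreeInvolution n
  constructor
  · rintro ⟨h1, h2⟩
    have hconj : ∀ x, tau n (σ x) = σ⁻¹ (tau n x) := by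
      intro x
      rw [← show tau n * σ * tau n = σ⁻¹ from h1]
      simp [hτ.invol]
    refine ⟨hconj, fun x hx => ?_⟩
    have hτx : σ.SameCycle x (tau n x) := hx ▸ sameCycle_apply_right.2 (SameCycle.refl _ _)
    -- a point `x` with `σ x = τ x` would lie on a self-symmetric cycle
    have hpow : ∀ {y}, σ.SameCycle x y → σ.SameCycle x (tau n y) := by
      intro y hy
      refine SameCycle.induct hy (r := fun y => σ.SameCycle x (tau n y)) (fun z hz => ?_) hτx
      rw [hconj]
      exact sameCycle_apply_right.1 (by simpa using hz)
    refine h2 (σ.cycleOf x) ?_ ?_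
    · rw [cycleOf_mem_cycleFactorsFinset_iff, mem_support, hx]
      exact hτ.ne x
    · ext y
      rw [cycleOf_inv, mul_apply, mul_apply, cycleOf_apply, cycleOf_apply]
      by_cases hy : σ.SameCycle x y
      · rw [if_pos (hpow hy), if_pos (sameCycle_inv.2 hy), hconj, hτ.invol]
      · rw [if_neg, if_neg fun h' => hy (sameCycle_inv.1 h'), hτ.invol]
        intro h'
        have := hpow h'
        rw [hτ.invol] at this
        exact hy this
  · intro h
    refine ⟨?_, fun c hc h' => ?_⟩
    · change _ = _
      ext x
      simp [h.conj, hτ.invol]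
    · obtain ⟨z, hz⟩ := (mem_cycleFactorsFinset_iff.1 hc).1.nonempty_support
      have h1 := cycle_is_cycleOf hz hc
      have h2 : tau n z ∈ c.support := by
        rw [← support_inv, ← h', mem_support, mul_apply, mul_apply, hτ.invol]
        intro h3
        exact mem_support.1 hz ((tau n).injective h3)
      rw [h1, mem_support_cycleOf_iff] at h2
      exact h.not_sameCycle hτ z h2.1

/-- The last product of a factorisation is the result of all twists. -/
theorem prod_reverse_mul_mul_prod {P : Type*} (τ : Perm P) {m : ℕ} (σ : Fin (m + 1) → Perm P)
    (η : Fin m → Perm P) (h : ∀ i, σ i.succ = twist τ (η i) (σ i.castSucc)) :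
    (List.ofFn η).reverse.prod * σ 0 * (List.ofFn fun i => τ * η i * τ).prod =
      σ (Fin.last m) := by
  induction m with
  | zero => simp
  | succ m ih =>
    have h1 := ih (fun i => σ i.castSucc) (fun i => η i.castSucc) (fun i => h i.castSucc)
    rw [List.ofFn_succ', List.ofFn_succ', List.concat_eq_append, List.concat_eq_append,
      List.reverse_append, List.prod_append, List.prod_append, ← Fin.succ_last, h (Fin.last m),
      twist]
    simp only [Fin.castSucc_zero] at h1
    rw [← h1]
    simp [mul_assoc]

open scoped Classical

variable {n g : ℕ} {μ ν : n.Partition} {p : Fin (numBranch g μ ν) → ℝ}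
variable {X : TwistedTropicalCover g μ ν p}
variable {hp : StrictMono p} {hX : Nondegenerate X} {x : Movie X}

theorem map_weight_alive_numBranch (hp : StrictMono p) :
    (alive X (numBranch g μ ν)).val.map X.weight = 2 • ν.parts := by
  rw [← X.right_ends]
  congr 2
  ext h
  rw [mem_alive_numBranch hp]
  simp only [IsRep, Finset.mem_filter, Finset.mem_univ, true_and]
  constructor
  · rintro ⟨h1, h2⟩
    have h3 := h1.resolve_left h2
    have := X.slope_end h h3
    exact ⟨h3, by lia⟩
  · rintro ⟨h1, h2⟩
    exact ⟨.inr h1, by lia⟩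

/-- The connectedness of a cover makes the factorisations below its labellings transitive. -/
theorem IsLabelling.isPretransitive (h : IsLabelling hp hX x) :
    MulAction.IsPretransitive (Subgroup.closure
      ({(x.1 0).1, (x.1 (Fin.last _)).1} ∪ Set.range x.2 ∪
        Set.range fun i => tau n * x.2 i * tau n)) (Fin n ⊕ Fin n) := by
  have hτ := tau_isFreeInvolution n
  set G := Subgroup.closure ({(x.1 0).1, (x.1 (Fin.last _)).1} ∪ Set.range x.2 ∪
    Set.range fun i => tau n * x.2 i * tau n) with hG
  have g1 : (x.1 0).1 ∈ G := Subgroup.subset_closure (by simp)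
  have g2 : ∀ i, x.2 i ∈ G := fun i => Subgroup.subset_closure (by simp)
  have g3 : ∀ i, tau n * x.2 i * tau n ∈ G := fun i => Subgroup.subset_closure (by simp)
  have hσ : ∀ k, (x.1 k).1 ∈ G := by
    intro k
    induction k using Fin.induction with
    | zero => exact g1
    | succ i ih =>
      rw [(h.2 i).fst]
      exact mul_mem (mul_mem (g2 i) ih) (g3 i)
  let r : Setoid (Fin n ⊕ Fin n) := MulAction.orbitRel G (Fin n ⊕ Fin n)
  have hr : ∀ {z} {ρ : Perm (Fin n ⊕ Fin n)}, ρ ∈ G → r z (ρ z) := fun {z ρ} hρ =>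
    Setoid.symm (MulAction.orbitRel_apply.2 ⟨⟨ρ, hρ⟩, rfl⟩)
  have hsc : ∀ k {z u}, (x.1 k).1.SameCycle z u → r z u := by
    rintro k z _ ⟨m, rfl⟩
    exact hr (zpow_mem (hσ k) m)
  -- all points on one edge lie in one orbit
  have hlab : ∀ {k j z u}, (x.1 k).2 z = (x.1 j).2 u → r z u := by
    intro k j z u hzu
    rcases le_total k j with hkj | hkj
    · exact hsc _ ((h.label_eq_iff hkj z u).1 hzu).2
    · exact Setoid.symm (hsc _ ((h.label_eq_iff hkj u z).1 hzu.symm).2)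
  have htouch : ∀ i {z u}, Touched (x.2 i) (x.1 i.castSucc).1 z →
      Touched (x.2 i) (x.1 i.castSucc).1 u → r z u ∧ r (tau n z) (tau n u) := by
    intro i z u hz hu
    have hbal := (h.isState i.castSucc).balanced
    have hη := g2 i
    have hη' := g3 i
    obtain ⟨a, b, hab, he⟩ := (h.2 i).isSwap
    rw [he] at hz hu hη hη'
    rw [tau_swap_tau hτ] at hη'
    rw [touched_swap hab] at hz hu
    have e1 : r a b := by simpa using hr (z := a) hη
    have e2 : r (tau n a) (tau n b) := by simpa using hr (z := tau n a) hη'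
    have key : ∀ {z}, (x.1 i.castSucc).1.SameCycle z a ∨ (x.1 i.castSucc).1.SameCycle z b →
        r z a ∧ r (tau n z) (tau n a) := by
      rintro z (hz | hz)
      · exact ⟨hsc _ hz, hsc _ (hbal.sameCycle_tau hz)⟩
      · exact ⟨Setoid.trans (hsc _ hz) (Setoid.symm e1),
          Setoid.trans (hsc _ (hbal.sameCycle_tau hz)) (Setoid.symm e2)⟩
    exact ⟨Setoid.trans (key hz).1 (Setoid.symm (key hu).1),
      Setoid.trans (key hz).2 (Setoid.symm (key hu).2)⟩
  -- all points near one vertex lie in one orbit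
  have hroot : ∀ {i j z u}, Active (fun k => (x.1 k).1) x.2 i z →
      Active (fun k => (x.1 k).1) x.2 j u →
      X.root ((x.1 i.castSucc).2 z) = X.root ((x.1 j.castSucc).2 u) → r z u := by
    intro i j z u hz hu hzu
    obtain ⟨rfl, h1 | h1⟩ := (h.root_eq_iff hz hu).1 hzu
    · exact (htouch i h1.1 h1.2).1
    · simpa only [hτ.invol] using (htouch i h1.1 h1.2).2
  have hdying : ∀ e, X.slope e < 0 → ∃ i z, Active (fun k => (x.1 k).1) x.2 i z ∧
      (x.1 i.castSucc).2 z = e := by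
    intro e he
    have hd := (mem_dying hp (time X (X.root e)) e).2 ⟨he, rfl⟩
    obtain ⟨z, hz⟩ := h.exists_label (k := (time X (X.root e)).castSucc)
      ((site X hp _).dying_subset hd)
    exact ⟨_, z, by rwa [← h.mem_dying_iff, hz], hz⟩
  have hedge : ∀ e, X.slope e < 0 → ∀ {i j z u}, Active (fun k => (x.1 k).1) x.2 i z →
      Active (fun k => (x.1 k).1) x.2 j u → X.root ((x.1 i.castSucc).2 z) = X.root e →
      X.root ((x.1 j.castSucc).2 u) = X.root (X.inv e) → r z u := by
    intro e he i j z u hz hu hzv huv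
    obtain ⟨k, w, hw, hwe⟩ := hdying e he
    have e1 : r z w := hroot hz hw (by rw [hzv, hwe])
    by_cases he0 : e ∈ alive X 0
    · rw [(mem_alive_zero.1 he0).1] at huv
      exact hroot hz hu (by rw [hzv, huv])
    · obtain ⟨k', w', hw', hwe', hr'⟩ := h.exists_root_inv (.inl he) he0
      have e2 : r w w' := hlab (hwe.trans hwe'.symm)
      exact Setoid.trans e1 (Setoid.trans e2 (hroot hw' hu (by rw [hr', huv])))
  have hpath : ∀ {i j z u}, Active (fun k => (x.1 k).1) x.2 i z →
      Active (fun k => (x.1 k).1) x.2 j u → r z u := by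
    intro i j z u hz hu
    have hc := X.connected (X.root ((x.1 i.castSucc).2 z)) (X.root ((x.1 j.castSucc).2 u))
    generalize hv : X.root ((x.1 j.castSucc).2 u) = v at hc
    induction hc generalizing j u with
    | refl => exact hroot hz hu hv.symm
    | tail _ hstep ih =>
      obtain ⟨e, rfl, rfl⟩ := hstep
      obtain ⟨k, w, hw, hwe⟩ := h.exists_root (X.root e)
      refine Setoid.trans (ih hw hwe) ?_
      rcases lt_or_gt_of_ne (hX e) with he | he
      · exact hedge e he hw hu hwe hv
      · by_cases hi : X.inv e = e
        · rw [hi] at hv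
          exact hroot hw hu (by rw [hwe, hv])
        · refine Setoid.symm (hedge (X.inv e) ?_ hu hw hv ?_)
          · rw [X.slope_inv e hi]; lia
          · rw [X.inv_inv, hwe]
  refine ⟨fun z u => ?_⟩
  have hstart : ∀ z, ∃ i w, Active (fun k => (x.1 k).1) x.2 i w ∧ r z w := by
    intro z
    have h0 := mem_alive_zero.1 ((h.isState 0).mem z)
    obtain ⟨i, w, hw, hwe⟩ := hdying _ h0.2
    exact ⟨i, w, hw, hlab hwe.symm⟩
  obtain ⟨i, w, hw, hzw⟩ := hstart z
  obtain ⟨j, w', hw', huw⟩ := hstart u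
  have : r u z := Setoid.trans huw (Setoid.trans (hpath hw' hw) (Setoid.symm hzw))
  exact MulAction.orbitRel_apply.1 this

/-- A labelling lies over a transitive twisted factorisation. -/
theorem IsLabelling.mem_twistedFactorisations (h : IsLabelling hp hX x) :
    ((x.1 0).1, x.2, (x.1 (Fin.last _)).1) ∈ twistedFactorisations g μ ν := by
  have h0 : HasDoubledCycleType (x.1 0).1 μ :=
    h.1.partition_parts.trans map_weight_alive_zero
  refine ⟨h0, ?_, fun i => ⟨(h.2 i).isSwap, (h.2 i).ne⟩, ⟨mem_BTilde_iff.2 h.1.balanced, h0⟩, ?_,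
    h.isPretransitive⟩
  · exact (h.isState (Fin.last _)).partition_parts.trans (map_weight_alive_numBranch hp)
  · exact prod_reverse_mul_mul_prod (tau n) (fun k => (x.1 k).1) x.2 fun i => (h.2 i).fst

end Factorisation

/-! ### Labels of the cycles of a factorisation -/

section Existence

/-- A transitive twisted factorisation, given by the intermediate products `σ` and the
transpositions `η`. (Their values beyond the `m` steps play no role.) Transitivity is
stated in terms of stable sets. -/
structure Factorisation {P : Type} [DecidableEq P] (τ : Perm P) (m : ℕ) where
  σ : ℕ → Perm P
  η : ℕ → Perm P
  invol : IsFreeInvolution τ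
  balanced_zero : IsBalanced τ (σ 0)
  isSwap : ∀ i < m, (η i).IsSwap
  ne : ∀ i < m, η i ≠ τ * η i * τ
  step : ∀ i < m, σ (i + 1) = twist τ (η i) (σ i)
  pos : 0 < m
  transitive : ∀ S : Set P, S.Nonempty → (∀ z, σ 0 z ∈ S ↔ z ∈ S) → (∀ z, σ m z ∈ S ↔ z ∈ S) →
    (∀ i < m, ∀ z, η i z ∈ S ↔ z ∈ S) → (∀ i < m, ∀ z, τ (η i (τ z)) ∈ S ↔ z ∈ S) → ∀ z, z ∈ S

namespace Factorisation

open scoped Classical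

variable {P : Type} [Fintype P] [DecidableEq P] {τ : Perm P} {m : ℕ} (W : Factorisation τ m)

/-- The points on cycles that the `i`-th step changes. -/
def Active (i : ℕ) (z : P) : Prop :=
  Touched (W.η i) (W.σ i) z ∨ Touched (W.η i) (W.σ i) (τ z)

/-- The cycle of a point as a set. -/
noncomputable def cyc (k : ℕ) (z : P) : Finset P := Finset.univ.filter ((W.σ k).SameCycle z)

/-- The edge of the cover on which a point lies after `k` steps: a maximal time interval during
which its cycle does not change, given by the number of the first step after which the cycle is
present and the cycle itself. -/
noncomputable def label : ℕ → P → ℕ × Finset P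
  | 0, z => (0, W.cyc 0 z)
  | k + 1, z => if W.Active k z then (k + 1, W.cyc (k + 1) z) else label k z

/-- The points on cycles that come together with `z` at the `i`-th step. -/
noncomputable def star (i : ℕ) (z : P) : Finset P := Finset.univ.filter fun y =>
  (Touched (W.η i) (W.σ i) z ∧ Touched (W.η i) (W.σ i) y) ∨
    (Touched (W.η i) (W.σ i) (τ z) ∧ Touched (W.η i) (W.σ i) (τ y))

/-- The number of the last step before which an edge is present. -/
noncomputable def death (e : ℕ × Finset P) : ℕ :=
  ((Finset.range (m + 1)).filter fun k => ∃ z, W.label k z = e).sup id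

variable {W}

omit [Fintype P] in
theorem balanced {k : ℕ} (hk : k ≤ m) : IsBalanced τ (W.σ k) := by
  induction k with
  | zero => exact W.balanced_zero
  | succ k ih =>
    rw [W.step k hk]
    exact (ih (by lia)).twist W.invol (isSwap_apply_apply (W.isSwap k hk))

omit [Fintype P] in
theorem active_tau {i : ℕ} {z : P} : W.Active i (τ z) ↔ W.Active i z := by
  rw [Active, Active, W.invol.invol, or_comm]

theorem touched_succ {i : ℕ} (hi : i < m) {z : P} :
    Touched (W.η i) (W.σ (i + 1)) z ↔ Touched (W.η i) (W.σ i) z := by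
  rw [W.step i hi]
  exact touched_twist (balanced hi.le) W.invol (W.isSwap i hi)

theorem touched_congr {i : ℕ} (hi : i < m) {z u : P}
    (h : (W.σ i).SameCycle z u ∨ (W.σ (i + 1)).SameCycle z u) :
    Touched (W.η i) (W.σ i) z ↔ Touched (W.η i) (W.σ i) u := by
  rcases h with h | h
  · exact Touched.congr h
  · rw [← touched_succ hi, ← touched_succ hi, Touched.congr h]

theorem touched_congr_tau {i : ℕ} (hi : i < m) {z u : P}
    (h : (W.σ i).SameCycle z u ∨ (W.σ (i + 1)).SameCycle z u) :
    Touched (W.η i) (W.σ i) (τ z) ↔ Touched (W.η i) (W.σ i) (τ u) :=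
  touched_congr hi (h.imp (balanced hi.le).sameCycle_tau (balanced hi).sameCycle_tau)

theorem active_congr {i : ℕ} (hi : i < m) {z u : P}
    (h : (W.σ i).SameCycle z u ∨ (W.σ (i + 1)).SameCycle z u) : W.Active i z ↔ W.Active i u :=
  or_congr (touched_congr hi h) (touched_congr_tau hi h)

theorem sameCycle_succ {i : ℕ} (hi : i < m) {z u : P} (hz : ¬ W.Active i z) :
    (W.σ (i + 1)).SameCycle z u ↔ (W.σ i).SameCycle z u := by
  rw [Active, not_or] at hz
  rw [W.step i hi]
  exact sameCycle_twist_of_not_touched (balanced hi.le) W.invol (W.isSwap i hi) hz.1 hz.2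

theorem mem_cyc {k : ℕ} {z u : P} : u ∈ W.cyc k z ↔ (W.σ k).SameCycle z u := by simp [cyc]

theorem cyc_eq_iff {k : ℕ} {z u : P} : W.cyc k z = W.cyc k u ↔ (W.σ k).SameCycle z u := by
  constructor
  · intro h
    rw [← mem_cyc, h, mem_cyc]
  · intro h
    ext w
    rw [mem_cyc, mem_cyc]
    exact ⟨h.symm.trans, h.trans⟩

theorem label_snd {k : ℕ} (hk : k ≤ m) (z : P) : (W.label k z).2 = W.cyc k z := by
  induction k with
  | zero => rfl
  | succ k ih =>
    rw [label]
    split_ifs with h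
    · rfl
    · rw [ih (by lia)]
      ext u
      rw [mem_cyc, mem_cyc, sameCycle_succ hk h]

theorem label_succ_of_active {k : ℕ} {z : P} (h : W.Active k z) :
    W.label (k + 1) z = (k + 1, W.cyc (k + 1) z) := by rw [label, if_pos h]

theorem label_succ_of_not_active {k : ℕ} {z : P} (h : ¬ W.Active k z) :
    W.label (k + 1) z = W.label k z := by rw [label, if_neg h]

theorem label_fst_le (k : ℕ) (z : P) : (W.label k z).1 ≤ k := by
  induction k with
  | zero => exact le_rfl
  | succ k ih =>
    rw [label]
    split_ifs with h
    · exact le_rfl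
    · lia

theorem label_eq_iff {k : ℕ} (hk : k ≤ m) {z u : P} :
    W.label k z = W.label k u ↔ (W.σ k).SameCycle z u := by
  refine ⟨fun h => by rw [← cyc_eq_iff, ← label_snd hk, h, label_snd hk], fun h => ?_⟩
  induction k with
  | zero => rw [label, label, cyc_eq_iff.2 h]
  | succ k ih =>
    have h1 := active_congr hk (.inr h)
    by_cases h2 : W.Active k z
    · rw [label_succ_of_active h2, label_succ_of_active (h1.1 h2), cyc_eq_iff.2 h]
    · rw [label_succ_of_not_active h2, label_succ_of_not_active (fun h' => h2 (h1.2 h'))]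
      exact ih (by lia) ((sameCycle_succ hk h2).1 h)

variable (τ) in
/-- The involution on the edges. -/
noncomputable def iotaLabel (e : ℕ × Finset P) : ℕ × Finset P := (e.1, e.2.map τ.toEmbedding)

omit [Fintype P] [DecidableEq P] in
theorem iotaLabel_iotaLabel (hτ : IsFreeInvolution τ) (e : ℕ × Finset P) :
    iotaLabel τ (iotaLabel τ e) = e := by
  refine Prod.ext rfl ?_
  rw [iotaLabel, iotaLabel, Finset.map_map]
  convert Finset.map_refl
  ext u
  simp [hτ.invol]

theorem cyc_tau {k : ℕ} (hk : k ≤ m) (z : P) :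
    W.cyc k (τ z) = (W.cyc k z).map τ.toEmbedding := by
  ext u
  simp only [mem_cyc, Finset.mem_map, Equiv.coe_toEmbedding]
  rw [(balanced hk).sameCycle_tau_comm W.invol]
  exact ⟨fun h => ⟨_, h, W.invol.invol u⟩, by rintro ⟨w, hw, rfl⟩; rwa [W.invol.invol]⟩

theorem label_tau {k : ℕ} (hk : k ≤ m) (z : P) : W.label k (τ z) = iotaLabel τ (W.label k z) := by
  induction k with
  | zero => exact Prod.ext rfl (cyc_tau hk z)
  | succ k ih =>
    by_cases h : W.Active k z
    · rw [label_succ_of_active h, label_succ_of_active (active_tau.2 h), cyc_tau hk, iotaLabel]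
    · rw [label_succ_of_not_active h, label_succ_of_not_active fun h' => h (active_tau.1 h'),
        ih (by lia)]

/-- An edge is present from its first moment on, and inactive until the last one. -/
theorem label_of_le {k j : ℕ} {z : P} (hj : (W.label k z).1 ≤ j) (hjk : j ≤ k) :
    W.label j z = W.label k z ∧ (j < k → ¬ W.Active j z) := by
  induction k with
  | zero =>
    obtain rfl : j = 0 := by lia
    exact ⟨rfl, fun h => absurd h (lt_irrefl _)⟩
  | succ k ih =>
    by_cases h : W.Active k z
    · rw [label_succ_of_active h] at hj
      obtain rfl : j = k + 1 := le_antisymm hjk hj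
      exact ⟨rfl, fun h => absurd h (lt_irrefl _)⟩
    · rcases hjk.eq_or_lt with rfl | hlt
      · exact ⟨rfl, fun h => absurd h (lt_irrefl _)⟩
      · rw [label_succ_of_not_active h] at hj ⊢
        have := ih hj (by lia)
        refine ⟨this.1, fun _ => ?_⟩
        rcases (Nat.lt_succ_iff.1 hlt).eq_or_lt with rfl | hlt'
        · exact h
        · exact this.2 hlt'

theorem active_of_label_fst {k i : ℕ} {z : P} (h : (W.label k z).1 = i + 1) : W.Active i z := by
  have h1 := label_of_le (z := z) h.le (h ▸ label_fst_le k z)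
  by_contra h2
  have h3 := label_fst_le (W := W) i z
  rw [← h1.1, label_succ_of_not_active h2] at h
  lia

theorem death_le (e : ℕ × Finset P) : W.death e ≤ m := by
  refine Finset.sup_le fun k hk => ?_
  have := Finset.mem_range.1 (Finset.mem_filter.1 hk).1
  simp only [id]
  lia

theorem le_death {k : ℕ} (hk : k ≤ m) (z : P) : k ≤ W.death (W.label k z) :=
  Finset.le_sup (f := id) (Finset.mem_filter.2 ⟨Finset.mem_range.2 (by lia), z, rfl⟩)

theorem exists_label_death {k : ℕ} (hk : k ≤ m) (z : P) :
    ∃ u, W.label (W.death (W.label k z)) u = W.label k z := by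
  have hne : ((Finset.range (m + 1)).filter
      fun j => ∃ u, W.label j u = W.label k z).Nonempty :=
    ⟨k, Finset.mem_filter.2 ⟨Finset.mem_range.2 (by lia), z, rfl⟩⟩
  obtain ⟨j, hj, hs⟩ := Finset.exists_mem_eq_sup _ hne id
  obtain ⟨u, hu⟩ := (Finset.mem_filter.1 hj).2
  refine ⟨u, ?_⟩
  rw [death, hs]
  exact hu

/-- The edges present after `j` steps. -/
theorem label_eq_of_le_death {k j : ℕ} (hk : k ≤ m) {z : P} (h1 : (W.label k z).1 ≤ j)
    (h2 : j ≤ W.death (W.label k z)) : W.label j z = W.label k z := by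
  rcases le_total j k with hjk | hjk
  · exact (label_of_le h1 hjk).1
  · obtain ⟨u, hu⟩ := exists_label_death hk z
    have h3 := (label_of_le (W := W) (z := u) (by rw [hu]; exact h1) h2).1
    have h4 := (label_of_le (W := W) (z := u) (by rw [hu]; exact label_fst_le k z)
      (hjk.trans h2)).1
    have hjm := h2.trans (death_le _)
    rw [hu] at h3 h4
    rw [label_eq_iff hk] at h4
    clear hu h3
    -- the cycle of `u` does not change between the steps `k` and `j`
    induction j with
    | zero =>
      obtain rfl : k = 0 := by lia
      rfl
    | succ j ih =>
      rcases hjk.eq_or_lt with rfl | hlt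
      · rfl
      · have h5 := ih (by have := label_fst_le (W := W) k z; lia) (by lia) (by lia) (by lia)
        rw [← h5]
        refine label_succ_of_not_active fun hact => ?_
        obtain ⟨u, hu⟩ := exists_label_death hk z
        have h6 := label_of_le (W := W) (z := u) (k := W.death (W.label k z)) (j := j)
          (by rw [hu]; have := label_fst_le (W := W) k z; lia) (by lia)
        rw [hu, ← h5, label_eq_iff (by lia)] at h6
        exact h6.2 (by lia) ((active_congr (by lia) (.inl h6.1)).2 hact)

theorem death_eq_iff {i : ℕ} (hi : i < m) {z : P} : W.death (W.label i z) = i ↔ W.Active i z := by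
  constructor
  · intro h
    by_contra h1
    have h2 := le_death (W := W) (k := i + 1) hi z
    rw [label_succ_of_not_active h1, h] at h2
    lia
  · intro h
    by_contra h1
    have h2 := le_death (W := W) hi.le z
    have h3 := label_eq_of_le_death (W := W) hi.le (z := z) (j := i + 1)
      (by have := label_fst_le (W := W) i z; lia) (by lia)
    have h4 := label_fst_le (W := W) i z
    rw [← h3, label_succ_of_active h] at h4
    simp only at h4
    lia

theorem label_fst_mono {k j : ℕ} (hkj : k ≤ j) (z : P) : (W.label k z).1 ≤ (W.label j z).1 := by
  induction j, hkj using Nat.le_induction with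
  | base => exact le_rfl
  | succ j hkj ih =>
    refine ih.trans ?_
    by_cases h : W.Active j z
    · rw [label_succ_of_active h]
      exact (label_fst_le j z).trans (Nat.le_succ j)
    · rw [label_succ_of_not_active h]

/-- By transitivity every cycle changes at some step. -/
theorem exists_active (z : P) : ∃ i < m, W.Active i z := by
  by_contra! hno
  have hcyc : ∀ y, (∀ i < m, ¬ W.Active i y) → ∀ k ≤ m, ∀ u,
      (W.σ k).SameCycle y u ↔ (W.σ 0).SameCycle y u := by
    intro y hy k hk u
    induction k with
    | zero => exact Iff.rfl
    | succ k ih => rw [sameCycle_succ hk (hy k hk), ih (by lia)]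
  have hno' : ∀ i < m, ¬ W.Active i (τ z) := fun i hi h => hno i hi (active_tau.1 h)
  have h1 := hcyc z hno
  have h2 := hcyc _ hno'
  let S : Set P := {u | (W.σ 0).SameCycle z u ∨ (W.σ 0).SameCycle (τ z) u}
  have hfix : ∀ i < m, ∀ u ∈ S, ¬ W.Active i u := by
    rintro i hi u (hu | hu)
    · rw [← h1 i hi.le] at hu
      rw [← active_congr hi (.inl hu)]
      exact hno i hi
    · rw [← h2 i hi.le] at hu
      rw [← active_congr hi (.inl hu)]
      exact hno' i hi
  have hη : ∀ i < m, ∀ u ∈ S, W.η i u = u := fun i hi u hu =>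
    by_contra fun h => hfix i hi u hu (.inl (touched_of_ne h))
  have hη' : ∀ i < m, ∀ u ∈ S, τ (W.η i (τ u)) = u := fun i hi u hu => by
    have : W.η i (τ u) = τ u :=
      by_contra fun h => hfix i hi u hu (.inr (touched_of_ne h))
    rw [this, W.invol.invol]
  have hall := W.transitive S ⟨z, .inl (SameCycle.refl _ _)⟩
    (fun u => by simp only [S, Set.mem_ofPred_eq, sameCycle_apply_right])
    (fun u => by simp only [S, Set.mem_ofPred_eq, ← h1 m le_rfl, ← h2 m le_rfl,
      sameCycle_apply_right])
    (fun i hi u => ⟨fun h => by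
      have := hη i hi _ h
      rw [isSwap_apply_apply (W.isSwap i hi)] at this
      rwa [← this] at h, fun h => by rwa [hη i hi u h]⟩)
    (fun i hi u => ⟨fun h => by
      have := hη' i hi _ h
      rw [W.invol.invol, isSwap_apply_apply (W.isSwap i hi), W.invol.invol] at this
      rwa [← this] at h, fun h => by rwa [hη' i hi u h]⟩)
  obtain ⟨x, y, hxy, h0⟩ := W.isSwap 0 W.pos
  have := hη 0 W.pos x (hall x)
  rw [h0, swap_apply_left] at this
  exact hxy this.symm

/-- No edge is present all the time. -/
theorem fst_ne_zero_or_death_ne {k : ℕ} (hk : k ≤ m) (z : P) :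
    0 < (W.label k z).1 ∨ W.death (W.label k z) < m := by
  by_contra! h
  obtain ⟨i, hi, hact⟩ := W.exists_active z
  have h1 := label_eq_of_le_death (W := W) hk (z := z) (j := i) (by lia) (by lia)
  have h2 := (death_eq_iff hi).2 hact
  rw [h1] at h2
  lia

end Factorisation

end Existence

/-! ### Cycles that meet at a branch point -/

namespace Factorisation

open scoped Classical

variable {P : Type} [Fintype P] [DecidableEq P] {τ : Perm P} {m : ℕ} {W : Factorisation τ m}

theorem mem_star {i : ℕ} {z y : P} : y ∈ W.star i z ↔
    (Touched (W.η i) (W.σ i) z ∧ Touched (W.η i) (W.σ i) y) ∨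
      (Touched (W.η i) (W.σ i) (τ z) ∧ Touched (W.η i) (W.σ i) (τ y)) := by
  simp [star]

theorem mem_star_self {i : ℕ} {z : P} : z ∈ W.star i z ↔ W.Active i z := by
  rw [mem_star, and_self, and_self, Active]

theorem active_of_mem_star {i : ℕ} {z y : P} (h : y ∈ W.star i z) : W.Active i y :=
  (mem_star.1 h).imp And.right And.right

theorem mem_star_tau {i : ℕ} {z y : P} : y ∈ W.star i (τ z) ↔ τ y ∈ W.star i z := by
  rw [mem_star, mem_star, W.invol.invol, W.invol.invol, or_comm]

theorem star_tau {i : ℕ} {z : P} : W.star i (τ z) = (W.star i z).map τ.toEmbedding := by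
  ext y
  rw [mem_star_tau, Finset.mem_map]
  exact ⟨fun h => ⟨_, h, W.invol.invol y⟩, by
    rintro ⟨w, hw, rfl⟩
    simpa [W.invol.invol] using hw⟩

omit [Fintype P] in
theorem touched_tau {i : ℕ} (hi : i < m) {z : P} (h1 : Touched (W.η i) (W.σ i) z)
    (h2 : Touched (W.η i) (W.σ i) (τ z)) (w : P) :
    Touched (W.η i) (W.σ i) (τ w) ↔ Touched (W.η i) (W.σ i) w :=
  touched_tau_iff (balanced hi.le) W.invol (W.isSwap i hi) h1 h2 w

theorem star_eq_of_mem {i : ℕ} (hi : i < m) {z y : P} (h : y ∈ W.star i z) :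
    W.star i y = W.star i z := by
  ext u
  rw [mem_star] at h ⊢
  rw [mem_star]
  have h1 := touched_tau (W := W) hi (z := z)
  have h2 := touched_tau (W := W) hi (z := y)
  have h3 := fun a b => h1 a b y
  have h4 := fun a b => h2 a b u
  have h5 := fun a b => h1 a b u
  have h6 := fun a b => h2 a b z
  clear h1 h2
  generalize Touched (W.η i) (W.σ i) z = a at *
  generalize Touched (W.η i) (W.σ i) (τ z) = a' at *
  generalize Touched (W.η i) (W.σ i) y = b at *
  generalize Touched (W.η i) (W.σ i) (τ y) = b' at *
  generalize Touched (W.η i) (W.σ i) u = c at *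
  generalize Touched (W.η i) (W.σ i) (τ u) = c' at *
  rcases h with ⟨h, h'⟩ | ⟨h, h'⟩ <;> grind

theorem star_congr {i : ℕ} (hi : i < m) {z u : P}
    (h : (W.σ i).SameCycle z u ∨ (W.σ (i + 1)).SameCycle z u) : W.star i z = W.star i u := by
  ext y
  rw [mem_star, mem_star, touched_congr hi h, touched_congr_tau hi h]

theorem mem_star_congr {i : ℕ} (hi : i < m) {z u y : P}
    (h : (W.σ i).SameCycle z u ∨ (W.σ (i + 1)).SameCycle z u) :
    z ∈ W.star i y ↔ u ∈ W.star i y := by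
  rw [mem_star, mem_star, touched_congr hi h, touched_congr_tau hi h]

/-- The sum of the lengths of the cycles in a stable set. -/
theorem sum_card_label {k : ℕ} (hk : k ≤ m) {S : Finset P}
    (hS : ∀ z u, (W.σ k).SameCycle z u → z ∈ S → u ∈ S) :
    ∑ e ∈ S.image (W.label k), e.2.card = S.card := by
  rw [Finset.card_eq_sum_card_image (W.label k) S]
  refine Finset.sum_congr rfl fun e he => ?_
  obtain ⟨z, hz, rfl⟩ := Finset.mem_image.1 he
  rw [label_snd hk]
  congr 1
  ext u
  rw [mem_cyc, Finset.mem_filter, label_eq_iff hk]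
  exact ⟨fun h => ⟨hS z u h hz, h.symm⟩, fun h => h.2.symm⟩

theorem card_image_star_tau {k i : ℕ} (hk : k ≤ m) (z : P) :
    ((W.star i (τ z)).image (W.label k)).card = ((W.star i z).image (W.label k)).card := by
  have h : (W.star i (τ z)).image (W.label k) =
      ((W.star i z).image (W.label k)).image (iotaLabel τ) := by
    rw [star_tau, Finset.image_image]
    ext e
    simp only [Finset.mem_image, Finset.mem_map, Equiv.coe_toEmbedding, exists_exists_and_eq_and,
      Function.comp_apply, label_tau hk]
  rw [h, Finset.card_image_of_injective]
  exact Function.LeftInverse.injective (g := iotaLabel τ) (iotaLabel_iotaLabel W.invol)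

theorem card_cyc_tau {k : ℕ} (hk : k ≤ m) (z : P) :
    (W.cyc k (τ z)).card = (W.cyc k z).card := by
  rw [cyc_tau hk, Finset.card_map]

theorem card_label_pair {k : ℕ} (hk : k ≤ m) (x y : P) :
    (({x, y} : Finset P).image (W.label k)).card = if (W.σ k).SameCycle x y then 1 else 2 := by
  rw [Finset.image_insert, Finset.image_singleton]
  split_ifs with h
  · rw [(label_eq_iff hk).2 h]; simp
  · rw [Finset.card_pair]
    rwa [Ne, label_eq_iff hk]

/-- The numbers of cycles that come together at a step. -/
theorem star_cases {i : ℕ} (hi : i < m) : ∃ x, W.Active i x ∧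
    (∀ z, W.Active i z → W.star i z = W.star i x ∨ W.star i z = W.star i (τ x)) ∧
    ((W.star i (τ x) ≠ W.star i x ∧
      ((W.star i x).image (W.label i)).card + ((W.star i x).image (W.label (i + 1))).card = 3) ∨
    (W.star i (τ x) = W.star i x ∧
      ((W.star i x).image (W.label i)).card + ((W.star i x).image (W.label (i + 1))).card = 4 ∧
      ∃ w, ∀ z ∈ W.star i x, (W.cyc i z).card = w ∧ (W.cyc (i + 1) z).card = w)) := by
  obtain ⟨x, y, hxy, hη⟩ := W.isSwap i hi
  have hb := balanced (W := W) hi.le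
  have hb' := balanced (W := W) (k := i + 1) hi
  have hstep := W.step i hi
  have hT : ∀ z, Touched (W.η i) (W.σ i) z ↔ (W.σ i).SameCycle z x ∨ (W.σ i).SameCycle z y := by
    intro z
    rw [hη, touched_swap hxy]
  have hT' : ∀ z, Touched (W.η i) (W.σ i) z ↔
      (W.σ (i + 1)).SameCycle z x ∨ (W.σ (i + 1)).SameCycle z y := by
    intro z
    rw [← touched_succ hi, hη, touched_swap hxy]
  have hx : Touched (W.η i) (W.σ i) x := (hT x).2 (.inl (SameCycle.refl _ _))
  have hy : Touched (W.η i) (W.σ i) y := (hT y).2 (.inr (SameCycle.refl _ _))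
  have hnx := hb.not_sameCycle W.invol x
  have hny := hb.not_sameCycle W.invol y
  have hstar : ∀ z, z ∈ W.star i x ↔ Touched (W.η i) (W.σ i) z := by
    intro z
    rw [mem_star]
    have := fun h => touched_tau (W := W) hi hx h z
    tauto
  have himage : ∀ k ≤ m, (∀ z, Touched (W.η i) (W.σ i) z ↔
      (W.σ k).SameCycle z x ∨ (W.σ k).SameCycle z y) →
      (W.star i x).image (W.label k) = ({x, y} : Finset P).image (W.label k) := by
    intro k hk hTk
    apply Finset.Subset.antisymm
    · intro e he
      obtain ⟨z, hz, rfl⟩ := Finset.mem_image.1 he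
      rw [hstar, hTk] at hz
      rcases hz with hz | hz
      · exact Finset.mem_image.2 ⟨x, by simp, ((label_eq_iff hk).2 hz).symm⟩
      · exact Finset.mem_image.2 ⟨y, by simp, ((label_eq_iff hk).2 hz).symm⟩
    · refine Finset.image_subset_image ?_
      intro z hz
      rw [hstar]
      rcases Finset.mem_insert.1 hz with rfl | hz
      · exact hx
      · rwa [Finset.mem_singleton.1 hz]
  refine ⟨x, .inl hx, ?_, ?_⟩
  · rintro z (hz | hz)
    · exact .inl (star_eq_of_mem hi ((hstar z).2 hz))
    · refine .inr (star_eq_of_mem hi ?_)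
      rwa [mem_star_tau, hstar]
  rw [himage i hi.le hT, himage (i + 1) hi hT', card_label_pair hi.le, card_label_pair hi]
  -- a crossing if `τ y` lies on the cycle of `x`; otherwise a cut or a join
  by_cases hc : (W.σ i).SameCycle x (τ y)
  · right
    have hτx : Touched (W.η i) (W.σ i) (τ x) :=
      (hT _).2 (.inr ((hb.sameCycle_tau_comm W.invol).2 hc))
    obtain ⟨h1, h2⟩ := sameCycle_twist_of_cross hb W.invol hxy hc
    rw [← hη, ← hstep] at h1 h2
    have h3 : ¬ (W.σ i).SameCycle x y := fun h => hny (h.symm.trans hc)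
    refine ⟨star_eq_of_mem hi ((hstar _).2 hτx), by rw [if_neg h3, if_neg h1], ?_⟩
    have hw : ∀ k ≤ m, (∀ z, Touched (W.η i) (W.σ i) z ↔
        (W.σ k).SameCycle z x ∨ (W.σ k).SameCycle z y) → (W.σ k).SameCycle x (τ y) →
        ¬ (W.σ k).SameCycle x y →
        2 * (W.cyc k x).card = (W.star i x).card ∧
          ∀ z ∈ W.star i x, (W.cyc k z).card = (W.cyc k x).card := by
      intro k hk hTk hck hnk
      have e1 : (W.cyc k y).card = (W.cyc k x).card := by
        rw [cyc_eq_iff.2 hck, card_cyc_tau hk]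
      constructor
      · rw [← sum_card_label hk (S := W.star i x), himage k hk hTk, Finset.image_insert,
          Finset.image_singleton, Finset.sum_pair, label_snd hk, label_snd hk, e1, two_mul]
        · rwa [Ne, label_eq_iff hk]
        · intro z u hzu
          rw [hstar, hstar, hTk, hTk]
          exact Or.imp hzu.symm.trans hzu.symm.trans
      · intro z hz
        rw [hstar, hTk] at hz
        rcases hz with hz | hz
        · rw [cyc_eq_iff.2 hz]
        · rw [cyc_eq_iff.2 hz, e1]
    have hw1 := hw i hi.le hT hc h3
    have hw2 := hw (i + 1) hi hT' h2 h1
    exact ⟨(W.cyc i x).card, fun z hz => ⟨hw1.2 z hz, by rw [hw2.2 z hz]; lia⟩⟩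
  · left
    have hτx : ¬ Touched (W.η i) (W.σ i) (τ x) := by
      rw [hT]
      rintro (h | h)
      · exact hnx h.symm
      · exact hc ((hb.sameCycle_tau_comm W.invol).1 h)
    refine ⟨fun h => hτx ?_, ?_⟩
    · rw [← hstar, ← h, mem_star_self]
      exact active_tau.2 (.inl hx)
    by_cases h1 : (W.σ i).SameCycle x y
    · have h2 := (not_sameCycle_twist_of_cut hb W.invol hxy h1).1
      rw [← hη, ← hstep] at h2
      rw [if_pos h1, if_neg h2]
    · have h2 : (W.σ (i + 1)).SameCycle x y := by
        rw [hstep, hη, sameCycle_twist_of_join hb W.invol h1 hc]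
        exact .inr (.inl ⟨.inl (SameCycle.refl _ _), .inr (SameCycle.refl _ _)⟩)
      rw [if_neg h1, if_pos h2]

end Factorisation

/-! ### The graph of a factorisation -/

namespace Factorisation

open scoped Classical

variable {P : Type} [Fintype P] [DecidableEq P] {τ : Perm P} {m : ℕ}

variable (W : Factorisation τ m)

/-- The edges of the cover of a factorisation: the labels of the points. -/
def Edge : Type := {e : ℕ × Finset P // ∃ k ≤ m, ∃ z, W.label k z = e}

/-- The vertices of the cover of a factorisation: over the `i`-th branch point these are the unions
of the cycles that come together at the `i`-th step. -/
def Vertex : Type := {v : Fin m × Finset P // ∃ z, W.Active v.1 z ∧ W.star v.1 z = v.2}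

variable {W}

/-- The edge on which a point lies after `k` steps. -/
noncomputable def edge (k : ℕ) (hk : k ≤ m) (z : P) : W.Edge := ⟨W.label k z, k, hk, z, rfl⟩

/-- The vertex to which an active point comes at the `i`-th step. -/
noncomputable def vertex (i : Fin m) (z : P) (hz : W.Active i z) : W.Vertex :=
  ⟨(i, W.star i z), z, hz, rfl⟩

theorem vertex_eq_iff {i j : Fin m} {z u : P} {hz : W.Active i z} {hu : W.Active j u} :
    vertex i z hz = vertex j u hu ↔ i = j ∧ W.star i z = W.star i u := by
  rw [vertex, vertex]
  refine Subtype.mk_eq_mk.trans ?_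
  rw [Prod.mk.injEq]
  constructor
  · rintro ⟨rfl, h⟩; exact ⟨rfl, h⟩
  · rintro ⟨rfl, h⟩; exact ⟨rfl, h⟩

theorem exists_vertex (v : W.Vertex) : ∃ i z hz, v = vertex i z hz := by
  obtain ⟨⟨i, S⟩, z, hz, hS⟩ := v
  simp only at hz hS
  subst hS
  exact ⟨i, z, hz, rfl⟩

instance : Finite W.Edge := by
  refine Finite.of_surjective (fun q : Fin (m + 1) × P => edge (W := W) q.1 (by lia) q.2) ?_
  rintro ⟨e, k, hk, z, rfl⟩
  exact ⟨(⟨k, by lia⟩, z), rfl⟩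

noncomputable instance : Fintype W.Edge := Fintype.ofFinite _

noncomputable instance : Fintype W.Vertex :=
  inferInstanceAs (Fintype {v : Fin m × Finset P // ∃ z, W.Active v.1 z ∧ W.star v.1 z = v.2})

namespace Edge

/-- The number of steps after which an edge appears. -/
def birth (e : W.Edge) : ℕ := e.1.1

/-- The number of steps after which an edge is present for the last time. -/
noncomputable def death (e : W.Edge) : ℕ := Factorisation.death W e.1

/-- The length of the cycle that an edge stands for. -/
def weight (e : W.Edge) : ℕ := e.1.2.card

/-- A point of the cycle that an edge stands for. -/
noncomputable def point (e : W.Edge) : P := e.2.choose_spec.2.choose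

theorem label_point {e : W.Edge} {j : ℕ} (h1 : e.birth ≤ j) (h2 : j ≤ e.death) :
    W.label j e.point = e.1 := by
  have h := e.2.choose_spec.2.choose_spec
  rw [birth, ← h] at h1
  rw [death, ← h] at h2
  exact (label_eq_of_le_death e.2.choose_spec.1 h1 h2).trans h

theorem birth_le_death (e : W.Edge) : e.birth ≤ e.death := by
  obtain ⟨_, k, hk, z, rfl⟩ := e
  exact (label_fst_le k z).trans (le_death hk z)

theorem death_le (e : W.Edge) : e.death ≤ m := Factorisation.death_le _

theorem birth_pos_or_death_lt (e : W.Edge) : 0 < e.birth ∨ e.death < m := by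
  obtain ⟨_, k, hk, z, rfl⟩ := e
  exact fst_ne_zero_or_death_ne hk z

theorem sameCycle_point {e : W.Edge} {j : ℕ} (h1 : e.birth ≤ j) (h2 : j ≤ e.death) {z : P}
    (hz : W.label j z = e.1) : (W.σ j).SameCycle e.point z := by
  rw [← label_eq_iff (h2.trans e.death_le), label_point h1 h2, hz]

theorem active_point {e : W.Edge} (h : e.death < m) : W.Active e.death e.point := by
  rw [← death_eq_iff h, label_point e.birth_le_death le_rfl]
  rfl

theorem active_point' {e : W.Edge} (h : 0 < e.birth) : W.Active (e.birth - 1) e.point := by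
  apply active_of_label_fst (k := e.birth)
  rw [label_point le_rfl e.birth_le_death, Nat.sub_add_cancel h]
  rfl

theorem weight_pos (e : W.Edge) : 0 < e.weight := by
  have h := label_point (e := e) le_rfl e.birth_le_death
  rw [weight, ← h, label_snd (e.birth_le_death.trans e.death_le)]
  exact Finset.card_pos.2 ⟨e.point, mem_cyc.2 (SameCycle.refl _ _)⟩

/-- The vertex at which an edge ends. -/
noncomputable def endVertex (e : W.Edge) (h : e.death < m) : W.Vertex :=
  vertex ⟨e.death, h⟩ e.point (active_point h)

/-- The vertex at which an edge starts. -/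
noncomputable def startVertex (e : W.Edge) (h : 0 < e.birth) : W.Vertex :=
  vertex ⟨e.birth - 1, by have := e.birth_le_death; have := e.death_le; lia⟩ e.point
    (active_point' h)

end Edge

theorem death_edge {i : Fin m} {z : P} : (edge (W := W) i i.2.le z).death = i ↔ W.Active i z :=
  death_eq_iff i.2

theorem birth_edge {i : Fin m} {z : P} (hz : W.Active i z) :
    (edge (W := W) (i + 1) i.2 z).birth = i + 1 := by
  change (W.label (i + 1) z).1 = i + 1
  rw [label_succ_of_active hz]

theorem endVertex_eq {e : W.Edge} {i : Fin m} {z : P} (hz : W.Active i z)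
    (he : W.label i z = e.1) (h : e.death < m) : e.endVertex h = vertex i z hz := by
  have h1 : e = edge i i.2.le z := Subtype.ext he.symm
  have h2 : e.death = i := by rw [h1]; exact death_edge.2 hz
  refine vertex_eq_iff.2 ⟨Fin.ext h2, ?_⟩
  refine star_congr h (.inl (Edge.sameCycle_point e.birth_le_death le_rfl ?_))
  rw [h2, he]

theorem startVertex_eq {e : W.Edge} {i : Fin m} {z : P} (hz : W.Active i z)
    (he : W.label (i + 1) z = e.1) (h : 0 < e.birth) : e.startVertex h = vertex i z hz := by
  have h1 : e = edge (i + 1) i.2 z := Subtype.ext he.symm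
  have h2 : e.birth = i + 1 := by rw [h1]; exact birth_edge hz
  have h3 := e.birth_le_death
  have h4 : e.birth - 1 + 1 = e.birth := by lia
  refine vertex_eq_iff.2 ⟨Fin.ext (by simp [h2]), ?_⟩
  refine star_congr (by have := i.2; simp only; lia)
    (.inr (Edge.sameCycle_point (e := e) ?_ ?_ ?_))
  · simp only; lia
  · simp only; lia
  · simp only; rw [h4, h2, he]

/-- The edges that end at a vertex. -/
theorem sum_endVertex (F : W.Edge → ℕ) (G : ℕ × Finset P → ℕ) (hFG : ∀ e, F e = G e.1)
    {i : Fin m} {z : P} (hz : W.Active i z) :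
    ∑ e : {e : W.Edge // e.death < m}, (if e.1.endVertex e.2 = vertex i z hz then F e.1 else 0) =
      ∑ e ∈ (W.star i z).image (W.label i), G e := by
  rw [← Finset.sum_filter]
  refine Finset.sum_bij (fun e _ => e.1.1) ?_ ?_ ?_ (fun e _ => hFG _)
  · intro e he
    have he := (Finset.mem_filter.1 he).2
    obtain ⟨h1, h2⟩ := vertex_eq_iff.1 he
    have h3 : e.1.death = i := congrArg Fin.val h1
    refine Finset.mem_image.2 ⟨e.1.point, ?_, ?_⟩
    · rw [← h1, ← h2, mem_star_self]
      exact Edge.active_point e.2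
    · rw [← h3]
      exact Edge.label_point e.1.birth_le_death le_rfl
  · intro e _ e' _ h
    exact Subtype.ext (Subtype.ext h)
  · intro e he
    obtain ⟨u, hu, rfl⟩ := Finset.mem_image.1 he
    have hact := active_of_mem_star hu
    have hd : (edge (W := W) i i.2.le u).death = i := death_edge.2 hact
    refine ⟨⟨edge i i.2.le u, by rw [hd]; exact i.2⟩, ?_, rfl⟩
    rw [Finset.mem_filter]
    refine ⟨Finset.mem_univ _, ?_⟩
    rw [endVertex_eq hact rfl, vertex_eq_iff]
    exact ⟨rfl, star_eq_of_mem i.2 hu⟩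

/-- The edges that start at a vertex. -/
theorem sum_startVertex (F : W.Edge → ℕ) (G : ℕ × Finset P → ℕ) (hFG : ∀ e, F e = G e.1)
    {i : Fin m} {z : P} (hz : W.Active i z) :
    ∑ e : {e : W.Edge // 0 < e.birth}, (if e.1.startVertex e.2 = vertex i z hz then F e.1 else 0) =
      ∑ e ∈ (W.star i z).image (W.label (i + 1)), G e := by
  rw [← Finset.sum_filter]
  refine Finset.sum_bij (fun e _ => e.1.1) ?_ ?_ ?_ (fun e _ => hFG _)
  · intro e he
    have he := (Finset.mem_filter.1 he).2
    obtain ⟨h1, h2⟩ := vertex_eq_iff.1 he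
    have h3 : e.1.birth - 1 = i := congrArg Fin.val h1
    have h4 := e.2
    refine Finset.mem_image.2 ⟨e.1.point, ?_, ?_⟩
    · rw [← h1, ← h2, mem_star_self]
      exact Edge.active_point' e.2
    · rw [← h3, Nat.sub_add_cancel h4]
      exact Edge.label_point le_rfl e.1.birth_le_death
  · intro e _ e' _ h
    exact Subtype.ext (Subtype.ext h)
  · intro e he
    obtain ⟨u, hu, rfl⟩ := Finset.mem_image.1 he
    have hact := active_of_mem_star hu
    have hd : (edge (W := W) (i + 1) i.2 u).birth = i + 1 := birth_edge hact
    refine ⟨⟨edge (i + 1) i.2 u, by rw [hd]; lia⟩, ?_, rfl⟩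
    rw [Finset.mem_filter]
    refine ⟨Finset.mem_univ _, ?_⟩
    rw [startVertex_eq hact rfl, vertex_eq_iff]
    exact ⟨rfl, star_eq_of_mem i.2 hu⟩

variable (W) in
/-- The half-edges: the right halves of the edges that end at a vertex and the left halves of the
edges that start at a vertex. -/
abbrev HalfEdge : Type := {e : W.Edge // e.death < m} ⊕ {e : W.Edge // 0 < e.birth}

namespace HalfEdge

/-- The vertex of a half-edge. -/
noncomputable def root : W.HalfEdge → W.Vertex :=
  Sum.elim (fun e => e.1.endVertex e.2) (fun e => e.1.startVertex e.2)

/-- The other half of the same edge if there is one. -/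
noncomputable def inv : W.HalfEdge → W.HalfEdge :=
  Sum.elim (fun e => if h : 0 < e.1.birth then .inr ⟨e.1, h⟩ else .inl e)
    (fun e => if h : e.1.death < m then .inl ⟨e.1, h⟩ else .inr e)

/-- The edge of a half-edge. -/
def toEdge : W.HalfEdge → W.Edge := Sum.elim (fun e => e.1) (fun e => e.1)

theorem inv_inl_of_pos {e : W.Edge} (h : e.death < m) (h' : 0 < e.birth) :
    inv (.inl ⟨e, h⟩) = .inr ⟨e, h'⟩ := dif_pos h'

theorem inv_inr_of_lt {e : W.Edge} (h : e.death < m) (h' : 0 < e.birth) :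
    inv (.inr ⟨e, h'⟩) = .inl ⟨e, h⟩ := dif_pos h

theorem inv_inl_of_not {e : W.Edge} (h : e.death < m) (h' : ¬ 0 < e.birth) :
    inv (.inl ⟨e, h⟩) = .inl ⟨e, h⟩ := dif_neg h'

theorem inv_inr_of_not {e : W.Edge} (h : ¬ e.death < m) (h' : 0 < e.birth) :
    inv (.inr ⟨e, h'⟩) = .inr ⟨e, h'⟩ := dif_neg h

theorem inv_inv (h : W.HalfEdge) : inv (inv h) = h := by
  rcases h with ⟨e, he⟩ | ⟨e, he⟩
  · by_cases h' : 0 < e.birth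
    · rw [inv_inl_of_pos he h', inv_inr_of_lt he h']
    · rw [inv_inl_of_not he h', inv_inl_of_not he h']
  · by_cases h' : e.death < m
    · rw [inv_inr_of_lt h' he, inv_inl_of_pos h' he]
    · rw [inv_inr_of_not h' he, inv_inr_of_not h' he]

theorem toEdge_inv (h : W.HalfEdge) : (inv h).toEdge = h.toEdge := by
  rcases h with ⟨e, he⟩ | ⟨e, he⟩
  · by_cases h' : 0 < e.birth
    · rw [inv_inl_of_pos he h']; rfl
    · rw [inv_inl_of_not he h']
  · by_cases h' : e.death < m
    · rw [inv_inr_of_lt h' he]; rfl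
    · rw [inv_inr_of_not h' he]

theorem inv_eq_iff (h : W.HalfEdge) : inv h = h ↔ ¬ (0 < h.toEdge.birth ∧ h.toEdge.death < m) := by
  rcases h with ⟨e, he⟩ | ⟨e, he⟩
  · by_cases h' : 0 < e.birth
    · rw [inv_inl_of_pos he h']; simp [toEdge, h', he]
    · rw [inv_inl_of_not he h']; simp [toEdge, h']
  · by_cases h' : e.death < m
    · rw [inv_inr_of_lt h' he]; simp [toEdge, h', he]
    · rw [inv_inr_of_not h' he]; simp [toEdge, h']

end HalfEdge

theorem card_root {i : Fin m} {z : P} (hz : W.Active i z) :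
    Nat.card {h : W.HalfEdge // h.root = vertex i z hz} =
      ((W.star i z).image (W.label i)).card + ((W.star i z).image (W.label (i + 1))).card := by
  rw [Nat.card_eq_fintype_card, Fintype.card_subtype, Finset.card_filter, Fintype.sum_sum_type,
    Finset.card_eq_sum_ones, Finset.card_eq_sum_ones,
    ← sum_endVertex (fun _ => 1) (fun _ => 1) (fun _ => rfl) hz,
    ← sum_startVertex (fun _ => 1) (fun _ => 1) (fun _ => rfl) hz]
  rfl

theorem sum_weight_endVertex {i : Fin m} {z : P} (hz : W.Active i z) :
    ∑ e : {e : W.Edge // e.death < m},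
      (if e.1.endVertex e.2 = vertex i z hz then e.1.weight else 0) = (W.star i z).card := by
  rw [sum_endVertex Edge.weight (fun e => e.2.card) (fun _ => rfl) hz]
  exact sum_card_label i.2.le fun u v h => (mem_star_congr i.2 (.inl h)).1

theorem sum_weight_startVertex {i : Fin m} {z : P} (hz : W.Active i z) :
    ∑ e : {e : W.Edge // 0 < e.birth},
      (if e.1.startVertex e.2 = vertex i z hz then e.1.weight else 0) = (W.star i z).card := by
  rw [sum_startVertex Edge.weight (fun e => e.2.card) (fun _ => rfl) hz]
  exact sum_card_label i.2 fun u v h => (mem_star_congr i.2 (.inr h)).1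

section Connected

/-- Two vertices are joined by a path. -/
def Linked : W.Vertex → W.Vertex → Prop :=
  Relation.ReflTransGen fun a c => ∃ h : W.HalfEdge, h.root = a ∧ h.inv.root = c

theorem Linked.symm {v w : W.Vertex} (h : Linked v w) : Linked w v := by
  induction h with
  | refl => exact Relation.ReflTransGen.refl
  | tail _ h ih =>
    obtain ⟨h, rfl, rfl⟩ := h
    exact Relation.ReflTransGen.head ⟨h.inv, rfl, by rw [HalfEdge.inv_inv]⟩ ih

/-- The vertices to which one point comes are joined by the edges on which it lies meanwhile. -/
theorem linked_vertex {i j : Fin m} (hij : i ≤ j) {z : P} (hi : W.Active i z)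
    (hj : W.Active j z) : Linked (vertex j z hj) (vertex i z hi) := by
  induction hn : (j : ℕ) using Nat.strong_induction_on generalizing j with
  | _ n ih =>
    subst hn
    rcases hij.eq_or_lt with rfl | hlt
    · exact Relation.ReflTransGen.refl
    · have h0 := label_fst_mono (W := W) (k := i + 1) (j := j) hlt z
      rw [label_succ_of_active hi] at h0
      have h1 := label_fst_le (W := W) j z
      set e : W.Edge := edge j j.2.le z with he
      have hb : e.birth = (W.label j z).1 := rfl
      have hb0 : 0 < e.birth := by simp only at h0; lia
      have hd : e.death = j := death_edge.2 hj
      let k : Fin m := ⟨e.birth - 1, by have := j.2; lia⟩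
      have hk : W.Active k z := active_of_label_fst (k := j) (by simp only [k]; lia)
      have hkl : W.label (k + 1) z = e.1 := by
        have : (k : ℕ) + 1 = e.birth := Nat.sub_add_cancel hb0
        rw [this]
        exact (label_of_le (z := z) (k := j) le_rfl h1).1
      have hkj : k < j := by
        change e.birth - 1 < j
        lia
      have hik : i ≤ k := by
        change (i : ℕ) ≤ e.birth - 1
        simp only at h0
        lia
      refine Relation.ReflTransGen.head ?_ (ih k hkj hik hk rfl)
      have hdm : e.death < m := by rw [hd]; exact j.2
      refine ⟨.inl ⟨e, hdm⟩, endVertex_eq hj rfl hdm, ?_⟩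
      rw [HalfEdge.inv_inl_of_pos hdm hb0]
      exact startVertex_eq hk hkl hb0

/-- The points that come to a vertex linked to `v` form a stable set, so that all vertices are
linked to `v` by transitivity. -/
theorem linked (v w : W.Vertex) : Linked v w := by
  let S : Set P := {z | ∃ (i : Fin m) (hz : W.Active i z), Linked v (vertex i z hz)}
  have hS : ∀ {i : Fin m} {z : P} (hz : W.Active i z), z ∈ S ↔ Linked v (vertex i z hz) := by
    intro i z hz
    refine ⟨?_, fun h => ⟨i, hz, h⟩⟩
    rintro ⟨j, hj, h⟩
    rcases le_total i j with hij | hij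
    · exact h.trans (linked_vertex hij hz hj)
    · exact h.trans (linked_vertex hij hj hz).symm
  have hstar : ∀ {i : Fin m} {z u : P}, W.Active i z → W.Active i u →
      W.star i u = W.star i z → (u ∈ S ↔ z ∈ S) := by
    intro i z u hz hu hzu
    rw [hS hz, hS hu, vertex_eq_iff.2 ⟨rfl, hzu⟩]
  -- a cycle of `σ 0` stays together until it first changes, when all its points come to one vertex
  have hσ0 : ∀ z, W.σ 0 z ∈ S ↔ z ∈ S := by
    intro z
    have h0 : W.label 0 (W.σ 0 z) = W.label 0 z :=
      (label_eq_iff (Nat.zero_le _)).2 (sameCycle_apply_left.2 (SameCycle.refl _ _))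
    have hd : W.death (W.label 0 z) < m :=
      (fst_ne_zero_or_death_ne (Nat.zero_le _) z).resolve_left (lt_irrefl 0)
    have h1 := label_eq_of_le_death (W := W) (Nat.zero_le _) (z := z)
      (j := W.death (W.label 0 z)) (Nat.zero_le _) le_rfl
    have h2 := label_eq_of_le_death (W := W) (Nat.zero_le _) (z := W.σ 0 z)
      (j := W.death (W.label 0 z)) (Nat.zero_le _) (by rw [h0])
    have h3 := (label_eq_iff hd.le).1 (h2.trans (h0.trans h1.symm))
    have ha := (death_eq_iff (W := W) hd (z := z)).1 (by rw [h1])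
    exact hstar (i := ⟨_, hd⟩) ha ((active_congr hd (.inl h3)).2 ha) (star_congr hd (.inl h3))
  have hσm : ∀ z, W.σ m z ∈ S ↔ z ∈ S := by
    intro z
    have h0 : W.label m (W.σ m z) = W.label m z :=
      (label_eq_iff le_rfl).2 (sameCycle_apply_left.2 (SameCycle.refl _ _))
    have hd := (fst_ne_zero_or_death_ne (W := W) le_rfl z).resolve_right
      (not_lt.2 (le_death le_rfl z))
    have hle := label_fst_le (W := W) m z
    obtain ⟨i, hi⟩ : ∃ i, (W.label m z).1 = i + 1 := ⟨_, (Nat.sub_add_cancel hd).symm⟩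
    have him : i < m := by lia
    have h1 := (label_of_le (W := W) (j := i + 1) (z := z) hi.le him).1
    have h2 := (label_of_le (W := W) (j := i + 1) (z := W.σ m z) (by rw [h0]; exact hi.le)
      him).1
    have h3 := (label_eq_iff him).1 (h2.trans (h0.trans h1.symm))
    have ha := active_of_label_fst hi
    exact hstar (i := ⟨i, him⟩) ha ((active_congr him (.inr h3)).2 ha) (star_congr him (.inr h3))
  have hη : ∀ i < m, ∀ z, W.η i z ∈ S ↔ z ∈ S := by
    intro i hi z
    by_cases hz : W.η i z = z
    · rw [hz]
    · have h1 : Touched (W.η i) (W.σ i) z := touched_of_ne hz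
      have h2 : Touched (W.η i) (W.σ i) (W.η i z) :=
        touched_of_ne fun h => hz ((W.η i).injective h)
      exact hstar (i := ⟨i, hi⟩) (.inl h1) (.inl h2)
        (star_eq_of_mem hi (mem_star.2 (.inl ⟨h1, h2⟩)))
  have hη' : ∀ i < m, ∀ z, τ (W.η i (τ z)) ∈ S ↔ z ∈ S := by
    intro i hi z
    by_cases hz : W.η i (τ z) = τ z
    · rw [hz, W.invol.invol]
    · have h1 : Touched (W.η i) (W.σ i) (τ z) := touched_of_ne hz
      have h2 : Touched (W.η i) (W.σ i) (τ (τ (W.η i (τ z)))) := by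
        rw [W.invol.invol]
        exact touched_of_ne fun h => hz ((W.η i).injective h)
      exact hstar (i := ⟨i, hi⟩) (.inr h1) (.inr h2)
        (star_eq_of_mem hi (mem_star.2 (.inr ⟨h1, h2⟩)))
  obtain ⟨i, z, hz, rfl⟩ := exists_vertex v
  obtain ⟨j, u, hu, rfl⟩ := exists_vertex w
  have hne : S.Nonempty := ⟨z, i, hz, Relation.ReflTransGen.refl⟩
  exact (hS hu).1 (W.transitive S hne hσ0 hσm hη hη' u)

end Connected

/-- Over each branch point there are two vertices of valence three, which are exchanged by the
involution, or one fixed vertex of valence four, at which all edges have the same weight. -/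
theorem valence_cases (i : Fin m) :
    (∃ v w : W.Vertex, v ≠ w ∧ (∀ u : W.Vertex, u.1.1 = i ↔ u = v ∨ u = w) ∧
      Nat.card {h : W.HalfEdge // h.root = v} = 3 ∧
      Nat.card {h : W.HalfEdge // h.root = w} = 3 ∧ w.1.2 = v.1.2.map τ.toEmbedding) ∨
    (∃ v : W.Vertex, (∀ u : W.Vertex, u.1.1 = i ↔ u = v) ∧
      Nat.card {h : W.HalfEdge // h.root = v} = 4 ∧ v.1.2.map τ.toEmbedding = v.1.2 ∧
      ∃ w, ∀ h : W.HalfEdge, h.root = v → h.toEdge.weight = w) := by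
  obtain ⟨x, hx, hall, ⟨hne, hcard⟩ | ⟨heq, hcard, w, hw⟩⟩ := star_cases (W := W) i.2
  · refine .inl ⟨vertex i x hx, vertex i (τ x) (active_tau.2 hx), ?_, ?_, ?_, ?_, star_tau⟩
    · rw [Ne, vertex_eq_iff]
      exact fun h => hne h.2.symm
    · intro u
      obtain ⟨j, z, hz, rfl⟩ := exists_vertex u
      rw [vertex_eq_iff, vertex_eq_iff]
      constructor
      · rintro (rfl : j = i)
        exact (hall z hz).imp (fun h => ⟨rfl, h⟩) fun h => ⟨rfl, h⟩
      · rintro (h | h)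
        exacts [h.1, h.1]
    · rw [card_root, hcard]
    · rw [card_root, card_image_star_tau i.2.le, card_image_star_tau i.2, hcard]
  · refine .inr ⟨vertex i x hx, ?_, ?_, ?_, w, ?_⟩
    · intro u
      obtain ⟨j, z, hz, rfl⟩ := exists_vertex u
      rw [vertex_eq_iff]
      constructor
      · rintro (rfl : j = i)
        refine ⟨rfl, (hall z hz).elim id fun h => h.trans heq⟩
      · exact fun h => h.1
    · rw [card_root, hcard]
    · exact star_tau.symm.trans heq
    · rintro (⟨e, he⟩ | ⟨e, he⟩) h
      · change e.endVertex he = _ at h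
        rw [Edge.endVertex, vertex_eq_iff] at h
        obtain ⟨h1, h2⟩ := h
        have h3 : e.death = i := congrArg Fin.val h1
        have h4 : e.point ∈ W.star i x := by
          rw [← h1, ← h2, mem_star_self]
          exact Edge.active_point he
        have h5 := Edge.label_point (e := e) (j := i) (by rw [← h3]; exact e.birth_le_death) h3.ge
        rw [← (hw _ h4).1, ← label_snd i.2.le, h5]
        rfl
      · change e.startVertex he = _ at h
        rw [Edge.startVertex, vertex_eq_iff] at h
        obtain ⟨h1, h2⟩ := h
        have h3 : e.birth - 1 = i := congrArg Fin.val h1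
        have h6 : e.birth = i + 1 := by lia
        have h4 : e.point ∈ W.star i x := by
          rw [← h1, ← h2, mem_star_self]
          exact Edge.active_point' he
        have h5 := Edge.label_point (e := e) (j := i + 1) h6.le (by rw [← h6]; exact e.birth_le_death)
        rw [← (hw _ h4).2, ← label_snd i.2, h5]
        rfl

end Factorisation

/-! ### The cover of a factorisation -/

namespace Factorisation

open scoped Classical

variable {P : Type} [Fintype P] [DecidableEq P] {τ : Perm P} {m : ℕ} {W : Factorisation τ m}

section Involution

/-- The involution on the edges. -/
noncomputable def Edge.iota (e : W.Edge) : W.Edge :=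
  ⟨iotaLabel τ e.1, by
    obtain ⟨k, hk, z, hz⟩ := e.2
    exact ⟨k, hk, τ z, by rw [label_tau hk, hz]⟩⟩

theorem Edge.iota_iota (e : W.Edge) : e.iota.iota = e :=
  Subtype.ext (iotaLabel_iotaLabel W.invol e.1)

theorem edge_tau {k : ℕ} {hk : k ≤ m} {z : P} :
    edge (W := W) k hk (τ z) = (edge k hk z).iota := Subtype.ext (label_tau hk z)

theorem edge_eq_iff {k : ℕ} {hk : k ≤ m} {z u : P} :
    edge (W := W) k hk z = edge k hk u ↔ (W.σ k).SameCycle z u := by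
  rw [← label_eq_iff hk]
  exact Subtype.ext_iff

theorem edge_point {e : W.Edge} {k : ℕ} {hk : k ≤ m} (h1 : e.birth ≤ k) (h2 : k ≤ e.death) :
    edge k hk e.point = e := Subtype.ext (Edge.label_point h1 h2)

theorem birth_edge_le {k : ℕ} {hk : k ≤ m} {z : P} : (edge (W := W) k hk z).birth ≤ k :=
  label_fst_le k z

theorem le_death_edge {k : ℕ} {hk : k ≤ m} {z : P} : k ≤ (edge (W := W) k hk z).death :=
  le_death hk z

theorem Edge.iota_ne (e : W.Edge) : e.iota ≠ e := by
  rw [← edge_point (k := e.death) (hk := e.death_le) e.birth_le_death le_rfl, ← edge_tau, Ne,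
    edge_eq_iff]
  exact fun h => (balanced e.death_le).not_sameCycle W.invol _ h.symm

theorem Edge.birth_iota (e : W.Edge) : e.iota.birth = e.birth := rfl

theorem Edge.weight_iota (e : W.Edge) : e.iota.weight = e.weight := Finset.card_map _

theorem Edge.death_iota (e : W.Edge) : e.iota.death = e.death := by
  have key : ∀ e : W.Edge, e.death ≤ e.iota.death := by
    intro e
    have h := le_death_edge (W := W) (hk := e.death_le) (z := τ e.point)
    rwa [edge_tau, edge_point e.birth_le_death le_rfl] at h
  exact le_antisymm ((key e.iota).trans_eq (by rw [iota_iota])) (key e)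

variable (W) in
/-- The edges of a factorisation with their weights and the involution. -/
noncomputable def labelEdges : PairedEdges W.Edge where
  iota := Edge.iota
  free := ⟨Edge.iota_iota, Edge.iota_ne⟩
  weight := Edge.weight
  weight_pos := Edge.weight_pos
  weight_iota := Edge.weight_iota

variable (W) in
/-- The edges that are present after `k` steps. -/
noncomputable def present (k : ℕ) : Finset W.Edge :=
  Finset.univ.filter fun e => e.birth ≤ k ∧ k ≤ e.death

theorem mem_present {k : ℕ} {e : W.Edge} : e ∈ W.present k ↔ e.birth ≤ k ∧ k ≤ e.death := by
  simp [present]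

theorem isState {k : ℕ} (hk : k ≤ m) :
    IsState W.labelEdges τ (W.present k) (W.σ k, edge k hk) where
  balanced := balanced hk
  mem z := mem_present.2 ⟨birth_edge_le (hk := hk), le_death_edge (hk := hk)⟩
  label_tau z := edge_tau (hk := hk)
  sameCycle z u := (edge_eq_iff (hk := hk)).symm
  card e he := by
    rw [mem_present] at he
    change _ = e.1.2.card
    rw [← edge_point (hk := hk) he.1 he.2]
    change _ = (W.label k e.point).2.card
    rw [label_snd hk]
    congr 1
    ext u
    simp only [Finset.mem_filter, Finset.mem_univ, true_and]
    rw [edge_eq_iff, mem_cyc]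
    exact ⟨SameCycle.symm, SameCycle.symm⟩

/-- The involution on the vertices. -/
noncomputable def Vertex.iota (v : W.Vertex) : W.Vertex :=
  ⟨(v.1.1, v.1.2.map τ.toEmbedding), by
    obtain ⟨z, hz, hS⟩ := v.2
    exact ⟨τ z, active_tau.2 hz, by rw [star_tau, hS]⟩⟩

theorem iota_vertex {i : Fin m} {z : P} (hz : W.Active i z) :
    (vertex i z hz).iota = vertex i (τ z) (active_tau.2 hz) := by
  refine Subtype.ext (Prod.ext rfl ?_)
  exact star_tau.symm

theorem Vertex.iota_iota (v : W.Vertex) : v.iota.iota = v := by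
  obtain ⟨i, z, hz, rfl⟩ := exists_vertex v
  rw [iota_vertex, iota_vertex, vertex_eq_iff, W.invol.invol]
  exact ⟨rfl, rfl⟩

theorem endVertex_iota (e : W.Edge) (h : e.death < m) (h' : e.iota.death < m) :
    e.iota.endVertex h' = (e.endVertex h).iota := by
  refine Eq.trans ?_ (iota_vertex (Edge.active_point h)).symm
  refine endVertex_eq (i := ⟨e.death, h⟩) (active_tau.2 (Edge.active_point h)) ?_ h'
  rw [label_tau e.death_le, Edge.label_point e.birth_le_death le_rfl]
  rfl

theorem startVertex_iota (e : W.Edge) (h : 0 < e.birth) (h' : 0 < e.iota.birth) :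
    e.iota.startVertex h' = (e.startVertex h).iota := by
  refine Eq.trans ?_ (iota_vertex (Edge.active_point' h)).symm
  refine startVertex_eq (active_tau.2 (Edge.active_point' h)) ?_ h'
  simp only [Nat.sub_add_cancel h]
  rw [label_tau (e.birth_le_death.trans e.death_le), Edge.label_point le_rfl e.birth_le_death]
  rfl

/-- The involution on the half-edges. -/
noncomputable def HalfEdge.iota : W.HalfEdge → W.HalfEdge :=
  Sum.map (fun e => ⟨e.1.iota, by rw [Edge.death_iota]; exact e.2⟩) fun e => ⟨e.1.iota, e.2⟩

theorem HalfEdge.iota_iota (h : W.HalfEdge) : h.iota.iota = h := by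
  rcases h with e | e <;> simp [iota, Edge.iota_iota]

theorem HalfEdge.root_iota (h : W.HalfEdge) : h.iota.root = h.root.iota := by
  rcases h with ⟨e, h⟩ | ⟨e, h⟩
  · exact endVertex_iota e h _
  · exact startVertex_iota e h h

theorem HalfEdge.toEdge_iota (h : W.HalfEdge) : h.iota.toEdge = h.toEdge.iota := by
  rcases h with e | e <;> rfl

theorem HalfEdge.inv_iota (h : W.HalfEdge) : h.iota.inv = h.inv.iota := by
  rcases h with ⟨e, he⟩ | ⟨e, he⟩
  · have he' : e.iota.death < m := by rwa [Edge.death_iota]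
    change inv (.inl ⟨e.iota, he'⟩) = _
    by_cases h' : 0 < e.birth
    · rw [inv_inl_of_pos he h', inv_inl_of_pos he' h']; rfl
    · rw [inv_inl_of_not he h', inv_inl_of_not he' h']; rfl
  · change inv (.inr ⟨e.iota, he⟩) = _
    by_cases h' : e.death < m
    · have he' : e.iota.death < m := by rwa [Edge.death_iota]
      rw [inv_inr_of_lt h' he, inv_inr_of_lt he' he]; rfl
    · have he' : ¬ e.iota.death < m := by rwa [Edge.death_iota]
      rw [inv_inr_of_not h' he, inv_inr_of_not he' he]; rfl

theorem HalfEdge.iota_ne (h : W.HalfEdge) : h.iota ≠ h ∧ h.iota ≠ h.inv := by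
  constructor
  · intro h'
    exact h.toEdge.iota_ne (by rw [← toEdge_iota, h'])
  · intro h'
    exact h.toEdge.iota_ne (by rw [← toEdge_iota, h', toEdge_inv])

end Involution

section Cover

variable {p : Fin m → ℝ}

/-- The length of an edge. -/
noncomputable def Edge.length (p : Fin m → ℝ) (e : W.Edge) : ℝ≥0∞ :=
  if h : 0 < e.birth ∧ e.death < m then
    ENNReal.ofReal ((p (e.endVertex h.2).1.1 - p (e.startVertex h.1).1.1) / e.weight)
  else ⊤

theorem Edge.length_pos_aux (hp : StrictMono p) {e : W.Edge} (h : 0 < e.birth ∧ e.death < m) :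
    0 < (p (e.endVertex h.2).1.1 - p (e.startVertex h.1).1.1) / e.weight := by
  have h1 : (e.startVertex h.1).1.1 < (e.endVertex h.2).1.1 := by
    have := e.birth_le_death
    have := h.1
    change e.birth - 1 < e.death
    lia
  have h2 := hp h1
  have h3 : (0 : ℝ) < e.weight := by exact_mod_cast e.weight_pos
  exact div_pos (by linarith) h3

variable (W) in
/-- The tropical curve of a factorisation. -/
noncomputable def curve (hp : StrictMono p) : TropicalCurve where
  V := W.Vertex
  H := W.HalfEdge
  root := HalfEdge.root
  inv := HalfEdge.inv
  inv_inv := HalfEdge.inv_inv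
  length h := h.toEdge.length p
  length_inv h := by rw [HalfEdge.toEdge_inv]
  length_pos h := by
    rw [Edge.length]
    split_ifs with h1
    · exact ENNReal.ofReal_pos.2 (Edge.length_pos_aux hp h1)
    · exact ENNReal.zero_lt_top
  length_eq_top_iff h := by
    rw [HalfEdge.inv_eq_iff, Edge.length]
    split_ifs with h1
    · simp [h1]
    · simp [h1]
  valence_ne_one v := by
    rcases valence_cases (W := W) v.1.1 with ⟨a, b, -, hab, ha, hb, -⟩ | ⟨a, haa, ha, -⟩
    · rcases (hab v).1 rfl with rfl | rfl
      · rw [ha]; decide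
      · rw [hb]; decide
    · obtain rfl := (haa v).1 rfl
      rw [ha]; decide
  nonempty := by
    obtain ⟨x, hx, -⟩ := star_cases (W := W) W.pos
    exact ⟨vertex ⟨0, W.pos⟩ x hx⟩
  connected := linked

/-- The slope of a half-edge. -/
def HalfEdge.slope : W.HalfEdge → ℤ :=
  Sum.elim (fun e => -(e.1.weight : ℤ)) (fun e => (e.1.weight : ℤ))

theorem HalfEdge.slope_inl {e : {e : W.Edge // e.death < m}} :
    slope (.inl e : W.HalfEdge) = -(e.1.weight : ℤ) := rfl

theorem HalfEdge.slope_inr {e : {e : W.Edge // 0 < e.birth}} :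
    slope (.inr e : W.HalfEdge) = (e.1.weight : ℤ) := rfl

theorem HalfEdge.slope_inl_neg (e : {e : W.Edge // e.death < m}) :
    slope (.inl e : W.HalfEdge) < 0 := by
  have := e.1.weight_pos
  rw [slope_inl]
  lia

theorem HalfEdge.slope_inr_pos (e : {e : W.Edge // 0 < e.birth}) :
    0 < slope (.inr e : W.HalfEdge) := by
  have := e.1.weight_pos
  rw [slope_inr]
  lia

theorem HalfEdge.natAbs_slope (h : W.HalfEdge) : h.slope.natAbs = h.toEdge.weight := by
  rcases h with ⟨e, he⟩ | ⟨e, he⟩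
  · exact Int.natAbs_neg _
  · rfl

theorem HalfEdge.slope_inv (h : W.HalfEdge) (hh : h.inv ≠ h) : h.inv.slope = -h.slope := by
  rcases h with ⟨e, he⟩ | ⟨e, he⟩
  · have h' : 0 < e.birth := by_contra fun h' => hh (inv_inl_of_not he h')
    rw [inv_inl_of_pos he h', slope_inl, slope_inr, neg_neg]
  · have h' : e.death < m := by_contra fun h' => hh (inv_inr_of_not h' he)
    rw [inv_inr_of_lt h' he, slope_inl, slope_inr]

theorem HalfEdge.pos_inv (hp : StrictMono p) (h : W.HalfEdge) (hh : h.inv ≠ h) :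
    p h.inv.root.1.1 = p h.root.1.1 + (h.slope : ℝ) * (h.toEdge.length p).toReal := by
  have key : ∀ (e : W.Edge) (h : 0 < e.birth ∧ e.death < m),
      p (e.endVertex h.2).1.1 - p (e.startVertex h.1).1.1 =
        e.weight * (e.length p).toReal := by
    intro e h
    have h3 : (e.weight : ℝ) ≠ 0 := by exact_mod_cast e.weight_pos.ne'
    rw [Edge.length, dif_pos h, ENNReal.toReal_ofReal (Edge.length_pos_aux hp h).le]
    field_simp
  rcases h with ⟨e, he⟩ | ⟨e, he⟩
  · have h' : 0 < e.birth := by_contra fun h' => hh (inv_inl_of_not he h')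
    have := key e ⟨h', he⟩
    rw [inv_inl_of_pos he h', slope_inl]
    simp only [root, toEdge, Sum.elim_inl, Sum.elim_inr]
    push_cast
    linarith
  · have h' : e.death < m := by_contra fun h' => hh (inv_inr_of_not h' he)
    have := key e ⟨he, h'⟩
    rw [inv_inr_of_lt h' he, slope_inr]
    simp only [root, toEdge, Sum.elim_inl, Sum.elim_inr]
    push_cast
    linarith

theorem HalfEdge.harmonic (v : W.Vertex) :
    ∑ h ∈ Finset.univ.filter (fun h : W.HalfEdge => h.root = v ∧ h.slope < 0), h.slope.natAbs =
    ∑ h ∈ Finset.univ.filter (fun h : W.HalfEdge => h.root = v ∧ 0 < h.slope), h.slope.natAbs := by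
  obtain ⟨i, z, hz, rfl⟩ := exists_vertex v
  have h1 := sum_weight_endVertex hz
  have h2 := sum_weight_startVertex hz
  rw [Finset.sum_filter, Finset.sum_filter, Fintype.sum_sum_type, Fintype.sum_sum_type]
  simp only [slope_inl_neg, slope_inr_pos, (slope_inl_neg _).not_gt, (slope_inr_pos _).not_gt,
    and_true, and_false, if_false, Finset.sum_const_zero, add_zero, zero_add, natAbs_slope]
  exact h1.trans h2.symm

variable (W) in
/-- The tropical cover of a factorisation. -/
noncomputable def cover (hp : StrictMono p) : TropicalCover where
  toTropicalCurve := W.curve hp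
  pos v := p v.1.1
  slope := HalfEdge.slope
  slope_inv := HalfEdge.slope_inv
  slope_end := by
    rintro (e | e) -
    · exact (HalfEdge.slope_inl_neg e).ne
    · exact (HalfEdge.slope_inr_pos e).ne'
  pos_inv := HalfEdge.pos_inv hp
  harmonic := HalfEdge.harmonic

end Cover

section TwistedCover

variable {n g : ℕ} {μ ν : n.Partition} {p : Fin (numBranch g μ ν) → ℝ}
variable {W : Factorisation (tau n) (numBranch g μ ν)}

/-- The ends over the left ray. -/
theorem map_weight_left {_ : DecidablePred fun h : W.HalfEdge => h.inv = h ∧ h.slope < 0}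
    (hμ : HasDoubledCycleType (W.σ 0) μ) :
    ((Finset.univ.filter fun h : W.HalfEdge => h.inv = h ∧ h.slope < 0).val.map
      fun h => h.slope.natAbs) = 2 • μ.parts := by
  refine Eq.trans ?_ ((isState (W := W) (Nat.zero_le _)).partition_parts.symm.trans hμ)
  refine Multiset.map_eq_map_of_bij_of_nodup _ _ (Finset.nodup _) (Finset.nodup _)
    (fun (h : W.HalfEdge) _ => h.toEdge) ?_ ?_ ?_ ?_
  · intro h hh
    obtain ⟨h1, h2⟩ := (Finset.mem_filter.1 hh).2
    have h1 := (HalfEdge.inv_eq_iff h).1 h1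
    refine mem_present.2 ⟨?_, Nat.zero_le _⟩
    rcases h with ⟨e, he⟩ | ⟨e, he⟩
    · simp only [HalfEdge.toEdge, Sum.elim_inl] at h1 ⊢
      lia
    · exact absurd h2 (HalfEdge.slope_inr_pos _).not_gt
  · intro h hh h' hh' heq
    have h2 := (Finset.mem_filter.1 hh).2.2
    have h2' := (Finset.mem_filter.1 hh').2.2
    rcases h with ⟨e, he⟩ | ⟨e, he⟩
    · rcases h' with ⟨e', he'⟩ | ⟨e', he'⟩
      · exact congrArg Sum.inl (Subtype.ext heq)
      · exact absurd h2' (HalfEdge.slope_inr_pos _).not_gt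
    · exact absurd h2 (HalfEdge.slope_inr_pos _).not_gt
  · intro e he
    have he := mem_present.1 he
    have hd := e.birth_pos_or_death_lt.resolve_left (by lia)
    refine ⟨.inl ⟨e, hd⟩, Finset.mem_filter.2 ⟨Finset.mem_univ _, ?_, ?_⟩, rfl⟩
    · exact HalfEdge.inv_inl_of_not hd (by lia)
    · exact HalfEdge.slope_inl_neg _
  · exact fun h _ => h.natAbs_slope

/-- The ends over the right ray. -/
theorem map_weight_right {_ : DecidablePred fun h : W.HalfEdge => h.inv = h ∧ 0 < h.slope}
    (hν : HasDoubledCycleType (W.σ (numBranch g μ ν)) ν) :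
    ((Finset.univ.filter fun h : W.HalfEdge => h.inv = h ∧ 0 < h.slope).val.map
      fun h => h.slope.natAbs) = 2 • ν.parts := by
  refine Eq.trans ?_ ((isState (W := W) le_rfl).partition_parts.symm.trans hν)
  refine Multiset.map_eq_map_of_bij_of_nodup _ _ (Finset.nodup _) (Finset.nodup _)
    (fun (h : W.HalfEdge) _ => h.toEdge) ?_ ?_ ?_ ?_
  · intro h hh
    obtain ⟨h1, h2⟩ := (Finset.mem_filter.1 hh).2
    have h1 := (HalfEdge.inv_eq_iff h).1 h1
    refine mem_present.2 ?_
    rcases h with ⟨e, he⟩ | ⟨e, he⟩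
    · exact absurd h2 (HalfEdge.slope_inl_neg _).not_gt
    · have := e.birth_le_death
      have := e.death_le
      simp only [HalfEdge.toEdge, Sum.elim_inr] at h1 ⊢
      lia
  · intro h hh h' hh' heq
    have h2 := (Finset.mem_filter.1 hh).2.2
    have h2' := (Finset.mem_filter.1 hh').2.2
    rcases h with ⟨e, he⟩ | ⟨e, he⟩
    · exact absurd h2 (HalfEdge.slope_inl_neg _).not_gt
    · rcases h' with ⟨e', he'⟩ | ⟨e', he'⟩
      · exact absurd h2' (HalfEdge.slope_inl_neg _).not_gt
      · exact congrArg Sum.inr (Subtype.ext heq)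
  · intro e he
    have he := mem_present.1 he
    have hd := e.birth_pos_or_death_lt.resolve_right (by lia)
    refine ⟨.inr ⟨e, hd⟩, Finset.mem_filter.2 ⟨Finset.mem_univ _, ?_, ?_⟩, rfl⟩
    · exact HalfEdge.inv_inr_of_not (by lia) hd
    · exact HalfEdge.slope_inr_pos _
  · exact fun h _ => h.natAbs_slope

theorem HalfEdge.length_iota (h : W.HalfEdge) : h.iota.toEdge.length p = h.toEdge.length p := by
  rw [toEdge_iota, Edge.length, Edge.length]
  simp only [Edge.birth_iota, Edge.death_iota, Edge.weight_iota]
  by_cases h' : 0 < h.toEdge.birth ∧ h.toEdge.death < numBranch g μ ν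
  · rw [dif_pos h', dif_pos h', endVertex_iota _ h'.2, startVertex_iota _ h'.1]
    rfl
  · rw [dif_neg h', dif_neg h']

theorem HalfEdge.slope_iota (h : W.HalfEdge) : h.iota.slope = h.slope := by
  rcases h with ⟨e, he⟩ | ⟨e, he⟩
  · change -(e.iota.weight : ℤ) = -(e.weight : ℤ)
    rw [Edge.weight_iota]
  · change (e.iota.weight : ℤ) = (e.weight : ℤ)
    rw [Edge.weight_iota]

theorem HalfEdge.weight_eq {h k : W.HalfEdge} (hhk : h.root = k.root)
    (h4 : Nat.card {l : W.HalfEdge // l.root = h.root} = 4) :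
    h.slope.natAbs = k.slope.natAbs := by
  rw [natAbs_slope, natAbs_slope]
  rcases valence_cases (W := W) h.root.1.1 with
    ⟨a, b, hab, hfib, ha, hb, -⟩ | ⟨a, hfib, ha, -, w, hw⟩
  · rcases (hfib _).1 rfl with h1 | h1
    · rw [← h1] at ha
      exact absurd (ha.symm.trans h4) (by decide)
    · rw [← h1] at hb
      exact absurd (hb.symm.trans h4) (by decide)
  · have h1 := (hfib _).1 rfl
    rw [hw h h1, hw k (hhk.symm.trans h1)]

theorem Vertex.iota_eq_iff (v : W.Vertex) :
    v.iota = v ↔ Nat.card {h : W.HalfEdge // h.root = v} = 4 := by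
  rcases valence_cases (W := W) v.1.1 with
    ⟨a, b, hab, hfib, ha, hb, hτ⟩ | ⟨a, hfib, ha, hτ, -⟩
  · have hιa : a.iota = b := Subtype.ext (Prod.ext
      (((hfib a).2 (.inl rfl)).trans ((hfib b).2 (.inr rfl)).symm) hτ.symm)
    have hιb : b.iota = a := by rw [← hιa, Vertex.iota_iota]
    rcases (hfib v).1 rfl with h1 | h1
    · rw [h1, hιa]
      exact ⟨fun h => absurd h.symm hab, fun h => absurd (ha.symm.trans h) (by decide)⟩
    · rw [h1, hιb]
      exact ⟨fun h => absurd h hab, fun h => absurd (hb.symm.trans h) (by decide)⟩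
  · rw [(hfib v).1 rfl]
    exact ⟨fun _ => ha, fun _ => Subtype.ext (Prod.ext rfl hτ)⟩

variable (W) in
/-- The twisted tropical cover of a factorisation. -/
noncomputable def twistedCover (hp : StrictMono p) (hμ : HasDoubledCycleType (W.σ 0) μ)
    (hν : HasDoubledCycleType (W.σ (numBranch g μ ν)) ν) : TwistedTropicalCover g μ ν p where
  toTropicalCover := W.cover hp
  iotaV := Vertex.iota
  iotaH := HalfEdge.iota
  iotaV_iotaV := Vertex.iota_iota
  iotaH_iotaH := HalfEdge.iota_iota
  iota_root := HalfEdge.root_iota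
  iota_inv := HalfEdge.inv_iota
  iota_length := HalfEdge.length_iota
  iota_pos v := rfl
  iota_slope := HalfEdge.slope_iota
  pos_mem v := ⟨_, rfl⟩
  fibre i := by
    rcases valence_cases (W := W) i with ⟨a, b, hab, hfib, ha, hb, -⟩ | ⟨a, hfib, ha, -⟩
    · refine .inl ⟨a, b, hab, ?_, ha, hb⟩
      ext u
      exact hp.injective.eq_iff.trans (hfib u)
    · refine .inr ⟨a, ?_, ha⟩
      ext u
      exact hp.injective.eq_iff.trans (hfib u)
  weight_fourValent _ _ := HalfEdge.weight_eq
  fixed_iff := Vertex.iota_eq_iff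
  iotaH_ne := HalfEdge.iota_ne
  left_ends := map_weight_left hμ
  right_ends := map_weight_right hν

end TwistedCover

end Factorisation

/-! ### The labelling of the cover of a factorisation -/

/-- States are transported along injective renamings of the edges. -/
theorem IsState.map {P E E' : Type*} [Fintype P] [DecidableEq P] [DecidableEq E] [DecidableEq E']
    {Λ : PairedEdges E} {Λ' : PairedEdges E'} {τ : Perm P} {S : Finset E} {ω : Perm P × (P → E)}
    (h : IsState Λ τ S ω) (f : E ↪ E') (hiota : ∀ e, f (Λ.iota e) = Λ'.iota (f e))
    (hweight : ∀ e, Λ'.weight (f e) = Λ.weight e) :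
    IsState Λ' τ (S.map f) (ω.1, f ∘ ω.2) where
  balanced := h.balanced
  mem z := Finset.mem_map_of_mem f (h.mem z)
  label_tau z := by simp only [Function.comp_apply, h.label_tau, hiota]
  sameCycle z u := by simp only [Function.comp_apply, h.sameCycle, f.injective.eq_iff]
  card e he := by
    obtain ⟨e, he', rfl⟩ := Finset.mem_map.1 he
    simp only [Function.comp_apply, f.injective.eq_iff, hweight, h.card e he']

section

open scoped Classical

variable {n g : ℕ} {μ ν : n.Partition} {p : Fin (numBranch g μ ν) → ℝ}
variable {X : TwistedTropicalCover g μ ν p} {hp : StrictMono p} {i : ℕ} {h : X.H}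

theorem mem_site_dying : h ∈ (site X hp i).dying ↔ IsRep X h ∧ death X h = i := by
  simp [site]

theorem mem_site_born : h ∈ (site X hp i).born ↔ IsRep X h ∧ birth X h = i + 1 := by
  simp [site]

end

namespace Factorisation

open scoped Classical

section Rep

variable {P : Type} [Fintype P] [DecidableEq P] {τ : Perm P} {m : ℕ} {W : Factorisation τ m}

/-- The half-edge at the right end of an edge, or its only half-edge. -/
noncomputable def Edge.rep (e : W.Edge) : W.HalfEdge :=
  if h : e.death < m then .inl ⟨e, h⟩ else .inr ⟨e, e.birth_pos_or_death_lt.resolve_right h⟩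

theorem Edge.rep_of_lt {e : W.Edge} (h : e.death < m) : e.rep = .inl ⟨e, h⟩ := dif_pos h

theorem Edge.rep_of_not {e : W.Edge} (h : ¬ e.death < m) :
    e.rep = .inr ⟨e, e.birth_pos_or_death_lt.resolve_right h⟩ := dif_neg h

theorem Edge.toEdge_rep (e : W.Edge) : e.rep.toEdge = e := by
  by_cases h : e.death < m
  · rw [rep_of_lt h]; rfl
  · rw [rep_of_not h]; rfl

theorem Edge.slope_rep_neg_iff (e : W.Edge) : e.rep.slope < 0 ↔ e.death < m := by
  by_cases h : e.death < m
  · rw [rep_of_lt h]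
    exact ⟨fun _ => h, fun _ => HalfEdge.slope_inl_neg _⟩
  · rw [rep_of_not h]
    exact ⟨fun h' => absurd h' (HalfEdge.slope_inr_pos _).not_gt, fun h' => absurd h' h⟩

theorem Edge.root_inv_rep {e : W.Edge} (h : 0 < e.birth) :
    e.rep.inv.root = e.startVertex h := by
  by_cases h' : e.death < m
  · rw [rep_of_lt h', HalfEdge.inv_inl_of_pos h' h]; rfl
  · rw [rep_of_not h', HalfEdge.inv_inr_of_not h' h]; rfl

theorem Edge.root_rep {e : W.Edge} (h : e.death < m) : e.rep.root = e.endVertex h := by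
  rw [rep_of_lt h]; rfl

theorem Edge.iota_rep (e : W.Edge) : e.iota.rep = e.rep.iota := by
  by_cases h : e.death < m
  · rw [rep_of_lt h, rep_of_lt (e := e.iota) (by rwa [death_iota])]; rfl
  · rw [rep_of_not h, rep_of_not (e := e.iota) (by rwa [death_iota])]; rfl

theorem HalfEdge.rep_toEdge_iff (h : W.HalfEdge) :
    h.toEdge.rep = h ↔ h.slope < 0 ∨ h.inv = h := by
  rcases h with ⟨e, he⟩ | ⟨e, he⟩
  · exact ⟨fun _ => .inl (slope_inl_neg _), fun _ => Edge.rep_of_lt he⟩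
  · rw [inv_eq_iff]
    change e.rep = _ ↔ _ ∨ ¬ (0 < e.birth ∧ e.death < m)
    by_cases h' : e.death < m
    · rw [Edge.rep_of_lt h']
      simp [h', he, (slope_inr_pos _).not_gt]
    · rw [Edge.rep_of_not h']
      simp [h']

/-- The representation of the edges by half-edges. -/
noncomputable def repEmbedding : W.Edge ↪ W.HalfEdge :=
  ⟨Edge.rep, fun e e' h => by rw [← e.toEdge_rep, h, e'.toEdge_rep]⟩

end Rep

section TwistedCover

variable {n g : ℕ} {μ ν : n.Partition} {p : Fin (numBranch g μ ν) → ℝ}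
variable {W : Factorisation (tau n) (numBranch g μ ν)} (hp : StrictMono p)
  (hμ : HasDoubledCycleType (W.σ 0) μ) (hν : HasDoubledCycleType (W.σ (numBranch g μ ν)) ν)

theorem nondegenerate_twistedCover : Nondegenerate (W.twistedCover hp hμ hν) := by
  rintro (e | e)
  · exact (HalfEdge.slope_inl_neg e).ne
  · exact (HalfEdge.slope_inr_pos e).ne'

theorem time_twistedCover (v : W.Vertex) : time (W.twistedCover hp hμ hν) v = v.1.1 :=
  (time_eq_iff hp).2 rfl

theorem birth_rep (e : W.Edge) : birth (W.twistedCover hp hμ hν) e.rep = e.birth := by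
  by_cases h : 0 < e.birth
  · refine (if_neg ?_).trans ?_
    · rintro ⟨h1, h2⟩
      have h1 := (HalfEdge.inv_eq_iff e.rep).1 h1
      have h2 := e.slope_rep_neg_iff.1 h2
      rw [Edge.toEdge_rep] at h1
      exact h1 ⟨h, h2⟩
    · have h1 : time (W.twistedCover hp hμ hν) e.rep.inv.root = e.rep.inv.root.1.1 :=
        time_twistedCover hp hμ hν _
      rw [Edge.root_inv_rep h] at h1
      have h2 : ((e.startVertex h).1.1 : ℕ) + 1 = e.birth := Nat.sub_add_cancel h
      rw [← h2, ← h1, ← Edge.root_inv_rep h]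
      rfl
  · refine (if_pos ⟨?_, ?_⟩).trans (by lia)
    · refine (HalfEdge.inv_eq_iff e.rep).2 ?_
      rw [Edge.toEdge_rep]
      exact fun h' => h h'.1
    · exact e.slope_rep_neg_iff.2 (e.birth_pos_or_death_lt.resolve_left h)

theorem death_rep (e : W.Edge) : TwistedHurwitz.death (W.twistedCover hp hμ hν) e.rep = e.death := by
  by_cases h : e.death < numBranch g μ ν
  · refine (if_pos (e.slope_rep_neg_iff.2 h)).trans ?_
    have h1 : time (W.twistedCover hp hμ hν) e.rep.root = e.rep.root.1.1 :=
      time_twistedCover hp hμ hν _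
    rw [Edge.root_rep h] at h1
    have h2 : ((e.endVertex h).1.1 : ℕ) = e.death := rfl
    rw [← h2, ← h1, ← Edge.root_rep h]
    rfl
  · refine (if_neg fun h' => h (e.slope_rep_neg_iff.1 h')).trans ?_
    have := e.death_le
    lia

theorem alive_twistedCover (k : ℕ) :
    alive (W.twistedCover hp hμ hν) k = (W.present k).map repEmbedding := by
  ext (h : W.HalfEdge)
  refine (mem_alive (X := W.twistedCover hp hμ hν) (h := h)).trans (Iff.trans ?_
    Finset.mem_map.symm)
  constructor
  · rintro ⟨h1, h2⟩
    have h3 := h.rep_toEdge_iff.2 h1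
    refine ⟨h.toEdge, ?_, h3⟩
    rw [← h3, birth_rep, death_rep] at h2
    exact mem_present.2 h2
  · rintro ⟨e, he, rfl⟩
    refine ⟨(HalfEdge.rep_toEdge_iff e.rep).1 (by rw [Edge.toEdge_rep]), ?_⟩
    rw [mem_present, ← birth_rep hp hμ hν, ← death_rep hp hμ hν] at he
    exact he

theorem isState_twistedCover {k : ℕ} (hk : k ≤ numBranch g μ ν) :
    IsState (pairedEdges (W.twistedCover hp hμ hν) (nondegenerate_twistedCover hp hμ hν)) (tau n)
      (alive (W.twistedCover hp hμ hν) k) (W.σ k, fun z => (edge k hk z).rep) := by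
  rw [alive_twistedCover]
  refine (isState hk).map (Λ' := pairedEdges (W.twistedCover hp hμ hν)
    (nondegenerate_twistedCover hp hμ hν)) repEmbedding (fun e => e.iota_rep) fun e => ?_
  refine (HalfEdge.natAbs_slope e.rep).trans ?_
  rw [Edge.toEdge_rep]
  rfl

theorem mem_dying_rep (i : Fin (numBranch g μ ν)) (z : Fin n ⊕ Fin n) :
    (edge (W := W) i i.2.le z).rep ∈ (site (W.twistedCover hp hμ hν) hp i).dying ↔
      W.Active i z := by
  rw [← death_edge]
  refine mem_site_dying.trans ?_
  rw [death_rep]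
  refine ⟨fun h => h.2, fun h => ⟨?_, h⟩⟩
  exact (HalfEdge.rep_toEdge_iff _).1 (by rw [Edge.toEdge_rep])

/-- The cover of a factorisation with its tautological labelling. -/
theorem isLabelling_twistedCover :
    IsLabelling hp (nondegenerate_twistedCover hp hμ hν)
      (fun k => (W.σ k, fun z => (edge k (by lia) z).rep), fun i => W.η i) := by
  refine ⟨isState_twistedCover hp hμ hν (Nat.zero_le _), fun i => ?_⟩
  have hroot : ∀ z (hz : W.Active i z),
      (edge (W := W) i i.2.le z).rep.root = vertex i z hz := by
    intro z hz
    have hd : (edge (W := W) i i.2.le z).death < numBranch g μ ν := by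
      rw [death_edge.2 hz]; exact i.2
    rw [Edge.root_rep hd]
    exact endVertex_eq hz rfl hd
  refine ⟨W.isSwap i i.2, W.ne i i.2, W.step i i.2, fun z hz => ?_, fun z hz => ⟨?_, ?_⟩,
    fun z hz => ⟨?_, ?_⟩, isState_twistedCover hp hμ hν i.2⟩
  · have hz : ¬ W.Active i z := fun h => hz ((mem_dying_rep hp hμ hν i z).2 h)
    have h1 : edge (W := W) (i + 1) i.2 z = edge i i.2.le z :=
      Subtype.ext (label_succ_of_not_active hz)
    exact congrArg Edge.rep h1
  · have hz := (mem_dying_rep hp hμ hν i z).1 hz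
    refine mem_site_born.2 ⟨?_, ?_⟩
    · exact (HalfEdge.rep_toEdge_iff _).1 (by rw [Edge.toEdge_rep])
    · exact (birth_rep hp hμ hν _).trans (birth_edge hz)
  · have hz := (mem_dying_rep hp hμ hν i z).1 hz
    have hb : 0 < (edge (W := W) (i + 1) i.2 z).birth := by rw [birth_edge hz]; lia
    refine (Edge.root_inv_rep hb).trans (Eq.trans ?_ (hroot z hz).symm)
    exact startVertex_eq hz rfl hb
  · exact (mem_dying_rep hp hμ hν i z).2 (.inl (touched_of_ne hz))
  · have h1 : Touched (W.η i) (W.σ i) z := touched_of_ne hz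
    have h2 : Touched (W.η i) (W.σ i) (W.η i z) :=
      touched_of_ne fun h => hz ((W.η i).injective h)
    refine (hroot _ (.inl h2)).trans (Eq.trans ?_ (hroot z (.inl h1)).symm)
    exact vertex_eq_iff.2 ⟨rfl, star_eq_of_mem i.2 (mem_star.2 (.inl ⟨h1, h2⟩))⟩

end TwistedCover

end Factorisation

/-! ### The correspondence -/

section Correspondence

open scoped Classical

variable {n g : ℕ} {μ ν : n.Partition} {p : Fin (numBranch g μ ν) → ℝ}

theorem numBranch_pos (hn : 0 < n) : 0 < numBranch g μ ν := by
  have key : ∀ lam : n.Partition, 0 < Multiset.card lam.parts := by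
    intro lam
    rw [Multiset.card_pos]
    intro h
    have := lam.parts_sum
    rw [h, Multiset.sum_zero] at this
    lia
  have := key μ
  have := key ν
  rw [numBranch]
  lia

/-- The intermediate products of a factorisation, constant after the last step. -/
def intermediate {P : Type*} (τ : Perm P) {m : ℕ} (σ₁ : Perm P) (η : Fin m → Perm P) : ℕ → Perm P
  | 0 => σ₁
  | k + 1 => if h : k < m then twist τ (η ⟨k, h⟩) (intermediate τ σ₁ η k)
      else intermediate τ σ₁ η k

theorem intermediate_succ {P : Type*} (τ : Perm P) {m : ℕ} (σ₁ : Perm P) (η : Fin m → Perm P)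
    (i : Fin m) : intermediate τ σ₁ η (i + 1) = twist τ (η i) (intermediate τ σ₁ η i) := by
  rw [intermediate, dif_pos i.2]

theorem mem_of_isPretransitive {P : Type*} {A : Set (Perm P)}
    (h : MulAction.IsPretransitive (Subgroup.closure A) P) {S : Set P} (hS : S.Nonempty)
    (hA : ∀ ρ ∈ A, ∀ z, ρ z ∈ S ↔ z ∈ S) (u : P) : u ∈ S := by
  obtain ⟨z, hz⟩ := hS
  obtain ⟨⟨ρ, hρ⟩, hu⟩ := h.exists_smul_eq z u
  have key : ∀ ρ ∈ Subgroup.closure A, ∀ w, ρ w ∈ S ↔ w ∈ S := by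
    intro ρ hρ
    induction hρ using Subgroup.closure_induction with
    | mem ρ hρ => exact hA ρ hρ
    | one => exact fun w => Iff.rfl
    | mul ρ ρ' _ _ ih ih' => exact fun w => (ih (ρ' w)).trans (ih' w)
    | inv ρ _ ih => exact fun w => by rw [← ih]; simp
  have hu : ρ z = u := hu
  rwa [← hu, key ρ hρ]

/-- A tuple in `C_g(μ, ν)` with its intermediate products is a `Factorisation`. -/
theorem exists_factorisation (hn : 0 < n) {σ₁ σ₂ : Perm (Fin n ⊕ Fin n)}
    {η : Fin (numBranch g μ ν) → Perm (Fin n ⊕ Fin n)}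
    (h : (σ₁, η, σ₂) ∈ twistedFactorisations g μ ν) :
    ∃ W : Factorisation (tau n) (numBranch g μ ν), W.σ 0 = σ₁ ∧ W.σ (numBranch g μ ν) = σ₂ ∧
      (fun i : Fin (numBranch g μ ν) => W.η i) = η := by
  obtain ⟨h1, h2, h3, ⟨h4, -⟩, h5, h6⟩ := h
  have hlast : intermediate (tau n) σ₁ η (numBranch g μ ν) = σ₂ := by
    rw [← h5]
    exact (prod_reverse_mul_mul_prod (tau n) (fun k => intermediate (tau n) σ₁ η k) η
      fun i => intermediate_succ (tau n) σ₁ η i).symm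
  refine ⟨
    { σ := intermediate (tau n) σ₁ η
      η := fun k => if h : k < numBranch g μ ν then η ⟨k, h⟩ else 1
      invol := tau_isFreeInvolution n
      balanced_zero := mem_BTilde_iff.1 h4
      isSwap := fun i hi => by rw [dif_pos hi]; exact (h3 _).1
      ne := fun i hi => by rw [dif_pos hi]; exact (h3 _).2
      step := fun i hi => by rw [dif_pos hi]; exact intermediate_succ (tau n) σ₁ η ⟨i, hi⟩
      pos := numBranch_pos hn
      transitive := ?_ }, rfl, hlast, funext fun i => dif_pos i.2⟩
  intro S hS s1 s2 s3 s4
  refine mem_of_isPretransitive h6 hS ?_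
  rintro ρ (((rfl | rfl) | ⟨i, rfl⟩) | ⟨i, rfl⟩)
  · exact s1
  · rwa [hlast] at s2
  · have s3 := s3 i i.2
    rwa [dif_pos i.2] at s3
  · have s4 := s4 i i.2
    rwa [dif_pos i.2] at s4

/-- Every twisted factorisation comes from a labelling of some cover. -/
theorem exists_isLabelling (hn : 0 < n) (hp : StrictMono p) {σ₁ σ₂ : Perm (Fin n ⊕ Fin n)}
    {η : Fin (numBranch g μ ν) → Perm (Fin n ⊕ Fin n)}
    (h : (σ₁, η, σ₂) ∈ twistedFactorisations g μ ν) :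
    ∃ (X : TwistedTropicalCover g μ ν p) (hX : Nondegenerate X) (x : Movie X),
      IsLabelling hp hX x ∧ (x.1 0).1 = σ₁ ∧ x.2 = η := by
  obtain ⟨W, rfl, rfl, hη⟩ := exists_factorisation hn h
  exact ⟨W.twistedCover hp h.1 h.2.1, Factorisation.nondegenerate_twistedCover hp h.1 h.2.1, _,
    Factorisation.isLabelling_twistedCover hp h.1 h.2.1, rfl, hη⟩

/-- The number of factorisations over a class of covers, with respect to an assignment of
labelled covers to the factorisations. -/
theorem card_fibre (hp : StrictMono p)
    {X : twistedFactorisations g μ ν → TwistedTropicalCover g μ ν p}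
    (hX : ∀ f, Nondegenerate (X f)) {x : ∀ f, Movie (X f)}
    (hx : ∀ f, IsLabelling hp (hX f) (x f)) (h1 : ∀ f, ((x f).1 0).1 = f.1.1)
    (h2 : ∀ f, (x f).2 = f.1.2.1) (Y : TwistedTropicalCover g μ ν p) :
    (Nat.card {f // Nonempty (TwistedTropicalCover.Iso (X f) Y)} : ℚ) =
      Nat.doubleFactorial (2 * n) * Y.multiplicity := by
  by_cases hY : Nondegenerate Y
  · let F : {y : Movie Y // IsLabelling hp hY y} →
        {f // Nonempty (TwistedTropicalCover.Iso (X f) Y)} := fun y =>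
      ⟨⟨_, y.2.mem_twistedFactorisations⟩, by
        obtain ⟨φ, -⟩ := (hx ⟨_, y.2.mem_twistedFactorisations⟩).exists_iso y.2 (h1 _) (h2 _)
        exact ⟨φ⟩⟩
    -- every labelling of `Y` has a factorisation; the labellings over one of them form a torsor
    have hF : ∀ f, Nat.card {y // F y = f} = Y.autCard := by
      rintro ⟨f, ⟨φ⟩⟩
      have hy := (hx f).iso φ hY
      rw [← card_isLabelling_over hy]
      refine Nat.card_congr ⟨fun y => ⟨y.1.1, y.1.2, ?_, ?_⟩, fun y => ⟨⟨y.1, y.2.1⟩, ?_⟩,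
        fun _ => rfl, fun _ => rfl⟩
      · have := congrArg (fun f => f.1.1.1) y.2
        exact this.trans (h1 f).symm
      · have := congrArg (fun f => f.1.1.2.1) y.2
        exact this.trans (h2 f).symm
      · have e1 : (y.1.1 0).1 = f.1.1 := y.2.2.1.trans (h1 f)
        have e2 : y.1.2 = f.1.2.1 := y.2.2.2.trans (h2 f)
        refine Subtype.ext (Subtype.ext (Prod.ext e1 (Prod.ext e2 ?_)))
        have e3 := y.2.1.mem_twistedFactorisations.2.2.2.2.1
        have e4 : _ * f.1.1 * _ = f.1.2.2 := f.2.2.2.2.2.1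
        rw [← e4, ← e1, ← e2]
        exact e3.symm
    have hcard := card_isLabelling_eq_multiplicity hp hY
    have : Fintype {f // Nonempty (TwistedTropicalCover.Iso (X f) Y)} := Fintype.ofFinite _
    rw [← Nat.card_congr (Equiv.sigmaFiberEquiv F), Nat.card_sigma,
      Finset.sum_congr rfl fun f _ => hF f, Finset.sum_const, Finset.card_univ,
      ← Nat.card_eq_fintype_card, smul_eq_mul] at hcard
    have h0 : (Y.autCard : ℚ) ≠ 0 := by exact_mod_cast autCard_pos.ne'
    apply mul_right_cancel₀ h0
    rw [← Nat.cast_mul, hcard]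
    ring
  · rw [multiplicity_eq_zero hY, mul_zero, Nat.cast_eq_zero]
    have : IsEmpty {f // Nonempty (TwistedTropicalCover.Iso (X f) Y)} :=
      ⟨fun ⟨f, ⟨φ⟩⟩ => hY (nondegenerate_of_iso φ (hX f))⟩
    exact Nat.card_of_isEmpty

end Correspondence

end TwistedHurwitz

theorem theorem4 (g n : ℕ) (hn : 0 < n) (μ ν : n.Partition)
    (p : Fin (numBranch g μ ν) → ℝ) (hp : StrictMono p) :
    (Function.support fun c : TwistedTropicalCoverClass g μ ν p => c.multiplicity).Finite ∧
      twistedHurwitz g μ ν = tropicalTwistedHurwitz g μ ν p := by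
  classical
  choose X hX x hx h1 h2 using fun f : twistedFactorisations g μ ν =>
    TwistedHurwitz.exists_isLabelling (p := p) hn hp f.2
  let cls : twistedFactorisations g μ ν → TwistedTropicalCoverClass g μ ν p :=
    fun f => Quotient.mk (TwistedTropicalCover.setoid g μ ν p) (X f)
  have : Fintype (twistedFactorisations g μ ν) := Fintype.ofFinite _
  have hpos : ((Nat.doubleFactorial (2 * n) : ℕ) : ℚ) ≠ 0 := by
    exact_mod_cast (Nat.doubleFactorial_pos _).ne'
  have hcard : ∀ c, (((Finset.univ.filter fun f => cls f = c).card : ℕ) : ℚ) =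
      Nat.doubleFactorial (2 * n) * c.multiplicity := by
    intro c
    obtain ⟨Y, rfl⟩ := Quotient.exists_rep c
    refine Eq.trans ?_ (TwistedHurwitz.card_fibre hp hX hx h1 h2 Y)
    rw [← Fintype.card_subtype, ← Nat.card_eq_fintype_card]
    congr 1
    exact Nat.card_congr (Equiv.subtypeEquivRight fun f => Quotient.eq'')
  have hsupp : (Function.support fun c : TwistedTropicalCoverClass g μ ν p => c.multiplicity) ⊆
      (Finset.univ.image cls : Finset _) := by
    intro c hc
    have h3 := hcard c
    have h4 : (Finset.univ.filter fun f => cls f = c).card ≠ 0 := by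
      intro h0
      rw [h0, Nat.cast_zero, zero_eq_mul] at h3
      exact hc (h3.resolve_left hpos)
    obtain ⟨f, hf⟩ := Finset.card_pos.1 (Nat.pos_of_ne_zero h4)
    rw [Finset.mem_filter] at hf
    exact Finset.mem_coe.2 (Finset.mem_image.2 ⟨f, hf⟩)
  refine ⟨(Finset.finite_toSet _).subset hsupp, ?_⟩
  rw [twistedHurwitz, tropicalTwistedHurwitz, finsum_eq_sum_of_support_subset _ hsupp,
    div_eq_iff hpos, Nat.card_eq_fintype_card, ← Finset.card_univ,
    Finset.card_eq_sum_card_image cls, Nat.cast_sum, Finset.sum_mul]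
  refine Finset.sum_congr rfl fun c _ => ?_
  rw [hcard, mul_comm]
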